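/- **Conventions.** A first order differential calculus on an algebra $A$ is an $A$-bimodule $\Gamma$ with a derivation $d:A\to\Gamma$ such that $\Gamma=A\,dA$. A differential calculus on $A$ is a differential graded algebra $\Omega^\bullet(A)=\bigoplus_{k\ge0}\Omega^k(A)$ with $\Omega^0(A)=A$ such that $\Omega^k(A)$ is spanned by the forms $a^0da^1\wedge\dots\wedge da^k$. The maximal prolongation of $(\Gamma,d)$ is the calculus $T_A(\Gamma)/S^\wedge$, where $S^\wedge$ is the two-sided ideal generated by the elements $\sum_i da^i\otimes db^i$ with $\sum_i a^i\,db^i=0$. The tensor product $\Omega^\bullet(A)\otimes\Omega^\bullet(H)$ carries the product $(\omega\otimes\eta)\wedge(\omega'\otimes\eta')=(-1)^{|\eta||\omega'|}\,\omega\wedge\omega'\otimes\eta\wedge\eta'$ and the differential $d\otimes\mathrm{id}+(-1)^{|\cdot|}\otimes d$. For a Hopf algebra $H$, a right $H$-comodule algebra $(A,\Delta_A)$ and calculi on $A$ and $H$, the calculus $\Omega^\bullet(A)$ is called complete if $\Delta_A$ extends to a morphism of differential graded algebras $\Delta_A^\bullet:\Omega^\bullet(A)\to\Omega^\bullet(A)\otimes\Omega^\bullet(H)$.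 Then $\Delta_{\Omega^k(A)}$ and $\mathrm{ver}^{i,j}$ denote the components of $\Delta_A^\bullet$ with values in $\Omega^k(A)\otimes H$ and in $\Omega^i(A)\otimes\Omega^j(H)$. The calculus $\Omega^\bullet(A)$ is right $H$-covariant if $\Delta_A$ extends to a graded right $H$-comodule algebra structure $\Omega^\bullet(A)\to\Omega^\bullet(A)\otimes H$ for which $d$ is colinear; left covariance is defined likewise, and a calculus on $H$ is bicovariant if it is left and right covariant for the coproduct. Let $H=\mathcal O(U(1))=\mathbb C[t,t^{-1}]$ with $\Delta(t)=t\otimes t$, $\varepsilon(t)=1$, $S(t)=t^{-1}$. For $p\in\mathbb C^\times$ (in applications $p=q^\alpha$) let $\Omega^\bullet(H)$ be the maximal prolongation of the first order calculus on $H$ that is free on $dt$ as a left $H$-module and has $t\,dt=p\,dt\,t$. Let $\theta\in\mathbb R$, let $A=\mathcal O_\theta(\mathbb T^2)=\mathbb C\langle u,u^{-1},v,v^{-1}\rangle/\langle uv-e^{-i\theta}vu\rangle$, and let $\Delta_A:A\to A\otimes H$ be the algebra map $u\mapsto u\otimes t$, $v\mapsto v\otimes t^{-1}$. Let $\Omega^\bullet(A)$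 be the maximal prolongation of the first order calculus on $A$ that is free on $du,dv$ as a left $A$-module and has $$du\,u=u\,du,\qquad dv\,v=v\,dv,\qquad du\,v=e^{-i\theta}v\,du,\qquad dv\,u=e^{i\theta}u\,dv .$$ **Theorem.** 1. *(Calculus on $\mathcal O(U(1))$.)* For every $p\in\mathbb C^\times$: $t\,dt=p\,dt\,t$ and $t^{-1}dt=p^{-1}dt\,t^{-1}$; $\Omega^1(H)$ is free on $dt$ as a left $H$-module; $dt\wedge dt=-p\,dt\wedge dt$; if $p\neq-1$, then $dt\wedge dt=0$ and $\Omega^k(H)=0$ for all $k\ge2$. Moreover $\Omega^\bullet(H)$ is bicovariant, and the coproduct extends to a unique morphism of differential graded algebras $\Omega^\bullet(H)\to\Omega^\bullet(H)\otimes\Omega^\bullet(H)$. 2. *(Calculus on the torus.)* The four relations above hold in $\Omega^\bullet(A)$, together with $$du\wedge dv+e^{-i\theta}dv\wedge du=0,\qquad du\wedge du=0,\qquad dv\wedge dv=0 .$$ As left $A$-modules, $\Omega^1(A)$ is free on $du,dv$ and $\Omega^2(A)$ is free on $du\wedge dv$, and $\Omega^k(A)=0$ for all $k\ge3$. The map $\Delta_A$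 is a right $H$-coaction, and $\Omega^\bullet(A)$ is right $H$-covariant. 3. *(Completeness.)* Let $\Omega^\bullet(H)$ be the calculus with $p=1$. Then $\Omega^\bullet(A)$ is complete: $\Delta_A$ extends to a morphism of differential graded algebras $\Delta_A^\bullet:\Omega^\bullet(A)\to\Omega^\bullet(A)\otimes\Omega^\bullet(H)$, and this extension is unique. Its components $\Delta_{\Omega^k(A)}$, $k\ge0$, together form a right $H$-coaction that makes $\Omega^\bullet(A)$ right $H$-covariant. On $\Omega^1(A)$ one has $\Delta_A^\bullet=\Delta_{\Omega^1(A)}+\mathrm{ver}^{0,1}$, on $\Omega^2(A)$ one has $\Delta_A^\bullet=\Delta_{\Omega^2(A)}+\mathrm{ver}^{1,1}$, and for all $a,a'\in A$ $$\Delta_{\Omega^1(A)}(a\,du+a'\,dv)=\Delta_A(a)(du\otimes t)+\Delta_A(a')(dv\otimes t^{-1}),$$ $$\mathrm{ver}^{0,1}(a\,du+a'\,dv)=\Delta_A(a)(u\otimes dt)+\Delta_A(a')(v\otimes d(t^{-1})),$$ $$\Delta_{\Omega^2(A)}(a\,du\wedge dv)=\Delta_A(a)(du\wedge dv\otimes1),$$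 $$\mathrm{ver}^{1,1}(a\,du\wedge dv)=\Delta_A(a)\bigl(du\,v\otimes t\,d(t^{-1})-u\,dv\otimes dt\,t^{-1}\bigr),\qquad \mathrm{ver}^{0,2}(a\,du\wedge dv)=0 .$$ -/

import Mathlib

universe u

open scoped TensorProduct DirectSum

noncomputable section

/-- A first order differential calculus `(Γ, d)` on the algebra `A`: an `A`-bimodule `Γ`, with its
right action as an action of `Aᵐᵒᵖ`, and a derivation `d : A → Γ` with `Γ = A dA`. -/
structure FirstOrderCalculus (k A Γ : Type u) [Field k] [Ring A] [Algebra k A]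
    [AddCommGroup Γ] [Module k Γ] [Module A Γ] [Module Aᵐᵒᵖ Γ] [SMulCommClass A Aᵐᵒᵖ Γ]
    [IsScalarTower k A Γ] [IsScalarTower k Aᵐᵒᵖ Γ] where
  d : A →ₗ[k] Γ
  leibniz : ∀ a b : A, d (a * b) = MulOpposite.op b • d a + a • d b
  span_eq_top : Submodule.span k {ω : Γ | ∃ a b : A, ω = a • d b} = ⊤

/-- A differential calculus on the algebra `A`: a differential graded algebra `⨁ₙ Ωⁿ` with
`Ω⁰ = A` that is generated in degree 0, that is, `Ωⁿ` is spanned by the forms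
`a db₁ ∧ ⋯ ∧ dbₙ`. -/
structure DifferentialCalculus (k A : Type u) [Field k] [Ring A] [Algebra k A] where
  Form : Type u
  [ring : Ring Form]
  [algebra : Algebra k Form]
  grade : ℕ → Submodule k Form
  [graded : GradedAlgebra grade]
  incl : A →ₐ[k] Form
  d : Form →ₗ[k] Form
  incl_injective : Function.Injective incl
  range_incl : LinearMap.range incl.toLinearMap = grade 0
  d_mem : ∀ (n : ℕ) (ω : Form), ω ∈ grade n → d ω ∈ grade (n + 1)
  d_d : ∀ ω : Form, d (d ω) = 0
  leibniz : ∀ (n : ℕ) (ω η : Form), ω ∈ grade n → d (ω * η) = d ω * η + (-1 : k) ^ n • (ω * d η)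
  generated : ∀ n : ℕ, grade n = Submodule.span k
    {ω : Form | ∃ (a : A) (b : Fin n → A), ω = incl a * (List.ofFn fun i => d (incl (b i))).prod}

attribute [instance] DifferentialCalculus.ring DifferentialCalculus.algebra
  DifferentialCalculus.graded

namespace FirstOrderCalculus

section Prolongation

variable {k A Γ : Type u} [Field k] [Ring A] [Algebra k A]
    [AddCommGroup Γ] [Module k Γ] [Module A Γ] [Module Aᵐᵒᵖ Γ] [SMulCommClass A Aᵐᵒᵖ Γ]
    [IsScalarTower k A Γ] [IsScalarTower k Aᵐᵒᵖ Γ] (F : FirstOrderCalculus k A Γ)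

/-- The relations that cut `T_A(Γ) / S^∧` out of the free algebra on symbols for the elements
of `A` and `Γ`. -/
inductive Rel : FreeAlgebra k (A ⊕ Γ) → FreeAlgebra k (A ⊕ Γ) → Prop
  | scalar (r : k) : Rel (FreeAlgebra.ι k (Sum.inl (algebraMap k A r))) (algebraMap k _ r)
  | add (a b : A) : Rel (FreeAlgebra.ι k (Sum.inl (a + b)))
      (FreeAlgebra.ι k (Sum.inl a) + FreeAlgebra.ι k (Sum.inl b))
  | mul (a b : A) : Rel (FreeAlgebra.ι k (Sum.inl (a * b)))
      (FreeAlgebra.ι k (Sum.inl a) * FreeAlgebra.ι k (Sum.inl b))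
  | addForm (ω η : Γ) : Rel (FreeAlgebra.ι k (Sum.inr (ω + η)))
      (FreeAlgebra.ι k (Sum.inr ω) + FreeAlgebra.ι k (Sum.inr η))
  | left (a : A) (ω : Γ) : Rel (FreeAlgebra.ι k (Sum.inr (a • ω)))
      (FreeAlgebra.ι k (Sum.inl a) * FreeAlgebra.ι k (Sum.inr ω))
  | right (a : A) (ω : Γ) : Rel (FreeAlgebra.ι k (Sum.inr (MulOpposite.op a • ω)))
      (FreeAlgebra.ι k (Sum.inr ω) * FreeAlgebra.ι k (Sum.inl a))
  | wedge (n : ℕ) (a b : Fin n → A) (h : ∑ i, a i • F.d (b i) = 0) :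
      Rel (∑ i, FreeAlgebra.ι k (Sum.inr (F.d (a i))) * FreeAlgebra.ι k (Sum.inr (F.d (b i)))) 0

/-- The maximal prolongation `Γ^∧ = T_A(Γ) / S^∧` as an algebra, where `S^∧` is the ideal generated
by the elements `∑ᵢ daᵢ ⊗ dbᵢ` with `∑ᵢ aᵢ dbᵢ = 0`. -/
def Wedge : Type u := RingQuot F.Rel

instance : Ring F.Wedge := inferInstanceAs (Ring (RingQuot F.Rel))

instance : Algebra k F.Wedge := inferInstanceAs (Algebra k (RingQuot F.Rel))

/-- The projection onto the quotient. -/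
def quot : FreeAlgebra k (A ⊕ Γ) →ₐ[k] F.Wedge := RingQuot.mkAlgHom k F.Rel

theorem quot_rel {x y : FreeAlgebra k (A ⊕ Γ)} (h : F.Rel x y) : F.quot x = F.quot y :=
  RingQuot.mkAlgHom_rel k h

/-- The functions of `A` as forms of degree 0. -/
def fn : A →ₐ[k] F.Wedge :=
  AlgHom.mk' (R := k)
    { toFun := fun a => F.quot (FreeAlgebra.ι k (Sum.inl a))
      map_one' := by
        have := F.quot_rel (.scalar 1)
        simpa using this
      map_mul' := fun a b => by simpa using F.quot_rel (.mul a b)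
      map_zero' := by simpa using F.quot_rel (.scalar 0)
      map_add' := fun a b => by simpa using F.quot_rel (.add a b) }
    (fun r a => by
      have h1 := F.quot_rel (.scalar r)
      have h2 := F.quot_rel (.mul (algebraMap k A r) a)
      simp only [map_mul, h1] at h2
      simp [Algebra.smul_def, h2])

/-- The elements of `Γ` as forms of degree 1. -/
def form : Γ →ₗ[k] F.Wedge where
  toFun ω := F.quot (FreeAlgebra.ι k (Sum.inr ω))
  map_add' ω η := by simpa using F.quot_rel (.addForm ω η)
  map_smul' r ω := by
    have h1 := F.quot_rel (.scalar r)
    have h2 := F.quot_rel (.left (algebraMap k A r) ω)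
    simp only [map_mul, h1] at h2
    simpa [Algebra.smul_def] using h2

theorem fn_def (a : A) : F.fn a = F.quot (FreeAlgebra.ι k (Sum.inl a)) := rfl

theorem form_def (ω : Γ) : F.form ω = F.quot (FreeAlgebra.ι k (Sum.inr ω)) := rfl

theorem form_left (a : A) (ω : Γ) : F.form (a • ω) = F.fn a * F.form ω := by
  simpa only [fn_def, form_def, map_mul] using F.quot_rel (.left a ω)

theorem form_right (a : A) (ω : Γ) : F.form (MulOpposite.op a • ω) = F.form ω * F.fn a := by
  simpa only [fn_def, form_def, map_mul] using F.quot_rel (.right a ω)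

theorem wedge_eq_zero {n : ℕ} (a b : Fin n → A) (h : ∑ i, a i • F.d (b i) = 0) :
    ∑ i, F.form (F.d (a i)) * F.form (F.d (b i)) = 0 := by
  simpa only [form_def, map_sum, map_mul, map_zero] using F.quot_rel (.wedge n a b h)

/-- Algebra maps out of `Γ^∧`. -/
def lift {B : Type u} [Semiring B] [Algebra k B] (f : A →ₐ[k] B) (g : Γ →+ B)
    (hl : ∀ a ω, g (a • ω) = f a * g ω) (hr : ∀ a ω, g (MulOpposite.op a • ω) = g ω * f a)
    (hw : ∀ (n : ℕ) (a b : Fin n → A), ∑ i, a i • F.d (b i) = 0 →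
      ∑ i, g (F.d (a i)) * g (F.d (b i)) = 0) : F.Wedge →ₐ[k] B :=
  RingQuot.liftAlgHom k ⟨FreeAlgebra.lift k (Sum.elim f g), by
    intro x y h
    induction h with
    | scalar r => simp
    | add a b => simp
    | mul a b => simp
    | addForm ω η => simp
    | left a ω => simp [hl]
    | right a ω => simp [hr]
    | wedge n a b h => simpa using hw n a b h⟩

theorem lift_fn {B : Type u} [Semiring B] [Algebra k B] (f : A →ₐ[k] B) (g : Γ →+ B) (hl hr hw)
    (a : A) : F.lift f g hl hr hw (F.fn a) = f a :=
  (RingQuot.liftAlgHom_mkAlgHom_apply ..).trans (by simp)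

theorem lift_form {B : Type u} [Semiring B] [Algebra k B] (f : A →ₐ[k] B) (g : Γ →+ B) (hl hr hw)
    (ω : Γ) : F.lift f g hl hr hw (F.form ω) = g ω :=
  (RingQuot.liftAlgHom_mkAlgHom_apply ..).trans (by simp)

theorem hom_ext {B : Type u} [Semiring B] [Algebra k B] {φ ψ : F.Wedge →ₐ[k] B}
    (h0 : ∀ a, φ (F.fn a) = ψ (F.fn a)) (h1 : ∀ ω, φ (F.form ω) = ψ (F.form ω)) : φ = ψ := by
  apply RingQuot.ringQuot_ext'
  apply FreeAlgebra.hom_ext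
  funext x
  rcases x with a | ω
  · exact h0 a
  · exact h1 ω

/-- Forms of degree `n`: sums of `a ω₁ ⋯ ωₙ` with `a ∈ A` and `ωᵢ ∈ Γ`. -/
def deg (n : ℕ) : Submodule k F.Wedge :=
  LinearMap.range F.fn.toLinearMap * LinearMap.range F.form ^ n

theorem fn_mem (a : A) : F.fn a ∈ F.deg 0 := by
  simp [deg]

theorem form_mem (ω : Γ) : F.form ω ∈ F.deg 1 := by
  have := Submodule.mul_mem_mul (LinearMap.mem_range_self F.fn.toLinearMap 1)
    (LinearMap.mem_range_self F.form ω)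
  simpa [deg] using this

theorem form_pow_mul_le (n : ℕ) :
    LinearMap.range F.form ^ n * LinearMap.range F.fn.toLinearMap ≤ F.deg n := by
  have key : LinearMap.range F.form * LinearMap.range F.fn.toLinearMap
      ≤ LinearMap.range F.fn.toLinearMap * LinearMap.range F.form := by
    rw [Submodule.mul_le]
    rintro _ ⟨ω, rfl⟩ _ ⟨a, rfl⟩
    have := Submodule.mul_mem_mul (LinearMap.mem_range_self F.fn.toLinearMap 1)
      (LinearMap.mem_range_self F.form (MulOpposite.op a • ω))
    simpa [form_right] using this
  induction n with
  | zero => simp [deg]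
  | succ n ih =>
    unfold deg at *
    calc LinearMap.range F.form ^ (n + 1) * LinearMap.range F.fn.toLinearMap
        = LinearMap.range F.form ^ n *
          (LinearMap.range F.form * LinearMap.range F.fn.toLinearMap) := by
          rw [pow_succ, mul_assoc]
      _ ≤ LinearMap.range F.form ^ n *
          (LinearMap.range F.fn.toLinearMap * LinearMap.range F.form) := by gcongr
      _ = (LinearMap.range F.form ^ n * LinearMap.range F.fn.toLinearMap) *
          LinearMap.range F.form := by rw [mul_assoc]
      _ ≤ (LinearMap.range F.fn.toLinearMap * LinearMap.range F.form ^ n) *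
          LinearMap.range F.form := by gcongr
      _ = _ := by rw [pow_succ, mul_assoc]

theorem range_fn_mul_self : LinearMap.range F.fn.toLinearMap * LinearMap.range F.fn.toLinearMap
    ≤ LinearMap.range F.fn.toLinearMap := by
  rw [Submodule.mul_le]
  rintro _ ⟨a, rfl⟩ _ ⟨b, rfl⟩
  exact ⟨a * b, by simp⟩

theorem deg_mul_deg_le (m n : ℕ) : F.deg m * F.deg n ≤ F.deg (m + n) := by
  calc F.deg m * F.deg n
      = LinearMap.range F.fn.toLinearMap *
        (LinearMap.range F.form ^ m * LinearMap.range F.fn.toLinearMap) *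
        LinearMap.range F.form ^ n := by simp only [deg, mul_assoc]
    _ ≤ LinearMap.range F.fn.toLinearMap *
        (LinearMap.range F.fn.toLinearMap * LinearMap.range F.form ^ m) *
        LinearMap.range F.form ^ n :=
          mul_le_mul_left (mul_le_mul_right (F.form_pow_mul_le m) _) _
    _ = (LinearMap.range F.fn.toLinearMap * LinearMap.range F.fn.toLinearMap) *
        LinearMap.range F.form ^ (m + n) := by simp only [pow_add, mul_assoc]
    _ ≤ _ := mul_le_mul_left F.range_fn_mul_self _

instance gradedMonoid : SetLike.GradedMonoid F.deg where
  one_mem := by simpa using F.fn_mem 1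
  mul_mem m n _ _ hx hy := F.deg_mul_deg_le m n (Submodule.mul_mem_mul hx hy)

/-- A homogeneous form as an element of the direct sum. -/
def single (n : ℕ) (x : F.Wedge) (hx : x ∈ F.deg n) : ⨁ n, F.deg n :=
  DirectSum.of (fun n => F.deg n) n ⟨x, hx⟩

theorem single_mul {m n : ℕ} {x y : F.Wedge} (hx : x ∈ F.deg m) (hy : y ∈ F.deg n) :
    F.single m x hx * F.single n y hy = F.single (m + n) (x * y) (SetLike.mul_mem_graded hx hy) :=
  DirectSum.of_mul_of _ _

theorem single_add {n : ℕ} {x y : F.Wedge} (hx : x ∈ F.deg n) (hy : y ∈ F.deg n) :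
    F.single n x hx + F.single n y hy = F.single n (x + y) (add_mem hx hy) :=
  (map_add (DirectSum.of (fun n => F.deg n) n) _ _).symm

theorem single_smul {n : ℕ} (r : k) {x : F.Wedge} (hx : x ∈ F.deg n) :
    r • F.single n x hx = F.single n (r • x) (Submodule.smul_mem _ r hx) :=
  (map_smul (DirectSum.lof k ℕ (fun n => F.deg n) n) r ⟨x, hx⟩).symm

theorem single_zero {n : ℕ} : F.single n 0 (zero_mem _) = 0 :=
  map_zero (DirectSum.of (fun n => F.deg n) n)

theorem single_sum {n : ℕ} {ι : Type} (s : Finset ι) (x : ι → F.Wedge)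
    (hx : ∀ i, x i ∈ F.deg n) :
    ∑ i ∈ s, F.single n (x i) (hx i) = F.single n (∑ i ∈ s, x i) (sum_mem fun i _ => hx i) := by
  unfold single
  rw [← map_sum]
  congr 1
  ext
  simp

theorem single_congr {m n : ℕ} {x y : F.Wedge} (hx : x ∈ F.deg m) (hy : y ∈ F.deg n)
    (h : m = n) (h' : x = y) : F.single m x hx = F.single n y hy := by
  subst h h'; rfl

theorem single_one : F.single 0 1 SetLike.GradedOne.one_mem = 1 := rfl

/-- The decomposition on functions. -/
def decomposeFn : A →ₐ[k] ⨁ n, F.deg n :=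
  AlgHom.ofLinearMap
    { toFun := fun a => F.single 0 (F.fn a) (F.fn_mem a)
      map_add' := fun a b => by
        rw [single_add]; exact F.single_congr _ _ rfl (by simp)
      map_smul' := fun r a => by
        rw [RingHom.id_apply, single_smul]; exact F.single_congr _ _ rfl (by simp) }
    (by rw [← single_one]; exact F.single_congr _ _ rfl (by simp))
    (fun a b => by
      simp only [LinearMap.coe_mk, AddHom.coe_mk]
      rw [single_mul]; exact F.single_congr _ _ rfl (by simp))

theorem decomposeFn_apply (a : A) : F.decomposeFn a = F.single 0 (F.fn a) (F.fn_mem a) := rfl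

/-- The decomposition on forms of degree 1. -/
def decomposeForm : Γ →+ ⨁ n, F.deg n where
  toFun := fun ω => F.single 1 (F.form ω) (F.form_mem ω)
  map_zero' := by
    rw [← F.single_zero (n := 1)]; exact F.single_congr _ _ rfl (by simp)
  map_add' := fun a b => by
    rw [single_add]; exact F.single_congr _ _ rfl (by simp)

theorem decomposeForm_apply (ω : Γ) :
    F.decomposeForm ω = F.single 1 (F.form ω) (F.form_mem ω) := rfl

/-- The decomposition of a form into its homogeneous components. -/
def decomposeHom : F.Wedge →ₐ[k] ⨁ n, F.deg n :=
  F.lift F.decomposeFn F.decomposeForm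
    (fun a ω => by
      simp only [decomposeFn_apply, decomposeForm_apply]
      rw [single_mul]; exact F.single_congr _ _ rfl (F.form_left a ω))
    (fun a ω => by
      simp only [decomposeFn_apply, decomposeForm_apply]
      rw [single_mul]; exact F.single_congr _ _ rfl (F.form_right a ω))
    (fun n a b h => by
      simp only [decomposeForm_apply, single_mul]
      rw [single_sum, ← F.single_zero (n := 2)]
      exact F.single_congr _ _ rfl (F.wedge_eq_zero a b h))

theorem decomposeHom_fn (a : A) : F.decomposeHom (F.fn a) =
    F.single 0 (F.fn a) (F.fn_mem a) := F.lift_fn ..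

theorem decomposeHom_form (ω : Γ) : F.decomposeHom (F.form ω) =
    F.single 1 (F.form ω) (F.form_mem ω) := F.lift_form ..

/-- Induction on degree for homogeneous forms. -/
theorem deg_induction {P : ℕ → F.Wedge → Prop}
    (fn : ∀ a, P 0 (F.fn a))
    (add : ∀ n x y, P n x → P n y → P n (x + y))
    (mul : ∀ n x ω, x ∈ F.deg n → P n x → P (n + 1) (x * F.form ω))
    (n : ℕ) (x : F.Wedge) (hx : x ∈ F.deg n) : P n x := by
  induction n generalizing x with
  | zero =>
    simp only [deg, pow_zero, mul_one, LinearMap.mem_range] at hx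
    obtain ⟨a, rfl⟩ := hx
    exact fn a
  | succ n ih =>
    have h : F.deg (n + 1) = F.deg n * LinearMap.range F.form := by
      simp only [deg, pow_succ, mul_assoc]
    rw [h] at hx
    induction hx using Submodule.mul_induction_on' with
    | mem_mul_mem m hm w hw =>
      obtain ⟨ω, rfl⟩ := hw
      exact mul n m ω hm (ih m hm)
    | add x _ y _ hx hy => exact add _ _ _ hx hy

theorem decomposeHom_of_mem (n : ℕ) (x : F.Wedge) (hx : x ∈ F.deg n) :
    F.decomposeHom x = F.single n x hx := by
  suffices h : ∃ hx : x ∈ F.deg n, F.decomposeHom x = F.single n x hx from h.2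
  refine F.deg_induction (P := fun n x => ∃ hx : x ∈ F.deg n, F.decomposeHom x = F.single n x hx)
    (fun a => ⟨F.fn_mem a, F.decomposeHom_fn a⟩) ?_ ?_ n x hx
  · rintro n x y ⟨hx, hx'⟩ ⟨hy, hy'⟩
    exact ⟨add_mem hx hy, by rw [map_add, hx', hy', single_add]⟩
  · rintro n x ω hx ⟨_, hx'⟩
    exact ⟨SetLike.mul_mem_graded hx (F.form_mem ω),
      by rw [map_mul, hx', decomposeHom_form, single_mul]⟩

instance gradedAlgebra : GradedAlgebra F.deg :=
  GradedAlgebra.ofAlgHom F.deg F.decomposeHom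
    (by
      apply F.hom_ext
      · intro a
        rw [AlgHom.comp_apply, decomposeHom_fn, single, DirectSum.coeAlgHom_of]; rfl
      · intro ω
        rw [AlgHom.comp_apply, decomposeHom_form, single, DirectSum.coeAlgHom_of]; rfl)
    (fun n x => F.decomposeHom_of_mem n x x.2)


/-- The map `A ⊗ A → Γ`, `a ⊗ b ↦ a d b`. -/
def tensorToForm : A ⊗[k] A →ₗ[k] Γ :=
  TensorProduct.lift (LinearMap.mk₂ k (fun a b => a • F.d b)
    (fun a a' b => add_smul a a' _) (fun r a b => smul_assoc r a _)
    (fun a b b' => by rw [map_add, smul_add])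
    (fun r a b => by rw [map_smul, smul_algebra_smul_comm]))

theorem tensorToForm_tmul (a b : A) : F.tensorToForm (a ⊗ₜ b) = a • F.d b := rfl

theorem tensorToForm_surjective : Function.Surjective F.tensorToForm := by
  rw [← LinearMap.range_eq_top, eq_top_iff, ← F.span_eq_top, Submodule.span_le]
  rintro _ ⟨a, b, rfl⟩
  exact ⟨a ⊗ₜ b, rfl⟩

/-- The map `A ⊗ A → Γ^∧`, `a ⊗ b ↦ da ∧ db`. -/
def tensorToWedge : A ⊗[k] A →ₗ[k] F.Wedge :=
  TensorProduct.lift ((LinearMap.mul k F.Wedge).compl₁₂ (F.form ∘ₗ F.d) (F.form ∘ₗ F.d))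

theorem tensorToWedge_tmul (a b : A) :
    F.tensorToWedge (a ⊗ₜ b) = F.form (F.d a) * F.form (F.d b) := rfl

theorem ker_le : LinearMap.ker F.tensorToForm ≤ LinearMap.ker F.tensorToWedge := by
  intro x hx
  rw [LinearMap.mem_ker] at hx ⊢
  obtain ⟨n, a, b, rfl⟩ : ∃ (n : ℕ) (a b : Fin n → A), x = ∑ i, a i ⊗ₜ[k] b i := by
    clear hx
    induction x with
    | zero => exact ⟨0, 0, 0, by simp⟩
    | tmul a b => exact ⟨1, fun _ => a, fun _ => b, by simp⟩
    | add x y hx hy =>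
      obtain ⟨m, a, b, rfl⟩ := hx
      obtain ⟨n, a', b', rfl⟩ := hy
      exact ⟨m + n, Fin.append a a', Fin.append b b', by simp [Fin.sum_univ_add]⟩
  simp only [map_sum, tensorToForm_tmul, tensorToWedge_tmul] at hx ⊢
  exact F.wedge_eq_zero a b hx

/-- The differential on 1-forms, `∑ aᵢ d bᵢ ↦ ∑ d aᵢ ∧ d bᵢ`. -/
def dForm : Γ →ₗ[k] F.Wedge :=
  (LinearMap.ker F.tensorToForm).liftQ F.tensorToWedge F.ker_le ∘ₗ
    (F.tensorToForm.quotKerEquivOfSurjective F.tensorToForm_surjective).symm.toLinearMap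

theorem dForm_tensor (x : A ⊗[k] A) : F.dForm (F.tensorToForm x) = F.tensorToWedge x := by
  have : (F.tensorToForm.quotKerEquivOfSurjective F.tensorToForm_surjective).symm
      (F.tensorToForm x) = Submodule.Quotient.mk x := by
    rw [LinearEquiv.symm_apply_eq]; rfl
  simp [dForm, this]

theorem dForm_smul_d (a b : A) : F.dForm (a • F.d b) = F.form (F.d a) * F.form (F.d b) :=
  F.dForm_tensor (a ⊗ₜ b)

theorem form_induction {P : Γ → Prop} (h : ∀ a b : A, P (a • F.d b : Γ))
    (hadd : ∀ ω η, P ω → P η → P (ω + η)) (ω : Γ) : P ω := by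
  obtain ⟨x, rfl⟩ := F.tensorToForm_surjective ω
  induction x with
  | zero => simpa using h 0 0
  | tmul a b => exact h a b
  | add x y hx hy => rw [map_add]; exact hadd _ _ hx hy

theorem d_one : F.d 1 = 0 := by
  have := F.leibniz 1 1
  simpa using this

theorem dForm_d (a : A) : F.dForm (F.d a) = 0 := by
  have := F.dForm_smul_d 1 a
  simpa [d_one] using this

theorem dForm_left (a : A) (ω : Γ) :
    F.dForm (a • ω) = F.form (F.d a) * F.form ω + F.fn a * F.dForm ω := by
  induction ω using F.form_induction with
  | h b c =>
    rw [smul_smul, dForm_smul_d, dForm_smul_d, F.leibniz, map_add, form_left, form_right,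
      form_left]
    noncomm_ring
  | hadd ω η h1 h2 => simp only [smul_add, map_add, h1, h2, mul_add]; abel

theorem dForm_right (a : A) (ω : Γ) :
    F.dForm (MulOpposite.op a • ω) = F.dForm ω * F.fn a - F.form ω * F.form (F.d a) := by
  induction ω using F.form_induction with
  | h b c =>
    have h : MulOpposite.op a • b • F.d c = b • F.d (c * a) - (b * c) • F.d a := by
      rw [F.leibniz, smul_add, smul_smul, add_sub_cancel_right, smul_comm b (MulOpposite.op a)]
    rw [h, map_sub, dForm_smul_d, dForm_smul_d, dForm_smul_d, F.leibniz, F.leibniz]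
    simp only [map_add, form_left, form_right]
    noncomm_ring
  | hadd ω η h1 h2 => simp only [smul_add, map_add, h1, h2, add_mul]; abel

/-- The value `(σ x, d x; 0, x)` of `dMatrix` on functions. -/
def dMatrixFn : A →ₐ[k] Matrix (Fin 2) (Fin 2) F.Wedge :=
  AlgHom.ofLinearMap
    { toFun := fun a => !![F.fn a, F.form (F.d a); 0, F.fn a]
      map_add' := fun a b => by
        ext i j; fin_cases i <;> fin_cases j <;> simp
      map_smul' := fun r a => by
        ext i j; fin_cases i <;> fin_cases j <;> simp }
    (by ext i j; fin_cases i <;> fin_cases j <;> simp [d_one])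
    (fun a b => by
      ext i j; fin_cases i <;> fin_cases j <;>
        simp [Matrix.mul_apply, Fin.sum_univ_two, F.leibniz, form_left, form_right, add_comm])

theorem dMatrixFn_apply (a : A) : F.dMatrixFn a = !![F.fn a, F.form (F.d a); 0, F.fn a] := rfl

/-- The value `(σ x, d x; 0, x)` of `dMatrix` on forms of degree 1. -/
def dMatrixForm : Γ →+ Matrix (Fin 2) (Fin 2) F.Wedge where
  toFun := fun ω => !![-F.form ω, F.dForm ω; 0, F.form ω]
  map_zero' := by ext i j; fin_cases i <;> fin_cases j <;> simp
  map_add' := fun a b => by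
    ext i j; fin_cases i <;> fin_cases j <;> simp [add_comm]

theorem dMatrixForm_apply (ω : Γ) :
    F.dMatrixForm ω = !![-F.form ω, F.dForm ω; 0, F.form ω] := rfl

/-- The algebra map `x ↦ (σ x, d x; 0, x)` that encodes the differential `d` of `Γ^∧`, where
`σ x = (-1)^|x| x`: its multiplicativity is the graded Leibniz rule. -/
def dMatrix : F.Wedge →ₐ[k] Matrix (Fin 2) (Fin 2) F.Wedge :=
  F.lift F.dMatrixFn F.dMatrixForm
    (fun a ω => by
      rw [dMatrixFn_apply, dMatrixForm_apply, dMatrixForm_apply]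
      ext i j; fin_cases i <;> fin_cases j <;>
        simp [Matrix.mul_apply, Fin.sum_univ_two, form_left, dForm_left, add_comm])
    (fun a ω => by
      rw [dMatrixFn_apply, dMatrixForm_apply, dMatrixForm_apply]
      ext i j; fin_cases i <;> fin_cases j <;>
        simp [Matrix.mul_apply, Fin.sum_univ_two, form_right, dForm_right, sub_eq_neg_add])
    (fun n a b h => by
      simp only [dMatrixForm_apply]
      ext i j; fin_cases i <;> fin_cases j <;>
        simp [Matrix.sum_apply, dForm_d, F.wedge_eq_zero a b h])

/-- The differential of `Γ^∧`. -/
def dWedge : F.Wedge →ₗ[k] F.Wedge :=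
  (Matrix.entryLinearMap k F.Wedge (0 : Fin 2) (1 : Fin 2)) ∘ₗ F.dMatrix.toLinearMap

theorem dWedge_apply (x : F.Wedge) : F.dWedge x = F.dMatrix x 0 1 := rfl

theorem dMatrix_fn (a : A) : F.dMatrix (F.fn a) = !![F.fn a, F.form (F.d a); 0, F.fn a] :=
  F.lift_fn ..

theorem dMatrix_form (ω : Γ) :
    F.dMatrix (F.form ω) = !![-F.form ω, F.dForm ω; 0, F.form ω] :=
  F.lift_form ..

theorem dWedge_fn (a : A) : F.dWedge (F.fn a) = F.form (F.d a) := by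
  simp [dWedge_apply, dMatrix_fn]

theorem dWedge_form (ω : Γ) : F.dWedge (F.form ω) = F.dForm ω := by
  simp [dWedge_apply, dMatrix_form]

theorem dMatrix_of_mem (n : ℕ) (x : F.Wedge) (hx : x ∈ F.deg n) :
    F.dMatrix x = !![(-1 : k) ^ n • x, F.dWedge x; 0, x] := by
  refine F.deg_induction (P := fun n x => F.dMatrix x = !![(-1 : k) ^ n • x, F.dWedge x; 0, x])
    ?_ ?_ ?_ n x hx
  · intro a; simp [dWedge_fn, dMatrix_fn]
  · intro n x y hx hy
    rw [map_add, hx, hy]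
    ext i j; fin_cases i <;> fin_cases j <;> simp
  · intro n x ω _ hx
    rw [dWedge_apply, map_mul, hx, dMatrix_form]
    ext i j; fin_cases i <;> fin_cases j <;>
      simp [Matrix.mul_apply, Fin.sum_univ_two, pow_succ]

theorem wedge_induction {P : F.Wedge → Prop}
    (hom : ∀ n x, x ∈ F.deg n → P x) (add : ∀ x y, P x → P y → P (x + y)) (x : F.Wedge) : P x := by
  have hx : x ∈ ⨆ n, F.deg n := by
    rw [(DirectSum.Decomposition.isInternal F.deg).submodule_iSup_eq_top]; trivial
  induction hx using Submodule.iSup_induction' with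
  | mem n x hx => exact hom n x hx
  | zero => exact hom 0 0 (zero_mem _)
  | add x y _ _ hx hy => exact add x y hx hy

theorem dWedge_mul (n : ℕ) (x y : F.Wedge) (hx : x ∈ F.deg n) :
    F.dWedge (x * y) = F.dWedge x * y + (-1 : k) ^ n • (x * F.dWedge y) := by
  have h11 : F.dMatrix y 1 1 = y := by
    induction y using F.wedge_induction with
    | hom n y hy => simp [F.dMatrix_of_mem n y hy]
    | add x y hx hy => rw [map_add, Matrix.add_apply, hx, hy]
  rw [dWedge_apply, map_mul, F.dMatrix_of_mem n x hx, Matrix.mul_apply, Fin.sum_univ_two, h11]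
  simp only [Matrix.of_apply, Matrix.cons_val', Matrix.cons_val_zero, Matrix.cons_val_one,
    Matrix.cons_val_fin_one, ← dWedge_apply, smul_mul_assoc]
  rw [add_comm]

theorem dForm_mem (ω : Γ) : F.dForm ω ∈ F.deg 2 := by
  induction ω using F.form_induction with
  | h a b =>
    rw [dForm_smul_d]
    have h := SetLike.mul_mem_graded (F.form_mem (F.d a)) (F.form_mem (F.d b))
    rwa [one_add_one_eq_two] at h
  | hadd ω η h1 h2 => rw [map_add]; exact add_mem h1 h2

theorem dWedge_mem (n : ℕ) (x : F.Wedge) (hx : x ∈ F.deg n) : F.dWedge x ∈ F.deg (n + 1) := by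
  refine F.deg_induction (P := fun n x => F.dWedge x ∈ F.deg (n + 1)) ?_ ?_ ?_ n x hx
  · intro a; rw [dWedge_fn]; exact F.form_mem _
  · intro n x y hx hy; rw [map_add]; exact add_mem hx hy
  · intro n x ω hx hx'
    rw [F.dWedge_mul n _ _ hx, dWedge_form]
    have h1 : F.dWedge x * F.form ω ∈ F.deg (n + 1 + 1) :=
      SetLike.mul_mem_graded hx' (F.form_mem ω)
    have h2 : x * F.dForm ω ∈ F.deg (n + 2) := SetLike.mul_mem_graded hx (F.dForm_mem ω)
    exact add_mem h1 (Submodule.smul_mem _ _ h2)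

theorem dWedge_dForm (ω : Γ) : F.dWedge (F.dForm ω) = 0 := by
  induction ω using F.form_induction with
  | h a b =>
    rw [dForm_smul_d, F.dWedge_mul 1 _ _ (F.form_mem _)]
    simp [dWedge_form, dForm_d]
  | hadd ω η h1 h2 => rw [map_add, map_add, h1, h2, add_zero]

theorem dWedge_dWedge (x : F.Wedge) : F.dWedge (F.dWedge x) = 0 := by
  induction x using F.wedge_induction with
  | add x y hx hy => rw [map_add, map_add, hx, hy, add_zero]
  | hom n x hx =>
    refine F.deg_induction (P := fun _ x => F.dWedge (F.dWedge x) = 0) ?_ ?_ ?_ n x hx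
    · intro a; rw [dWedge_fn, dWedge_form, dForm_d]
    · intro n x y hx hy; rw [map_add, map_add, hx, hy, add_zero]
    · intro n x ω hx hx'
      rw [F.dWedge_mul n _ _ hx, map_add, map_smul, F.dWedge_mul (n + 1) _ _ (F.dWedge_mem n x hx),
        F.dWedge_mul n _ _ hx, hx', dWedge_form, dWedge_dForm]
      simp [pow_succ]

theorem fn_injective : Function.Injective F.fn := by
  intro a b h
  have := congrArg (F.lift (AlgHom.id k A) 0 (by simp) (by simp) (by simp)) h
  simpa [lift_fn] using this

theorem range_fn : LinearMap.range F.fn.toLinearMap = F.deg 0 := by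
  simp [deg]

/-- The forms `a₀ da₁ ∧ ⋯ ∧ daₙ`. -/
def simpleForms (n : ℕ) : Set F.Wedge :=
  {ω | ∃ (a : A) (b : Fin n → A), ω = F.fn a * (List.ofFn fun i => F.dWedge (F.fn (b i))).prod}

theorem mem_simpleForms_succ {n : ℕ} {ω : F.Wedge} : ω ∈ F.simpleForms (n + 1) ↔
    ∃ η ∈ F.simpleForms n, ∃ b : A, ω = η * F.form (F.d b) := by
  constructor
  · rintro ⟨a, b, rfl⟩
    refine ⟨_, ⟨a, fun i => b i.castSucc, rfl⟩, b (Fin.last n), ?_⟩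
    rw [List.ofFn_succ', List.concat_eq_append, List.prod_append, List.prod_singleton, mul_assoc,
      dWedge_fn]
  · rintro ⟨_, ⟨a, b, rfl⟩, c, rfl⟩
    refine ⟨a, Fin.snoc b c, ?_⟩
    rw [List.ofFn_succ', List.concat_eq_append, List.prod_append, List.prod_singleton, mul_assoc,
      dWedge_fn]
    simp

theorem span_simpleForms_mul_d (n : ℕ) (x : F.Wedge) (b : A)
    (hx : x ∈ Submodule.span k (F.simpleForms n)) :
    x * F.form (F.d b) ∈ Submodule.span k (F.simpleForms (n + 1)) := by
  induction hx using Submodule.span_induction with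
  | mem x hx => exact Submodule.subset_span (F.mem_simpleForms_succ.2 ⟨x, hx, b, rfl⟩)
  | zero => simp
  | add x y _ _ hx hy => rw [add_mul]; exact add_mem hx hy
  | smul r x _ hx => rw [smul_mul_assoc]; exact Submodule.smul_mem _ r hx

theorem span_simpleForms_mul_fn (n : ℕ) (x : F.Wedge) (a : A)
    (hx : x ∈ Submodule.span k (F.simpleForms n)) :
    x * F.fn a ∈ Submodule.span k (F.simpleForms n) := by
  induction n generalizing x a with
  | zero =>
    induction hx using Submodule.span_induction with
    | mem x hx =>
      obtain ⟨c, b, rfl⟩ := hx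
      exact Submodule.subset_span ⟨c * a, b, by simp⟩
    | zero => simp
    | add x y _ _ hx hy => rw [add_mul]; exact add_mem hx hy
    | smul r x _ hx => rw [smul_mul_assoc]; exact Submodule.smul_mem _ r hx
  | succ n ih =>
    induction hx using Submodule.span_induction with
    | mem x hx =>
      obtain ⟨η, hη, b, rfl⟩ := F.mem_simpleForms_succ.1 hx
      have h : η * F.form (F.d b) * F.fn a =
          η * F.form (F.d (b * a)) - η * F.fn b * F.form (F.d a) := by
        rw [F.leibniz, map_add, form_right, form_left]; noncomm_ring
      rw [h]
      have hη' := Submodule.subset_span (R := k) hη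
      exact sub_mem (F.span_simpleForms_mul_d n _ _ hη')
        (F.span_simpleForms_mul_d n _ _ (ih _ _ hη'))
    | zero => simp
    | add x y _ _ hx hy => rw [add_mul]; exact add_mem hx hy
    | smul r x _ hx => rw [smul_mul_assoc]; exact Submodule.smul_mem _ r hx

theorem simpleForms_subset (n : ℕ) : ∀ x ∈ F.simpleForms n, x ∈ F.deg n := by
  induction n with
  | zero => rintro _ ⟨a, b, rfl⟩; simpa using F.fn_mem a
  | succ n ih =>
    intro x hx
    obtain ⟨η, hη, b, rfl⟩ := F.mem_simpleForms_succ.1 hx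
    exact SetLike.mul_mem_graded (ih η hη) (F.form_mem _)

theorem deg_eq_span (n : ℕ) : F.deg n = Submodule.span k (F.simpleForms n) := by
  refine le_antisymm (fun x hx => ?_) (Submodule.span_le.2 (F.simpleForms_subset n))
  refine F.deg_induction (P := fun n x => x ∈ Submodule.span k (F.simpleForms n)) ?_ ?_ ?_ n x hx
  · intro a; exact Submodule.subset_span ⟨a, Fin.elim0, by simp⟩
  · intro n x y hx hy; exact add_mem hx hy
  · intro n x ω _ hx
    induction ω using F.form_induction with
    | h a b =>
      rw [form_left, ← mul_assoc]
      exact F.span_simpleForms_mul_d n _ b (F.span_simpleForms_mul_fn n x a hx)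
    | hadd ω η h1 h2 => rw [map_add, mul_add]; exact add_mem h1 h2

/-- The maximal prolongation `Γ^∧` of a first order calculus. -/
def maximalProlongation : DifferentialCalculus k A where
  Form := F.Wedge
  grade := F.deg
  incl := F.fn
  d := F.dWedge
  incl_injective := F.fn_injective
  range_incl := F.range_fn
  d_mem := F.dWedge_mem
  d_d := F.dWedge_dWedge
  leibniz := F.dWedge_mul
  generated := F.deg_eq_span

end Prolongation
end FirstOrderCalculus

namespace DifferentialCalculus

section Coaction

variable {k A H : Type u} [Field k] [Ring A] [Algebra k A] [Ring H] [Algebra k H]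

/-- The linear map `ω ↦ (-1)^|ω| ω`. -/
def sign (Ω : DifferentialCalculus k A) : Ω.Form →ₗ[k] Ω.Form :=
  DirectSum.toModule k ℕ Ω.Form (fun n => (-1 : k) ^ n • (Ω.grade n).subtype) ∘ₗ
    (DirectSum.decomposeLinearEquiv Ω.grade).toLinearMap

/-- The graded tensor product `Ω ⊗ Ω'`, with the Koszul sign rule
`(ω ⊗ η) ∧ (ω' ⊗ η') = (-1)^(|η| |ω'|) (ω ∧ ω') ⊗ (η ∧ η')`. -/
abbrev Tensor (Ω : DifferentialCalculus k A) (Ω' : DifferentialCalculus k H) : Type u :=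
  Ω.grade ᵍ⊗[k] Ω'.grade

/-- The differential `ω ⊗ η ↦ dω ⊗ η + (-1)^|ω| ω ⊗ dη`. -/
def tensorD (Ω : DifferentialCalculus k A) (Ω' : DifferentialCalculus k H) :
    Ω.Tensor Ω' →ₗ[k] Ω.Tensor Ω' :=
  (GradedTensorProduct.of k Ω.grade Ω'.grade).toLinearMap ∘ₗ
    (TensorProduct.map Ω.d LinearMap.id + TensorProduct.map Ω.sign Ω'.d) ∘ₗ
    (GradedTensorProduct.of k Ω.grade Ω'.grade).symm.toLinearMap

/-- `⨁_{i + j = n} Ω^i ⊗ Ω'^j`. -/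
def tensorGrade (Ω : DifferentialCalculus k A) (Ω' : DifferentialCalculus k H) (n : ℕ) :
    Submodule k (Ω.Tensor Ω') :=
  Submodule.span k {x | ∃ (i j : ℕ) (ω : Ω.Form) (η : Ω'.Form), i + j = n ∧ ω ∈ Ω.grade i ∧
    η ∈ Ω'.grade j ∧ x = ω ᵍ⊗ₜ[k] η}

/-- The inclusion `A ⊗ H → Ω(A) ⊗ Ω(H)` in degree 0. -/
def tensorIncl (Ω : DifferentialCalculus k A) (Ω' : DifferentialCalculus k H) :
    A ⊗[k] H →ₗ[k] Ω.Tensor Ω' :=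
  (GradedTensorProduct.of k Ω.grade Ω'.grade).toLinearMap ∘ₗ
    TensorProduct.map Ω.incl.toLinearMap Ω'.incl.toLinearMap

/-- The inclusion `Ω(A) ⊗ H → Ω(A) ⊗ Ω(H)`. -/
def tensorInclRight (Ω : DifferentialCalculus k A) (Ω' : DifferentialCalculus k H) :
    Ω.Form ⊗[k] H →ₗ[k] Ω.Tensor Ω' :=
  (GradedTensorProduct.of k Ω.grade Ω'.grade).toLinearMap ∘ₗ
    TensorProduct.map LinearMap.id Ω'.incl.toLinearMap

/-- `Φ : Ω(A) → Ω(A) ⊗ Ω(H)` is a morphism of differential graded algebras that extends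
`Δ : A → A ⊗ H`. -/
structure IsCoactionLift (Δ : A →ₐ[k] A ⊗[k] H) (Ω : DifferentialCalculus k A)
    (Ω' : DifferentialCalculus k H) (Φ : Ω.Form →ₐ[k] Ω.Tensor Ω') : Prop where
  map_grade : ∀ (n : ℕ) (ω : Ω.Form), ω ∈ Ω.grade n → Φ ω ∈ Ω.tensorGrade Ω' n
  map_d : ∀ ω : Ω.Form, Φ (Ω.d ω) = Ω.tensorD Ω' (Φ ω)
  map_incl : ∀ a : A, Φ (Ω.incl a) = Ω.tensorIncl Ω' (Δ a)

/-- The calculus `Ω(A)` is complete with respect to the coaction `Δ : A → A ⊗ H` and the calculus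
`Ω(H)`. -/
def IsComplete (Δ : A →ₐ[k] A ⊗[k] H) (Ω : DifferentialCalculus k A)
    (Ω' : DifferentialCalculus k H) : Prop :=
  ∃ Φ : Ω.Form →ₐ[k] Ω.Tensor Ω', IsCoactionLift Δ Ω Ω' Φ

/-- The component `(π^i ⊗ π^j) ∘ Φ` of `Φ`. -/
def component {Ω : DifferentialCalculus k A} {Ω' : DifferentialCalculus k H}
    (Φ : Ω.Form →ₐ[k] Ω.Tensor Ω') (i j : ℕ) : Ω.Form →ₗ[k] Ω.Tensor Ω' :=
  (GradedTensorProduct.of k Ω.grade Ω'.grade).toLinearMap ∘ₗ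
    TensorProduct.map (GradedAlgebra.proj Ω.grade i) (GradedAlgebra.proj Ω'.grade j) ∘ₗ
    (GradedTensorProduct.of k Ω.grade Ω'.grade).symm.toLinearMap ∘ₗ Φ.toLinearMap

end Coaction

section Covariance

variable {k A H : Type u} [Field k] [Ring A] [Algebra k A] [Ring H] [HopfAlgebra k H]

/-- `A` is a right `H`-comodule algebra with coaction `Δ`. -/
structure IsRightCoaction (Δ : A →ₐ[k] A ⊗[k] H) : Prop where
  coassoc : ∀ a : A, TensorProduct.assoc k A H H (Δ.toLinearMap.rTensor H (Δ a)) =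
    (Coalgebra.comul (R := k) (A := H)).lTensor A (Δ a)
  counit : ∀ a : A, (Coalgebra.counit (R := k) (A := H)).lTensor A (Δ a) = a ⊗ₜ[k] (1 : k)

/-- `A` is a left `H`-comodule algebra with coaction `Δ`. -/
structure IsLeftCoaction (Δ : A →ₐ[k] H ⊗[k] A) : Prop where
  coassoc : ∀ a : A, (TensorProduct.assoc k H H A).symm (Δ.toLinearMap.lTensor H (Δ a)) =
    (Coalgebra.comul (R := k) (A := H)).rTensor A (Δ a)
  counit : ∀ a : A, (Coalgebra.counit (R := k) (A := H)).rTensor A (Δ a) = (1 : k) ⊗ₜ[k] a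

/-- `Ψ` makes `Ω(A)` a graded right `H`-comodule algebra that extends `(A, Δ)` and has a colinear
differential. -/
structure IsRightCovariantCoaction (Δ : A →ₐ[k] A ⊗[k] H) (Ω : DifferentialCalculus k A)
    (Ψ : Ω.Form →ₐ[k] Ω.Form ⊗[k] H) : Prop where
  coaction : IsRightCoaction Ψ
  map_grade : ∀ (n : ℕ) (ω : Ω.Form), ω ∈ Ω.grade n →
    Ψ ω ∈ LinearMap.range ((Ω.grade n).subtype.rTensor H)
  map_incl : ∀ a : A, Ψ (Ω.incl a) = Ω.incl.toLinearMap.rTensor H (Δ a)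
  map_d : ∀ ω : Ω.Form, Ψ (Ω.d ω) = Ω.d.rTensor H (Ψ ω)

/-- `Ψ` makes `Ω(A)` a graded left `H`-comodule algebra that extends `(A, Δ)` and has a colinear
differential. -/
structure IsLeftCovariantCoaction (Δ : A →ₐ[k] H ⊗[k] A) (Ω : DifferentialCalculus k A)
    (Ψ : Ω.Form →ₐ[k] H ⊗[k] Ω.Form) : Prop where
  coaction : IsLeftCoaction Ψ
  map_grade : ∀ (n : ℕ) (ω : Ω.Form), ω ∈ Ω.grade n →
    Ψ ω ∈ LinearMap.range ((Ω.grade n).subtype.lTensor H)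
  map_incl : ∀ a : A, Ψ (Ω.incl a) = Ω.incl.toLinearMap.lTensor H (Δ a)
  map_d : ∀ ω : Ω.Form, Ψ (Ω.d ω) = Ω.d.lTensor H (Ψ ω)

/-- A right `H`-covariant calculus on a right `H`-comodule algebra. -/
def IsRightCovariant (Δ : A →ₐ[k] A ⊗[k] H) (Ω : DifferentialCalculus k A) : Prop :=
  ∃ Ψ : Ω.Form →ₐ[k] Ω.Form ⊗[k] H, IsRightCovariantCoaction Δ Ω Ψ

/-- A left `H`-covariant calculus on a left `H`-comodule algebra. -/
def IsLeftCovariant (Δ : A →ₐ[k] H ⊗[k] A) (Ω : DifferentialCalculus k A) : Prop :=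
  ∃ Ψ : Ω.Form →ₐ[k] H ⊗[k] Ω.Form, IsLeftCovariantCoaction Δ Ω Ψ

/-- A bicovariant calculus on a Hopf algebra, whose coactions extend the coproduct. -/
def IsBicovariant (Ω : DifferentialCalculus k H) : Prop :=
  IsLeftCovariant (Bialgebra.comulAlgHom k H) Ω ∧ IsRightCovariant (Bialgebra.comulAlgHom k H) Ω

end Covariance

end DifferentialCalculus

section Twisted

variable {k A : Type u} [Field k] [Ring A] [Algebra k A] {n : ℕ}

/-- The free left `A`-module on `e₁, …, eₙ` with the right action `eᵢ a = σᵢ(a) eᵢ`. -/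
def TwistedFree (_σ : Fin n → A →ₐ[k] A) : Type u := Fin n → A

namespace TwistedFree

variable (σ : Fin n → A →ₐ[k] A)

instance : AddCommGroup (TwistedFree σ) := inferInstanceAs (AddCommGroup (Fin n → A))

instance : Module k (TwistedFree σ) := inferInstanceAs (Module k (Fin n → A))

instance : Module A (TwistedFree σ) := inferInstanceAs (Module A (Fin n → A))

instance : Module Aᵐᵒᵖ (TwistedFree σ) where
  smul a f := fun i => f i * σ i a.unop
  one_smul f := funext fun i => by
    change f i * σ i 1 = f i
    simp
  mul_smul a b f := funext fun i => by
    change f i * σ i (b.unop * a.unop) = f i * σ i b.unop * σ i a.unop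
    rw [map_mul, mul_assoc]
  smul_zero a := funext fun i => zero_mul _
  smul_add a f g := funext fun i => add_mul _ _ _
  add_smul a b f := funext fun i => by
    change f i * σ i (a.unop + b.unop) = f i * σ i a.unop + f i * σ i b.unop
    rw [map_add, mul_add]
  zero_smul f := funext fun i => by
    change f i * σ i 0 = 0
    simp

theorem op_smul_apply (a : A) (f : TwistedFree σ) (i : Fin n) :
    (MulOpposite.op a • f) i = f i * σ i a := rfl

theorem smul_apply (a : A) (f : TwistedFree σ) (i : Fin n) : (a • f) i = a * f i := rfl

instance : SMulCommClass A Aᵐᵒᵖ (TwistedFree σ) where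
  smul_comm a b f := funext fun i => (mul_assoc a (f i) (σ i b.unop)).symm

instance : IsScalarTower k A (TwistedFree σ) :=
  inferInstanceAs (IsScalarTower k A (Fin n → A))

instance : IsScalarTower k Aᵐᵒᵖ (TwistedFree σ) where
  smul_assoc r b f := funext fun i => by
    change f i * σ i (r • b.unop) = r • (f i * σ i b.unop)
    rw [map_smul, mul_smul_comm]

/-- The first order calculus `d a = ∑ᵢ ∂ᵢ(a) eᵢ` on the twisted free bimodule, for twisted
derivations `∂ᵢ` and elements `xᵢ` with `d xᵢ = eᵢ`. -/
def calculus (δ : Fin n → A →ₗ[k] A)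
    (hδ : ∀ i a b, δ i (a * b) = δ i a * σ i b + a * δ i b) (x : Fin n → A)
    (hx : ∀ i j, δ i (x j) = if i = j then 1 else 0) :
    FirstOrderCalculus k A (TwistedFree σ) where
  d := LinearMap.pi δ
  leibniz a b := funext fun i => hδ i a b
  span_eq_top := by
    rw [eq_top_iff]
    intro f _
    have h : f = ∑ j, f j • (show TwistedFree σ from LinearMap.pi δ (x j)) := by
      funext i
      have : (∑ j, f j • (show TwistedFree σ from LinearMap.pi δ (x j))) i =
          ∑ j, f j * δ i (x j) := Finset.sum_apply (M := fun _ => A) i _ _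
      rw [this]
      simp only [hx, mul_ite, mul_one, mul_zero]
      exact ((Finset.sum_ite_eq Finset.univ i (fun j => (f j : A))).trans (by simp)).symm
    rw [h]
    exact sum_mem fun j _ => Submodule.subset_span ⟨f j, x j, rfl⟩

end TwistedFree

/-- The twisted derivation `∂` obtained from an algebra map `a ↦ (a, ∂ a; 0, σ a)`. -/
def upperRight (D : A →ₐ[k] Matrix (Fin 2) (Fin 2) A) : A →ₗ[k] A :=
  Matrix.entryLinearMap k A (0 : Fin 2) (1 : Fin 2) ∘ₗ D.toLinearMap

theorem upperRight_apply (D : A →ₐ[k] Matrix (Fin 2) (Fin 2) A) (a : A) :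
    upperRight D a = D a 0 1 := rfl

/-- `D a` has the form `(a, ∂ a; 0, σ a)`. -/
structure IsUpper (σ : A →ₐ[k] A) (D : A →ₐ[k] Matrix (Fin 2) (Fin 2) A) (a : A) : Prop where
  h00 : D a 0 0 = a
  h10 : D a 1 0 = 0
  h11 : D a 1 1 = σ a

theorem IsUpper.algebraMap (σ : A →ₐ[k] A) (D : A →ₐ[k] Matrix (Fin 2) (Fin 2) A) (r : k) :
    IsUpper σ D (algebraMap k A r) := by
  constructor <;> simp [Matrix.algebraMap_matrix_apply]

theorem IsUpper.add {σ : A →ₐ[k] A} {D : A →ₐ[k] Matrix (Fin 2) (Fin 2) A} {a b : A}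
    (ha : IsUpper σ D a) (hb : IsUpper σ D b) : IsUpper σ D (a + b) := by
  constructor <;> simp [ha.h00, ha.h10, ha.h11, hb.h00, hb.h10, hb.h11]

theorem IsUpper.mul {σ : A →ₐ[k] A} {D : A →ₐ[k] Matrix (Fin 2) (Fin 2) A} {a b : A}
    (ha : IsUpper σ D a) (hb : IsUpper σ D b) : IsUpper σ D (a * b) := by
  constructor <;>
    simp [Matrix.mul_apply, Fin.sum_univ_two, ha.h00, ha.h10, ha.h11, hb.h00, hb.h10, hb.h11]

theorem upperRight_mul {σ : A →ₐ[k] A} {D : A →ₐ[k] Matrix (Fin 2) (Fin 2) A}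
    (h : ∀ a, IsUpper σ D a) (a b : A) :
    upperRight D (a * b) = upperRight D a * σ b + a * upperRight D b := by
  simp only [upperRight_apply, map_mul, Matrix.mul_apply, Fin.sum_univ_two, (h a).h00, (h b).h11]
  rw [add_comm]

end Twisted

section Circle

open LaurentPolynomial

/-- The Hopf algebra `O(U(1)) = ℂ[t, t⁻¹]`, in which `t` is group-like. -/
abbrev Circle1 : Type := ℂ[T;T⁻¹]

namespace Circle1

/-- The algebra map out of `ℂ[t, t⁻¹]` that sends `t` to a given unit. -/
def lift {B : Type} [Ring B] [Algebra ℂ B] (x : Bˣ) : Circle1 →ₐ[ℂ] B :=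
  AddMonoidAlgebra.lift ℂ B ℤ ((Units.coeHom B).comp (zpowersHom Bˣ x))

theorem lift_T {B : Type} [Ring B] [Algebra ℂ B] (x : Bˣ) (n : ℤ) :
    lift x (T n) = ((x ^ n : Bˣ) : B) := by
  have h := AddMonoidAlgebra.lift_single (R := ℂ) ((Units.coeHom B).comp (zpowersHom Bˣ x)) n 1
  rw [one_smul] at h
  exact h

/-- The generator `t`. -/
def t : Circle1 := T 1

/-- The generator `t⁻¹`. -/
def tInv : Circle1 := T (-1)

theorem t_mul_tInv : t * tInv = 1 := by
  rw [t, tInv, ← T_add, add_neg_cancel, T_zero]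

theorem tInv_mul_t : tInv * t = 1 := by
  rw [t, tInv, ← T_add, neg_add_cancel, T_zero]

theorem induction {P : Circle1 → Prop} (scalar : ∀ r : ℂ, P (algebraMap ℂ _ r))
    (ht : P t) (htInv : P tInv)
    (add : ∀ a b, P a → P b → P (a + b)) (mul : ∀ a b, P a → P b → P (a * b)) (a : Circle1) :
    P a := by
  induction a using LaurentPolynomial.induction_on with
  | h_C r => exact scalar r
  | h_add hp hq => exact add _ _ hp hq
  | h_C_mul_T n r h => rw [T_add, ← mul_assoc]; exact mul _ _ h ht
  | h_C_mul_T_Z n r h => rw [T_sub, ← mul_assoc]; exact mul _ _ h htInv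

variable (p : ℂˣ)

/-- The unit `r t` of `ℂ[t, t⁻¹]`. -/
def scaleUnit (r : ℂˣ) : Circle1ˣ where
  val := (r : ℂ) • t
  inv := ((r⁻¹ : ℂˣ) : ℂ) • tInv
  val_inv := by simp [smul_smul, t_mul_tInv]
  inv_val := by simp [smul_smul, tInv_mul_t]

/-- The automorphism `σ(t) = p⁻¹ t`. -/
def twist : Circle1 →ₐ[ℂ] Circle1 := lift (scaleUnit p⁻¹)

/-- The unit `(t, 1; 0, p⁻¹ t)`. -/
def matrixUnit : (Matrix (Fin 2) (Fin 2) Circle1)ˣ where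
  val := !![t, 1; 0, ((p⁻¹ : ℂˣ) : ℂ) • t]
  inv := !![tInv, -((p : ℂ) • (tInv * tInv)); 0, (p : ℂ) • tInv]
  val_inv := by
    ext1 i j; fin_cases i <;> fin_cases j <;>
      simp [Matrix.mul_apply, Fin.sum_univ_two, smul_smul, t_mul_tInv, ← mul_assoc]
  inv_val := by
    ext1 i j; fin_cases i <;> fin_cases j <;>
      simp [Matrix.mul_apply, Fin.sum_univ_two, smul_smul, tInv_mul_t, mul_assoc]

theorem lift_t {B : Type} [Ring B] [Algebra ℂ B] (x : Bˣ) : lift x t = (x : B) := by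
  rw [t, lift_T, zpow_one]

theorem lift_tInv {B : Type} [Ring B] [Algebra ℂ B] (x : Bˣ) :
    lift x tInv = ((x⁻¹ : Bˣ) : B) := by
  rw [tInv, lift_T, zpow_neg_one]

theorem isUpper (a : Circle1) : IsUpper (twist p) (lift (matrixUnit p)) a := by
  induction a using Circle1.induction with
  | scalar r => exact .algebraMap _ _ r
  | ht => constructor <;> simp [lift_t, twist, matrixUnit, scaleUnit]
  | htInv => constructor <;> simp [lift_tInv, twist, matrixUnit, scaleUnit]
  | add a b ha hb => exact ha.add hb
  | mul a b ha hb => exact ha.mul hb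

/-- The first order calculus on `ℂ[t, t⁻¹]` that is free on `dt` as a left module and has
`dt t = p⁻¹ t dt`. -/
def firstOrder : FirstOrderCalculus ℂ Circle1 (TwistedFree (fun _ : Fin 1 => twist p)) :=
  TwistedFree.calculus _ (fun _ => upperRight (lift (matrixUnit p)))
    (fun _ => upperRight_mul (isUpper p)) (fun _ => t)
    (fun i j => by
      rw [upperRight_apply, lift_t]
      simp [matrixUnit, Subsingleton.elim i j])

/-- The differential calculus on `O(U(1))` with `t dt = p dt t`: the maximal prolongation of the
first order calculus above. -/
def calculus : DifferentialCalculus ℂ Circle1 := (firstOrder p).maximalProlongation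

end Circle1

end Circle

section Torus

/-- The generators of `O_θ(𝕋²)`. -/
inductive TorusGen : Type
  | u | uInv | v | vInv

open FreeAlgebra in
/-- The relations of `O_θ(𝕋²)`. -/
inductive TorusRel (θ : ℝ) : FreeAlgebra ℂ TorusGen → FreeAlgebra ℂ TorusGen → Prop
  | u_uInv : TorusRel θ (ι ℂ .u * ι ℂ .uInv) 1
  | uInv_u : TorusRel θ (ι ℂ .uInv * ι ℂ .u) 1
  | v_vInv : TorusRel θ (ι ℂ .v * ι ℂ .vInv) 1
  | vInv_v : TorusRel θ (ι ℂ .vInv * ι ℂ .v) 1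
  | comm : TorusRel θ (ι ℂ .u * ι ℂ .v) (Complex.exp (-(θ * Complex.I)) • (ι ℂ .v * ι ℂ .u))

/-- The noncommutative algebraic 2-torus
`O_θ(𝕋²) = ℂ⟨u, u⁻¹, v, v⁻¹⟩ / (u v - e^{-iθ} v u)`. -/
def Torus (θ : ℝ) : Type := RingQuot (TorusRel θ)

namespace Torus

variable (θ : ℝ)

instance : Ring (Torus θ) := inferInstanceAs (Ring (RingQuot (TorusRel θ)))

instance : Algebra ℂ (Torus θ) := inferInstanceAs (Algebra ℂ (RingQuot (TorusRel θ)))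

/-- The projection onto the quotient. -/
def quot : FreeAlgebra ℂ TorusGen →ₐ[ℂ] Torus θ := RingQuot.mkAlgHom ℂ (TorusRel θ)

theorem quot_rel {x y : FreeAlgebra ℂ TorusGen} (h : TorusRel θ x y) : quot θ x = quot θ y :=
  RingQuot.mkAlgHom_rel ℂ h

/-- The generator `u`. -/
def u : Torus θ := quot θ (FreeAlgebra.ι ℂ .u)

/-- The generator `u⁻¹`. -/
def uInv : Torus θ := quot θ (FreeAlgebra.ι ℂ .uInv)

/-- The generator `v`. -/
def v : Torus θ := quot θ (FreeAlgebra.ι ℂ .v)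

/-- The generator `v⁻¹`. -/
def vInv : Torus θ := quot θ (FreeAlgebra.ι ℂ .vInv)

/-- The number `e^{-iθ}`. -/
def phase : ℂˣ := Units.mk0 (Complex.exp (-(θ * Complex.I))) (Complex.exp_ne_zero _)

theorem u_uInv : u θ * uInv θ = 1 := by
  exact (map_mul ..).symm.trans ((quot_rel θ .u_uInv).trans (map_one _))

theorem uInv_u : uInv θ * u θ = 1 := by
  exact (map_mul ..).symm.trans ((quot_rel θ .uInv_u).trans (map_one _))

theorem v_vInv : v θ * vInv θ = 1 := by
  exact (map_mul ..).symm.trans ((quot_rel θ .v_vInv).trans (map_one _))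

theorem vInv_v : vInv θ * v θ = 1 := by
  exact (map_mul ..).symm.trans ((quot_rel θ .vInv_v).trans (map_one _))

theorem u_v : u θ * v θ = (phase θ : ℂ) • (v θ * u θ) := by
  exact (map_mul ..).symm.trans ((quot_rel θ .comm).trans ((map_smul ..).trans
    (congrArg _ (map_mul ..))))

theorem induction {P : Torus θ → Prop} (scalar : ∀ r : ℂ, P (algebraMap ℂ _ r))
    (hu : P (u θ)) (huInv : P (uInv θ)) (hv : P (v θ)) (hvInv : P (vInv θ))
    (add : ∀ a b, P a → P b → P (a + b)) (mul : ∀ a b, P a → P b → P (a * b)) (a : Torus θ) :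
    P a := by
  obtain ⟨x, rfl⟩ : ∃ x, quot θ x = a := RingQuot.mkAlgHom_surjective ℂ (TorusRel θ) a
  induction x using FreeAlgebra.induction with
  | grade0 r => rw [AlgHom.commutes]; exact scalar r
  | grade1 x => cases x <;> assumption
  | mul a b ha hb => rw [map_mul]; exact mul _ _ ha hb
  | add a b ha hb => rw [map_add]; exact add _ _ ha hb

/-- The algebra map out of `O_θ(𝕋²)` given by units `x`, `y` with `x y = e^{-iθ} y x`. -/
def lift {B : Type} [Ring B] [Algebra ℂ B] (x y : Bˣ)
    (h : (x : B) * y = (phase θ : ℂ) • ((y : B) * x)) : Torus θ →ₐ[ℂ] B :=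
  RingQuot.liftAlgHom ℂ ⟨FreeAlgebra.lift ℂ (fun g => match g with
    | .u => (x : B)
    | .uInv => ((x⁻¹ : Bˣ) : B)
    | .v => (y : B)
    | .vInv => ((y⁻¹ : Bˣ) : B)), by
    intro a b hab
    cases hab with
    | comm => simpa [phase] using h
    | _ => simp⟩

section lift

variable {B : Type} [Ring B] [Algebra ℂ B] (x y : Bˣ)
  (h : (x : B) * y = (phase θ : ℂ) • ((y : B) * x))

theorem lift_u : lift θ x y h (u θ) = x :=
  (RingQuot.liftAlgHom_mkAlgHom_apply ..).trans (by simp)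

theorem lift_uInv : lift θ x y h (uInv θ) = ((x⁻¹ : Bˣ) : B) :=
  (RingQuot.liftAlgHom_mkAlgHom_apply ..).trans (by simp)

theorem lift_v : lift θ x y h (v θ) = y :=
  (RingQuot.liftAlgHom_mkAlgHom_apply ..).trans (by simp)

theorem lift_vInv : lift θ x y h (vInv θ) = ((y⁻¹ : Bˣ) : B) :=
  (RingQuot.liftAlgHom_mkAlgHom_apply ..).trans (by simp)

end lift

/-- The right coaction of `O(U(1))` on `O_θ(𝕋²)`: `u ↦ u ⊗ t`, `v ↦ v ⊗ t⁻¹`. -/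
def coaction : Torus θ →ₐ[ℂ] Torus θ ⊗[ℂ] Circle1 :=
  lift θ
    { val := u θ ⊗ₜ Circle1.t
      inv := uInv θ ⊗ₜ Circle1.tInv
      val_inv := by
        simp [u_uInv, Circle1.t_mul_tInv, Algebra.TensorProduct.one_def]
      inv_val := by
        simp [uInv_u, Circle1.tInv_mul_t, Algebra.TensorProduct.one_def] }
    { val := v θ ⊗ₜ Circle1.tInv
      inv := vInv θ ⊗ₜ Circle1.t
      val_inv := by
        simp [v_vInv, Circle1.tInv_mul_t, Algebra.TensorProduct.one_def]
      inv_val := by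
        simp [vInv_v, Circle1.t_mul_tInv, Algebra.TensorProduct.one_def] }
    (by simp [u_v, Circle1.t_mul_tInv, Circle1.tInv_mul_t, TensorProduct.smul_tmul'])

/-- The unit `r u`. -/
def unitU (r : ℂˣ) : (Torus θ)ˣ where
  val := (r : ℂ) • u θ
  inv := ((r⁻¹ : ℂˣ) : ℂ) • uInv θ
  val_inv := by simp [smul_smul, u_uInv]
  inv_val := by simp [smul_smul, uInv_u]

/-- The unit `r v`. -/
def unitV (r : ℂˣ) : (Torus θ)ˣ where
  val := (r : ℂ) • v θ
  inv := ((r⁻¹ : ℂˣ) : ℂ) • vInv θ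
  val_inv := by simp [smul_smul, v_vInv]
  inv_val := by simp [smul_smul, vInv_v]

/-- The automorphism `u ↦ r u`, `v ↦ s v`. -/
def rotate (r s : ℂˣ) : Torus θ →ₐ[ℂ] Torus θ :=
  lift θ (unitU θ r) (unitV θ s) (by
    simp only [unitU, unitV, smul_mul_smul_comm, u_v, smul_smul]
    congr 1
    ring)

/-- The algebra map `a ↦ (a, ∂ᵤ a; 0, σᵤ a)`, with `∂ᵤ u = 1`, `∂ᵤ v = 0`, and `σᵤ` the
automorphism `u ↦ u`, `v ↦ e^{-iθ} v`. -/
def matrixU : Torus θ →ₐ[ℂ] Matrix (Fin 2) (Fin 2) (Torus θ) :=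
  lift θ
    { val := !![u θ, 1; 0, u θ]
      inv := !![uInv θ, -(uInv θ * uInv θ); 0, uInv θ]
      val_inv := by
        ext1 i j; fin_cases i <;> fin_cases j <;>
          simp [Matrix.mul_apply, Fin.sum_univ_two, u_uInv, ← mul_assoc]
      inv_val := by
        ext1 i j; fin_cases i <;> fin_cases j <;>
          simp [Matrix.mul_apply, Fin.sum_univ_two, uInv_u, mul_assoc] }
    { val := !![v θ, 0; 0, (phase θ : ℂ) • v θ]
      inv := !![vInv θ, 0; 0, (((phase θ)⁻¹ : ℂˣ) : ℂ) • vInv θ]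
      val_inv := by
        ext1 i j; fin_cases i <;> fin_cases j <;>
          simp [Matrix.mul_apply, Fin.sum_univ_two, v_vInv, smul_smul]
      inv_val := by
        ext1 i j; fin_cases i <;> fin_cases j <;>
          simp [Matrix.mul_apply, Fin.sum_univ_two, vInv_v, smul_smul] }
    (by
      ext1 i j; fin_cases i <;> fin_cases j <;>
        simp [Matrix.mul_apply, Fin.sum_univ_two, u_v])

/-- The algebra map `a ↦ (a, ∂ᵥ a; 0, σᵥ a)`, with `∂ᵥ u = 0`, `∂ᵥ v = 1`, and `σᵥ` the
automorphism `u ↦ e^{iθ} u`, `v ↦ v`. -/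
def matrixV : Torus θ →ₐ[ℂ] Matrix (Fin 2) (Fin 2) (Torus θ) :=
  lift θ
    { val := !![u θ, 0; 0, (((phase θ)⁻¹ : ℂˣ) : ℂ) • u θ]
      inv := !![uInv θ, 0; 0, (phase θ : ℂ) • uInv θ]
      val_inv := by
        ext1 i j; fin_cases i <;> fin_cases j <;>
          simp [Matrix.mul_apply, Fin.sum_univ_two, u_uInv, smul_smul]
      inv_val := by
        ext1 i j; fin_cases i <;> fin_cases j <;>
          simp [Matrix.mul_apply, Fin.sum_univ_two, uInv_u, smul_smul] }
    { val := !![v θ, 1; 0, v θ]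
      inv := !![vInv θ, -(vInv θ * vInv θ); 0, vInv θ]
      val_inv := by
        ext1 i j; fin_cases i <;> fin_cases j <;>
          simp [Matrix.mul_apply, Fin.sum_univ_two, v_vInv, ← mul_assoc]
      inv_val := by
        ext1 i j; fin_cases i <;> fin_cases j <;>
          simp [Matrix.mul_apply, Fin.sum_univ_two, vInv_v, mul_assoc] }
    (by
      ext1 i j; fin_cases i <;> fin_cases j <;>
        simp [Matrix.mul_apply, Fin.sum_univ_two, u_v, smul_smul])

theorem isUpperU (a : Torus θ) : IsUpper (rotate θ 1 (phase θ)) (matrixU θ) a := by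
  induction a using Torus.induction with
  | scalar r => exact .algebraMap _ _ r
  | hu => constructor <;> simp [rotate, matrixU, lift_u, unitU]
  | huInv => constructor <;> simp [rotate, matrixU, lift_uInv, unitU]
  | hv => constructor <;> simp [rotate, matrixU, lift_v, unitV]
  | hvInv => constructor <;> simp [rotate, matrixU, lift_vInv, unitV]
  | add a b ha hb => exact ha.add hb
  | mul a b ha hb => exact ha.mul hb

theorem isUpperV (a : Torus θ) : IsUpper (rotate θ (phase θ)⁻¹ 1) (matrixV θ) a := by
  induction a using Torus.induction with
  | scalar r => exact .algebraMap _ _ r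
  | hu => constructor <;> simp [rotate, matrixV, lift_u, unitU]
  | huInv => constructor <;> simp [rotate, matrixV, lift_uInv, unitU]
  | hv => constructor <;> simp [rotate, matrixV, lift_v, unitV]
  | hvInv => constructor <;> simp [rotate, matrixV, lift_vInv, unitV]
  | add a b ha hb => exact ha.add hb
  | mul a b ha hb => exact ha.mul hb

/-- The twists of the bimodule: `du a = σᵤ(a) du` and `dv a = σᵥ(a) dv`. -/
def twist : Fin 2 → Torus θ →ₐ[ℂ] Torus θ :=
  ![rotate θ 1 (phase θ), rotate θ (phase θ)⁻¹ 1]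

/-- The first order calculus on `O_θ(𝕋²)` that is free on `du`, `dv` as a left module and has
`du u = u du`, `dv v = v dv`, `du v = e^{-iθ} v du`, `dv u = e^{iθ} u dv`. -/
def firstOrder : FirstOrderCalculus ℂ (Torus θ) (TwistedFree (twist θ)) :=
  TwistedFree.calculus (twist θ) ![upperRight (matrixU θ), upperRight (matrixV θ)]
    (fun i => by
      fin_cases i
      · exact upperRight_mul (isUpperU θ)
      · exact upperRight_mul (isUpperV θ))
    ![u θ, v θ]
    (fun i j => by
      fin_cases i <;> fin_cases j <;>
        simp [upperRight_apply, matrixU, matrixV, lift_u, lift_v])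

/-- The differential calculus on `O_θ(𝕋²)`: the maximal prolongation of the first order calculus
above. -/
def calculus : DifferentialCalculus ℂ (Torus θ) := (firstOrder θ).maximalProlongation

end Torus

end Torus

end

/-! All maps out of a maximal prolongation come from one universal property, `exists_lift`. Given an
algebra map `f : A → B`, a linear map `D` on `B` that obeys the Leibniz rule against the elements `f
a` and `D (f a)`, and a left-linear `g` on 1-forms with `g ∘ d = D ∘ f`, there is an algebra map
from the prolongation that extends `f` and intertwines `d` with `D`. The relations of `S^∧` need no
separate check: they result from applying `D` to `∑ f(aᵢ) D(f(bᵢ)) = 0`. With `B = Ω(A) ⊗ H` and `D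
= d ⊗ id` this gives right covariance; with `B` the graded tensor product and its total differential
it gives completeness. Left covariance on `O(U(1))` is the flip of right covariance, by
cocommutativity. Uniqueness, the coaction laws and the comparison of components are equalities of
algebra maps, so they are tested on functions and exact 1-forms only.

For a twisted free bimodule, `g` exists once `D (f a) = ∑ f(∂ᵢ a) Xᵢ`. Together with the commutation
rule `Xᵢ f(a) = f(σᵢ a) Xᵢ` this condition passes to products, sums and inverses
(`TwistedFree.Compat`), so everything reduces to finitely many commutation relations among the
generators. In the graded tensor product these are `tensorD_mul_tensorIncl`. For the torus they need
`dt` and `d(t⁻¹)` to commute with functions, which is where `p = 1` enters.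

The relations between 2-forms are the differentials of the relations between 1-forms. They make the
degrees above 1 (circle, `p ≠ -1`) and above 2 (torus) vanish. Conversely, nothing more collapses.
In degree 1 the square-zero extension `A ⊕ Γ` is a quotient of the prolongation (`form_injective`).
In degree 2 an explicit 4 × 4 matrix model detects the coefficient of `du ∧ dv`
(`fn_mul_du_mul_dv_injective`); it respects `S^∧` because the twisted partial derivatives commute up
to the phase (`partial_zero_partial_one`).

The component formulas come from expanding `(du ⊗ t + u ⊗ dt)(dv ⊗ t⁻¹ + v ⊗ d(t⁻¹))` and sorting by
bidegree. -/

namespace FirstOrderCalculus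

/-! ### The universal property of the maximal prolongation, and its degree 1 part. -/

section Universal

variable {k A Γ : Type u} [Field k] [Ring A] [Algebra k A]
    [AddCommGroup Γ] [Module k Γ] [Module A Γ] [Module Aᵐᵒᵖ Γ] [SMulCommClass A Aᵐᵒᵖ Γ]
    [IsScalarTower k A Γ] [IsScalarTower k Aᵐᵒᵖ Γ] (F : FirstOrderCalculus k A Γ)

theorem deg_le_of_simple (n : ℕ) (S : Submodule k F.Wedge)
    (h : ∀ (a : A) (l : List A), F.fn a * (l.map fun b => F.form (F.d b)).prod ∈ S) :
    F.deg n ≤ S := by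
  rw [deg_eq_span, Submodule.span_le]
  rintro _ ⟨a, b, rfl⟩
  have := h a (List.ofFn b)
  rw [List.map_ofFn] at this
  simp only [dWedge_fn]
  exact this

/-- Meant for `Φ ∘ d` and `D ∘ Φ`, which are linear but not multiplicative, so that agreement on
algebra generators would not be enough. -/
theorem eq_of_simple {M : Type*} [AddCommGroup M] [Module k M] {φ ψ : F.Wedge →ₗ[k] M}
    (h : ∀ (a : A) (l : List A), φ (F.fn a * (l.map fun b => F.form (F.d b)).prod) =
      ψ (F.fn a * (l.map fun b => F.form (F.d b)).prod)) (x : F.Wedge) : φ x = ψ x := by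
  induction x using F.wedge_induction with
  | hom n x hx => exact F.deg_le_of_simple n (LinearMap.eqLocus φ ψ) h hx
  | add x y hx hy => rw [map_add, map_add, hx, hy]

theorem hom_ext_d {B : Type u} [Semiring B] [Algebra k B] {φ ψ : F.Wedge →ₐ[k] B}
    (h0 : ∀ a, φ (F.fn a) = ψ (F.fn a))
    (h1 : ∀ a, φ (F.form (F.d a)) = ψ (F.form (F.d a))) : φ = ψ := by
  refine F.hom_ext h0 fun ω => ?_
  induction ω using F.form_induction with
  | h a b => rw [form_left, map_mul, map_mul, h0, h1]
  | hadd ω η h1 h2 => rw [map_add, map_add, map_add, h1, h2]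

/-- Every form is a sum of products of functions and exact 1-forms, so an algebra map respects
gradings as soon as it does so on these. -/
theorem map_mem_of_deg {B : Type*} [Ring B] [Algebra k B] (Φ : F.Wedge →ₐ[k] B)
    (G : ℕ → Submodule k B) [SetLike.GradedMonoid G] (h0 : ∀ a, Φ (F.fn a) ∈ G 0)
    (h1 : ∀ a, Φ (F.form (F.d a)) ∈ G 1) (n : ℕ) (x : F.Wedge) (hx : x ∈ F.deg n) :
    Φ x ∈ G n := by
  refine F.deg_induction (P := fun n x => Φ x ∈ G n) h0 ?_ ?_ n x hx
  · intro n x y hx hy; rw [map_add]; exact add_mem hx hy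
  · intro n x ω _ hx
    rw [map_mul]
    refine SetLike.mul_mem_graded hx ?_
    induction ω using F.form_induction with
    | h a b =>
      rw [form_left, map_mul]
      simpa using SetLike.mul_mem_graded (h0 a) (h1 b)
    | hadd ω η h1 h2 => rw [map_add, map_add]; exact add_mem h1 h2

theorem dWedge_prod (l : List A) : F.dWedge (l.map fun b => F.form (F.d b)).prod = 0 := by
  induction l with
  | nil => simpa [d_one] using F.dWedge_fn 1
  | cons b l ih =>
    rw [List.map_cons, List.prod_cons, F.dWedge_mul 1 _ _ (F.form_mem _), ih, dWedge_form, dForm_d]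
    simp

/-- The universal property of the maximal prolongation: it maps to every differential graded
algebra to which the first order calculus maps. -/
theorem exists_lift {B : Type u} [Ring B] [Algebra k B] (f : A →ₐ[k] B) (D : B →ₗ[k] B)
    (g : Γ →+ B) (hl : ∀ a ω, g (a • ω) = f a * g ω) (hd : ∀ a, g (F.d a) = D (f a))
    (leibniz : ∀ a x, D (f a * x) = D (f a) * x + f a * D x)
    (leibniz' : ∀ a x, D (D (f a) * x) = -(D (f a) * D x)) :
    ∃ Φ : F.Wedge →ₐ[k] B, (∀ a, Φ (F.fn a) = f a) ∧ ∀ x, Φ (F.dWedge x) = D (Φ x) := by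
  have D_one : D 1 = 0 := by
    have := leibniz 1 1
    simpa using this
  have D_D (a : A) : D (D (f a)) = 0 := by
    have := leibniz' a 1
    simpa [D_one] using this
  -- Right linearity follows from left linearity, because the Leibniz rule expresses the right
  -- action through the left one: `(b dc) a = b d(ca) - bc da`.
  have hr (a : A) (ω : Γ) : g (MulOpposite.op a • ω) = g ω * f a := by
    induction ω using F.form_induction with
    | h b c =>
      have h : MulOpposite.op a • b • F.d c = b • F.d (c * a) - (b * c) • F.d a := by
        rw [F.leibniz, smul_add, smul_smul, add_sub_cancel_right, smul_comm b (MulOpposite.op a)]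
      rw [h, map_sub, hl, hl, hl, hd, hd, hd, map_mul, leibniz, map_mul]
      noncomm_ring
    | hadd ω η h1 h2 => rw [smul_add, map_add, map_add, h1, h2, add_mul]
  -- Apply `D ∘ g` to the hypothesis. The terms `f(aᵢ) D(D(f(bᵢ)))` vanish and the rest is the
  -- relation of `S^∧`.
  have hw (n : ℕ) (a b : Fin n → A) (h : ∑ i, a i • F.d (b i) = 0) :
      ∑ i, g (F.d (a i)) * g (F.d (b i)) = 0 := by
    have h' := congrArg (fun ω => D (g ω)) h
    simpa [hl, hd, leibniz, D_D] using h'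
  have hΦ0 (a : A) : F.lift f g hl hr hw (F.fn a) = f a := F.lift_fn ..
  have hΦ1 (a : A) : F.lift f g hl hr hw (F.form (F.d a)) = D (f a) :=
    (F.lift_form ..).trans (hd a)
  refine ⟨F.lift f g hl hr hw, hΦ0, ?_⟩
  generalize F.lift f g hl hr hw = Φ at hΦ0 hΦ1
  -- Products of exact 1-forms are closed in the prolongation, and `leibniz'` makes their images
  -- closed too. Hence both sides of the intertwining relation reduce to `D` of the leading
  -- coefficient times the product.
  have hprod (l : List A) : D (Φ (l.map fun b => F.form (F.d b)).prod) = 0 := by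
    induction l with
    | nil => simp [D_one]
    | cons b l ih => rw [List.map_cons, List.prod_cons, map_mul, hΦ1, leibniz', ih]; simp
  refine F.eq_of_simple (φ := Φ.toLinearMap ∘ₗ F.dWedge) (ψ := D ∘ₗ Φ.toLinearMap) fun a l => ?_
  simp only [LinearMap.comp_apply, AlgHom.toLinearMap_apply]
  rw [F.dWedge_mul 0 _ _ (F.fn_mem a), dWedge_prod, dWedge_fn, map_mul Φ (F.fn a), hΦ0, leibniz,
    hprod]
  simp [hΦ1]

/-- Products of two 1-forms vanish in the square-zero extension `A ⊕ Γ`, so the relations of `S^∧`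
hold there trivially. The prolongation therefore maps onto it, and `Γ` survives. -/
theorem form_injective : Function.Injective F.form := by
  intro ω η h
  have := congrArg (F.lift (TrivSqZeroExt.inlAlgHom k A Γ) (TrivSqZeroExt.inrHom A Γ).toAddMonoidHom
    (by intro a ω; ext <;> simp) (by intro a ω; ext <;> simp) (by simp)) h
  simp only [lift_form] at this
  exact TrivSqZeroExt.inr_injective this

theorem mem_deg_one {x : F.Wedge} : x ∈ F.deg 1 ↔ ∃ ω, F.form ω = x := by
  constructor
  · intro hx
    rw [deg, pow_one] at hx
    induction hx using Submodule.mul_induction_on' with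
    | mem_mul_mem m hm w hw =>
      obtain ⟨a, rfl⟩ := hm
      obtain ⟨ω, rfl⟩ := hw
      exact ⟨a • ω, F.form_left a ω⟩
    | add x _ y _ hx hy =>
      obtain ⟨ω, rfl⟩ := hx
      obtain ⟨η, rfl⟩ := hy
      exact ⟨ω + η, map_add ..⟩
  · rintro ⟨ω, rfl⟩
    exact F.form_mem ω

theorem deg_succ (n : ℕ) : F.deg (n + 1) = F.deg n * LinearMap.range F.form := by
  simp only [deg, pow_succ, mul_assoc]

theorem deg_eq_bot_of_le {m n : ℕ} (h : F.deg m = ⊥) (hmn : m ≤ n) : F.deg n = ⊥ := by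
  induction n, hmn using Nat.le_induction with
  | base => exact h
  | succ n _ ih => rw [deg_succ, ih, Submodule.bot_mul]

end Universal

/-! ### Right covariance of a maximal prolongation. -/

section Covariance

open DifferentialCalculus

variable {k A Γ H : Type u} [Field k] [Ring A] [Algebra k A]
    [AddCommGroup Γ] [Module k Γ] [Module A Γ] [Module Aᵐᵒᵖ Γ] [SMulCommClass A Aᵐᵒᵖ Γ]
    [IsScalarTower k A Γ] [IsScalarTower k Aᵐᵒᵖ Γ] (F : FirstOrderCalculus k A Γ)
    [Ring H] [HopfAlgebra k H]

/-- The left factor has form degree 0, so no sign appears. This is the Leibniz hypothesis of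
`exists_lift` for `D = d ⊗ id`. -/
theorem rTensor_dWedge_mul (z : A ⊗[k] H) (x : F.Wedge ⊗[k] H) :
      F.dWedge.rTensor H (Algebra.TensorProduct.map F.fn (AlgHom.id k H) z * x) =
      F.dWedge.rTensor H (Algebra.TensorProduct.map F.fn (AlgHom.id k H) z) * x +
      Algebra.TensorProduct.map F.fn (AlgHom.id k H) z * F.dWedge.rTensor H x := by
  induction z with
  | zero => simp
  | add y z hy hz => simp only [map_add, add_mul, hy, hz]; abel
  | tmul a h =>
    induction x with
    | zero => simp
    | add y z hy hz => simp only [map_add, mul_add, hy, hz]; abel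
    | tmul x h' => simp [F.dWedge_mul 0 _ _ (F.fn_mem a), TensorProduct.add_tmul]

/-- The universal property with target `Ω(A) ⊗ H` produces `Ψ`. Both sides of each coaction law are
algebra maps, so they are compared on functions, where they are the laws of `Δ`, and on exact
1-forms, where the laws of `Δ` are transported by `d ⊗ id`. -/
theorem exists_isRightCovariantCoaction {Δ : A →ₐ[k] A ⊗[k] H} (hΔ : IsRightCoaction Δ)
    (g : Γ →+ F.Wedge ⊗[k] H)
    (hl : ∀ a ω, g (a • ω) = Algebra.TensorProduct.map F.fn (AlgHom.id k H) (Δ a) * g ω)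
    (hd : ∀ a, g (F.d a) =
      F.dWedge.rTensor H (Algebra.TensorProduct.map F.fn (AlgHom.id k H) (Δ a))) :
    ∃ Ψ : F.Wedge →ₐ[k] F.Wedge ⊗[k] H,
      IsRightCovariantCoaction Δ F.maximalProlongation Ψ := by
  have leibniz' (z : A ⊗[k] H) (x : F.Wedge ⊗[k] H) :
      F.dWedge.rTensor H
        (F.dWedge.rTensor H (Algebra.TensorProduct.map F.fn (AlgHom.id k H) z) * x) =
      -(F.dWedge.rTensor H (Algebra.TensorProduct.map F.fn (AlgHom.id k H) z) *
        F.dWedge.rTensor H x) := by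
    induction z with
    | zero => simp
    | add y z hy hz => simp only [map_add, add_mul, hy, hz]; abel
    | tmul a h =>
      induction x with
      | zero => simp
      | add y z hy hz => simp only [map_add, mul_add, hy, hz]; abel
      | tmul x h' =>
        simp [F.dWedge_mul 1 _ _ (F.form_mem _), dWedge_fn, dWedge_form, dForm_d,
          TensorProduct.neg_tmul]
  obtain ⟨Ψ, h0, h1⟩ := F.exists_lift
    ((Algebra.TensorProduct.map F.fn (AlgHom.id k H)).comp Δ) (F.dWedge.rTensor H) g hl hd
    (fun a => F.rTensor_dWedge_mul _) (fun a => leibniz' _)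
  have hmap (z : A ⊗[k] H) : Algebra.TensorProduct.map F.fn (AlgHom.id k H) z =
      F.fn.toLinearMap.rTensor H z := rfl
  simp only [AlgHom.comp_apply, hmap] at h0
  have hform (a : A) : Ψ (F.form (F.d a)) =
      F.dWedge.rTensor H (F.fn.toLinearMap.rTensor H (Δ a)) := by
    rw [← dWedge_fn, h1, h0]
  refine ⟨Ψ, ⟨?_, ?_⟩, ?_, h0, h1⟩
  -- The differential passes through the iterated coaction because `Ψ` is already known to be
  -- colinear for `d`.
  · have assoc_d (z : F.Wedge ⊗[k] H) :
        TensorProduct.assoc k F.Wedge H H (Ψ.toLinearMap.rTensor H (F.dWedge.rTensor H z)) =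
        F.dWedge.rTensor (H ⊗[k] H)
          (TensorProduct.assoc k F.Wedge H H (Ψ.toLinearMap.rTensor H z)) := by
      induction z with
      | zero => simp
      | add y z hy hz => simp only [map_add, hy, hz]
      | tmul x h =>
        simp only [LinearMap.rTensor_tmul, AlgHom.toLinearMap_apply, h1]
        generalize Ψ x = y
        induction y with
        | zero => simp
        | add y z hy hz => simp only [map_add, TensorProduct.add_tmul, hy, hz]
        | tmul x h => simp
    have assoc_fn (z : A ⊗[k] H) :
        TensorProduct.assoc k F.Wedge H H
          (Ψ.toLinearMap.rTensor H (F.fn.toLinearMap.rTensor H z)) =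
        F.fn.toLinearMap.rTensor (H ⊗[k] H)
          (TensorProduct.assoc k A H H (Δ.toLinearMap.rTensor H z)) := by
      induction z with
      | zero => simp
      | add y z hy hz => simp only [map_add, hy, hz]
      | tmul x h =>
        simp only [LinearMap.rTensor_tmul, AlgHom.toLinearMap_apply, h0]
        generalize Δ x = y
        induction y with
        | zero => simp
        | add y z hy hz => simp only [map_add, TensorProduct.add_tmul, hy, hz]
        | tmul x h => simp
    have comul_fn (z : A ⊗[k] H) : (Coalgebra.comul (R := k) (A := H)).lTensor F.Wedge
        (F.fn.toLinearMap.rTensor H z) = F.fn.toLinearMap.rTensor (H ⊗[k] H)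
          ((Coalgebra.comul (R := k) (A := H)).lTensor A z) := by
      rw [← LinearMap.comp_apply, ← LinearMap.comp_apply, LinearMap.lTensor_comp_rTensor,
        LinearMap.rTensor_comp_lTensor]
    have comul_d (z : F.Wedge ⊗[k] H) : (Coalgebra.comul (R := k) (A := H)).lTensor F.Wedge
        (F.dWedge.rTensor H z) = F.dWedge.rTensor (H ⊗[k] H)
          ((Coalgebra.comul (R := k) (A := H)).lTensor F.Wedge z) := by
      rw [← LinearMap.comp_apply, ← LinearMap.comp_apply, LinearMap.lTensor_comp_rTensor,
        LinearMap.rTensor_comp_lTensor]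
    have key : ((Algebra.TensorProduct.assoc k k k F.Wedge H H).toAlgHom.comp
        (Algebra.TensorProduct.map Ψ (AlgHom.id k H))).comp Ψ =
        (Algebra.TensorProduct.map (AlgHom.id k F.Wedge) (Bialgebra.comulAlgHom k H)).comp Ψ := by
      apply F.hom_ext_d
      · intro a
        change TensorProduct.assoc k F.Wedge H H (Ψ.toLinearMap.rTensor H (Ψ (F.fn a))) =
          (Coalgebra.comul (R := k) (A := H)).lTensor F.Wedge (Ψ (F.fn a))
        rw [h0, assoc_fn, comul_fn, hΔ.coassoc]
      · intro a
        change TensorProduct.assoc k F.Wedge H H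
            (Ψ.toLinearMap.rTensor H (Ψ (F.form (F.d a)))) =
          (Coalgebra.comul (R := k) (A := H)).lTensor F.Wedge (Ψ (F.form (F.d a)))
        rw [hform, assoc_d, assoc_fn, comul_d, comul_fn, hΔ.coassoc]
    exact fun x => DFunLike.congr_fun key x
  · have key : (Algebra.TensorProduct.map (AlgHom.id k F.Wedge)
        (Bialgebra.counitAlgHom k H)).comp Ψ = Algebra.TensorProduct.includeLeft := by
      have counit_fn (z : A ⊗[k] H) : (Coalgebra.counit (R := k) (A := H)).lTensor F.Wedge
          (F.fn.toLinearMap.rTensor H z) = F.fn.toLinearMap.rTensor k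
            ((Coalgebra.counit (R := k) (A := H)).lTensor A z) := by
        rw [← LinearMap.comp_apply, ← LinearMap.comp_apply, LinearMap.lTensor_comp_rTensor,
          LinearMap.rTensor_comp_lTensor]
      have counit_d (z : F.Wedge ⊗[k] H) : (Coalgebra.counit (R := k) (A := H)).lTensor F.Wedge
          (F.dWedge.rTensor H z) = F.dWedge.rTensor k
            ((Coalgebra.counit (R := k) (A := H)).lTensor F.Wedge z) := by
        rw [← LinearMap.comp_apply, ← LinearMap.comp_apply, LinearMap.lTensor_comp_rTensor,
          LinearMap.rTensor_comp_lTensor]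
      apply F.hom_ext_d
      · intro a
        change (Coalgebra.counit (R := k) (A := H)).lTensor F.Wedge (Ψ (F.fn a)) = F.fn a ⊗ₜ 1
        rw [h0, counit_fn, hΔ.counit]
        rfl
      · intro a
        change (Coalgebra.counit (R := k) (A := H)).lTensor F.Wedge (Ψ (F.form (F.d a))) =
          F.form (F.d a) ⊗ₜ 1
        rw [hform, counit_d, counit_fn, hΔ.counit, LinearMap.rTensor_tmul, LinearMap.rTensor_tmul,
          AlgHom.toLinearMap_apply, dWedge_fn]
    exact fun x => DFunLike.congr_fun key x
  -- The images of `Ωⁿ(A) ⊗ H` multiply like a grading, so `map_mem_of_deg` applies.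
  · have : SetLike.GradedMonoid
        fun n => LinearMap.range ((F.deg n).subtype.rTensor H) :=
      { one_mem := ⟨⟨1, SetLike.GradedOne.one_mem⟩ ⊗ₜ 1, rfl⟩
        mul_mem := by
          rintro m n _ _ ⟨x, rfl⟩ ⟨y, rfl⟩
          induction x with
          | zero => simp
          | add x x' hx hx' => rw [map_add, add_mul]; exact add_mem hx hx'
          | tmul x h =>
            induction y with
            | zero => simp
            | add y y' hy hy' => rw [map_add, mul_add]; exact add_mem hy hy'
            | tmul y h' =>
              exact ⟨⟨x * y, SetLike.mul_mem_graded x.2 y.2⟩ ⊗ₜ (h * h'), by simp⟩ }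
    refine F.map_mem_of_deg Ψ (fun n => LinearMap.range ((F.deg n).subtype.rTensor H)) ?_ ?_
    · intro a
      rw [h0]
      generalize Δ a = z
      induction z with
      | zero => simp
      | add y z hy hz => rw [map_add]; exact add_mem hy hz
      | tmul a h => exact ⟨⟨F.fn a, F.fn_mem a⟩ ⊗ₜ h, by simp⟩
    · intro a
      rw [hform]
      generalize Δ a = z
      induction z with
      | zero => simp
      | add y z hy hz => rw [map_add, map_add]; exact add_mem hy hz
      | tmul a h => exact ⟨⟨F.form (F.d a), F.form_mem _⟩ ⊗ₜ h, by simp [dWedge_fn]⟩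

end Covariance

end FirstOrderCalculus

/-! ### From right to left covariance over a cocommutative Hopf algebra. -/

namespace DifferentialCalculus

variable {k A H : Type u} [Field k] [Ring A] [Algebra k A] [Ring H] [HopfAlgebra k H]
  [Coalgebra.IsCocomm k H]

/-- Flipping the tensor factors reverses the order of the two copies of `H` in the coassociativity
law, and cocommutativity absorbs this reversal. -/
theorem IsRightCoaction.comm {Δ : A →ₐ[k] A ⊗[k] H} (h : IsRightCoaction Δ) :
    IsLeftCoaction ((Algebra.TensorProduct.comm k A H).toAlgHom.comp Δ) := by
  constructor
  · intro a
    have h1 (z : A ⊗[k] H) : (TensorProduct.assoc k H H A).symm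
        (((Algebra.TensorProduct.comm k A H).toAlgHom.comp Δ).toLinearMap.lTensor H
          (TensorProduct.comm k A H z)) =
        TensorProduct.comm k A (H ⊗[k] H) ((TensorProduct.comm k H H).toLinearMap.lTensor A
          (TensorProduct.assoc k A H H (Δ.toLinearMap.rTensor H z))) := by
      induction z with
      | zero => simp
      | add y z hy hz => simp only [map_add, hy, hz]
      | tmul x h =>
        simp only [TensorProduct.comm_tmul, LinearMap.lTensor_tmul, AlgHom.toLinearMap_apply,
          AlgHom.comp_apply, LinearMap.rTensor_tmul]
        generalize Δ x = y
        induction y with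
        | zero => simp
        | add y z hy hz =>
          simp only [map_add, TensorProduct.add_tmul, TensorProduct.tmul_add, hy, hz]
        | tmul x h => simp
    -- Cocommutativity enters here: the swap on `H ⊗ H` fixes every coproduct.
    have h2 (z : A ⊗[k] H) : (Coalgebra.comul (R := k) (A := H)).rTensor A
        (TensorProduct.comm k A H z) = TensorProduct.comm k A (H ⊗[k] H)
          ((TensorProduct.comm k H H).toLinearMap.lTensor A
            ((Coalgebra.comul (R := k) (A := H)).lTensor A z)) := by
      induction z with
      | zero => simp
      | add y z hy hz => simp only [map_add, hy, hz]
      | tmul x h => simp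
    have h3 : ((Algebra.TensorProduct.comm k A H).toAlgHom.comp Δ) a =
      TensorProduct.comm k A H (Δ a) := rfl
    rw [h3, h1, h2, h.coassoc]
  · intro a
    have h2 (z : A ⊗[k] H) : (Coalgebra.counit (R := k) (A := H)).rTensor A
        (TensorProduct.comm k A H z) = TensorProduct.comm k A k
          ((Coalgebra.counit (R := k) (A := H)).lTensor A z) := by
      induction z with
      | zero => simp
      | add y z hy hz => simp only [map_add, hy, hz]
      | tmul x h => simp
    exact (h2 (Δ a)).trans (by rw [h.counit, TensorProduct.comm_tmul])

theorem IsRightCovariant.comm {Δ : A →ₐ[k] A ⊗[k] H} {Ω : DifferentialCalculus k A}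
    (h : IsRightCovariant Δ Ω) :
    IsLeftCovariant ((Algebra.TensorProduct.comm k A H).toAlgHom.comp Δ) Ω := by
  obtain ⟨Ψ, hΨ⟩ := h
  have hnat {M N : Type u} [AddCommGroup M] [Module k M] [AddCommGroup N] [Module k N]
      (φ : M →ₗ[k] N) (z : M ⊗[k] H) : TensorProduct.comm k N H (φ.rTensor H z) =
        φ.lTensor H (TensorProduct.comm k M H z) := by
    induction z with
    | zero => simp
    | add y z hy hz => simp only [map_add, hy, hz]
    | tmul x h => simp
  refine ⟨(Algebra.TensorProduct.comm k Ω.Form H).toAlgHom.comp Ψ, hΨ.coaction.comm, ?_, ?_, ?_⟩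
  · intro n ω hω
    obtain ⟨z, hz⟩ := hΨ.map_grade n ω hω
    exact ⟨TensorProduct.comm k _ H z, by rw [← hnat, hz]; rfl⟩
  · intro a
    have := congrArg (TensorProduct.comm k Ω.Form H) (hΨ.map_incl a)
    rwa [hnat] at this
  · intro ω
    have := congrArg (TensorProduct.comm k Ω.Form H) (hΨ.map_d ω)
    rwa [hnat] at this

end DifferentialCalculus

/-! ### The graded tensor product of two calculi as a differential graded algebra, and its
bidegrees. -/

namespace DifferentialCalculus

section GradedTensor

variable {k A H : Type u} [Field k] [Ring A] [Algebra k A] [Ring H] [Algebra k H]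
  (Ω : DifferentialCalculus k A) (Ω' : DifferentialCalculus k H)

theorem incl_mem (a : A) : Ω.incl a ∈ Ω.grade 0 := by
  rw [← Ω.range_incl]; exact ⟨a, rfl⟩

theorem d_incl_mem (a : A) : Ω.d (Ω.incl a) ∈ Ω.grade 1 := Ω.d_mem 0 _ (Ω.incl_mem a)

theorem form_induction {P : Ω.Form → Prop} (hom : ∀ n x, x ∈ Ω.grade n → P x)
    (add : ∀ x y, P x → P y → P (x + y)) (x : Ω.Form) : P x := by
  have hx : x ∈ ⨆ n, Ω.grade n := by
    rw [(DirectSum.Decomposition.isInternal Ω.grade).submodule_iSup_eq_top]; trivial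
  induction hx using Submodule.iSup_induction' with
  | mem n x hx => exact hom n x hx
  | zero => exact hom 0 0 (zero_mem _)
  | add x y _ _ hx hy => exact add x y hx hy

theorem sign_of_mem {n : ℕ} {ω : Ω.Form} (h : ω ∈ Ω.grade n) : Ω.sign ω = (-1 : k) ^ n • ω := by
  rw [sign, LinearMap.comp_apply, LinearEquiv.coe_coe, DirectSum.decomposeLinearEquiv_apply,
    DirectSum.decompose_of_mem _ h, ← DirectSum.lof_eq_of k, DirectSum.toModule_lof]
  rfl

theorem proj_of_mem {n : ℕ} {ω : Ω.Form} (h : ω ∈ Ω.grade n) :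
    GradedAlgebra.proj Ω.grade n ω = ω := by
  rw [GradedAlgebra.proj_apply, DirectSum.decompose_of_mem_same _ h]

theorem proj_of_mem_ne {m n : ℕ} {ω : Ω.Form} (h : ω ∈ Ω.grade m) (hmn : m ≠ n) :
    GradedAlgebra.proj Ω.grade n ω = 0 := by
  rw [GradedAlgebra.proj_apply, DirectSum.decompose_of_mem_ne _ h hmn]

variable {Ω Ω'}

theorem tensor_induction {P : Ω.Tensor Ω' → Prop}
    (tmul : ∀ i j ω η, ω ∈ Ω.grade i → η ∈ Ω'.grade j → P (ω ᵍ⊗ₜ[k] η))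
    (add : ∀ x y, P x → P y → P (x + y)) (x : Ω.Tensor Ω') : P x := by
  obtain ⟨x, rfl⟩ := (GradedTensorProduct.of k Ω.grade Ω'.grade).surjective x
  induction x with
  | zero => simpa [GradedTensorProduct.tmul] using tmul 0 0 0 0 (zero_mem _) (zero_mem _)
  | add x y hx hy => rw [map_add]; exact add _ _ hx hy
  | tmul ω η =>
    induction ω using Ω.form_induction with
    | add x y hx hy => rw [TensorProduct.add_tmul, map_add]; exact add _ _ hx hy
    | hom i ω hω =>
      induction η using Ω'.form_induction with
      | add x y hx hy => rw [TensorProduct.tmul_add, map_add]; exact add _ _ hx hy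
      | hom j η hη => exact tmul i j ω η hω hη

theorem tmul_mul_tmul {i j : ℕ} (ω : Ω.Form) {η : Ω'.Form} {ω' : Ω.Form} (η' : Ω'.Form)
    (hη : η ∈ Ω'.grade j) (hω' : ω' ∈ Ω.grade i) :
    (ω ᵍ⊗ₜ[k] η * ω' ᵍ⊗ₜ[k] η' : Ω.Tensor Ω') =
      (-1 : k) ^ (j * i) • ((ω * ω') ᵍ⊗ₜ[k] (η * η') : Ω.Tensor Ω') := by
  have h := GradedTensorProduct.tmul_coe_mul_coe_tmul Ω.grade Ω'.grade ω ⟨η, hη⟩ ⟨ω', hω'⟩ η'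
  refine h.trans ?_
  rw [Units.smul_def, ← Int.cast_smul_eq_zsmul k]
  congr 1
  simp

/-- The Koszul sign depends only on the two inner factors `η` and `ω'`. If one of them has degree 0
it is trivial, even when the other is inhomogeneous. -/
theorem tmul_mul_tmul_of_left {ω : Ω.Form} {η : Ω'.Form} {ω' : Ω.Form} {η' : Ω'.Form}
    (hη : η ∈ Ω'.grade 0) :
    (ω ᵍ⊗ₜ[k] η * ω' ᵍ⊗ₜ[k] η' : Ω.Tensor Ω') = (ω * ω') ᵍ⊗ₜ[k] (η * η') := by
  induction ω' using Ω.form_induction with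
  | hom n x hx => rw [tmul_mul_tmul ω η' hη hx]; simp
  | add x y hx hy =>
    simp only [mul_add, GradedTensorProduct.tmul, TensorProduct.add_tmul, map_add] at hx hy ⊢
    rw [hx, hy]

theorem tmul_mul_tmul_of_right {ω : Ω.Form} {η : Ω'.Form} {ω' : Ω.Form} {η' : Ω'.Form}
    (hω' : ω' ∈ Ω.grade 0) :
    (ω ᵍ⊗ₜ[k] η * ω' ᵍ⊗ₜ[k] η' : Ω.Tensor Ω') = (ω * ω') ᵍ⊗ₜ[k] (η * η') := by
  induction η using Ω'.form_induction with
  | hom n x hx => rw [tmul_mul_tmul ω η' hx hω']; simp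
  | add x y hx hy =>
    simp only [add_mul, GradedTensorProduct.tmul, TensorProduct.tmul_add, map_add] at hx hy ⊢
    rw [hx, hy]

theorem tensorD_tmul {i : ℕ} {ω : Ω.Form} (hω : ω ∈ Ω.grade i) (η : Ω'.Form) :
    Ω.tensorD Ω' (ω ᵍ⊗ₜ[k] η) =
      (Ω.d ω) ᵍ⊗ₜ[k] η + (-1 : k) ^ i • (ω ᵍ⊗ₜ[k] (Ω'.d η) : Ω.Tensor Ω') := by
  simp [tensorD, Ω.sign_of_mem hω, GradedTensorProduct.tmul, TensorProduct.smul_tmul', ← map_smul]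

theorem tensorD_tensorD (x : Ω.Tensor Ω') : Ω.tensorD Ω' (Ω.tensorD Ω' x) = 0 := by
  induction x using tensor_induction with
  | add x y hx hy => simp only [map_add, hx, hy, add_zero]
  | tmul i j ω η hω hη =>
    rw [tensorD_tmul hω, map_add, map_smul, tensorD_tmul hω, tensorD_tmul (Ω.d_mem i ω hω),
      Ω.d_d, Ω'.d_d]
    simp [pow_succ, GradedTensorProduct.tmul]

theorem tmul_mem_tensorGrade {i j : ℕ} {ω : Ω.Form} {η : Ω'.Form} (hω : ω ∈ Ω.grade i)
    (hη : η ∈ Ω'.grade j) : ω ᵍ⊗ₜ[k] η ∈ Ω.tensorGrade Ω' (i + j) :=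
  Submodule.subset_span ⟨i, j, ω, η, rfl, hω, hη, rfl⟩

/-- On homogeneous pure tensors both sides are combinations of the same four tensors, with `d` on
one of `ω`, `η`, `ω'`, `η'`; only the signs have to be matched. -/
theorem tensorD_mul {n : ℕ} {x : Ω.Tensor Ω'} (hx : x ∈ Ω.tensorGrade Ω' n) (y : Ω.Tensor Ω') :
    Ω.tensorD Ω' (x * y) = Ω.tensorD Ω' x * y + (-1 : k) ^ n • (x * Ω.tensorD Ω' y) := by
  induction hx using Submodule.span_induction with
  | zero => simp
  | add x x' _ _ hx hx' => simp only [add_mul, map_add, hx, hx', smul_add]; abel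
  | smul r x _ hx => simp only [smul_mul_assoc, map_smul, hx, smul_add, smul_comm r]
  | mem x hx =>
    obtain ⟨i, j, ω, η, rfl, hω, hη, rfl⟩ := hx
    induction y using tensor_induction with
    | add y y' hy hy' => simp only [mul_add, map_add, hy, hy', smul_add]; abel
    | tmul i' j' ω' η' hω' hη' =>
      rw [tmul_mul_tmul ω η' hη hω', map_smul, tensorD_tmul (SetLike.mul_mem_graded hω hω'),
        tensorD_tmul hω, tensorD_tmul hω', Ω.leibniz i _ _ hω, Ω'.leibniz j _ _ hη, add_mul,
        mul_add, smul_mul_assoc, mul_smul_comm, tmul_mul_tmul _ _ hη hω',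
        tmul_mul_tmul _ _ (Ω'.d_mem j _ hη) hω', tmul_mul_tmul _ _ hη (Ω.d_mem i' _ hω'),
        tmul_mul_tmul _ _ hη hω']
      simp only [GradedTensorProduct.tmul, TensorProduct.add_tmul, TensorProduct.tmul_add, map_add,
        TensorProduct.tmul_smul, ← TensorProduct.smul_tmul', map_smul, smul_add, smul_smul]
      -- The identities `e1`, `e2`, `e3` match the signs of the terms with `dω'`, `dη`, `dη'`. In
      -- `e1`, moving `η` past `dω'` costs an extra `(-1)^j`, which cancels the one in the total
      -- degree `i + j`; hence `h2`.
      have h2 (m : ℕ) : ((-1 : k) ^ m) * (-1) ^ m = 1 := by rw [← mul_pow]; simp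
      have e1 : (-1 : k) ^ (j * i') * (-1) ^ i = (-1) ^ (i + j) * (-1) ^ (j * (i' + 1)) := by
        linear_combination (-(-1 : k) ^ (j * i') * (-1) ^ i) * h2 j
      have e2 : (-1 : k) ^ (j * i') * (-1) ^ (i + i') = (-1) ^ i * (-1) ^ ((j + 1) * i') := by
        ring
      have e3 : (-1 : k) ^ (j * i') * ((-1) ^ (i + i') * (-1) ^ j) =
          (-1) ^ (i + j) * ((-1) ^ i' * (-1) ^ (j * i')) := by
        ring
      simp only [e1, e2, e3]
      abel

instance : SetLike.GradedMonoid (Ω.tensorGrade Ω') where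
  one_mem := tmul_mem_tensorGrade (i := 0) (j := 0) SetLike.GradedOne.one_mem
    SetLike.GradedOne.one_mem
  mul_mem m n x y hx hy := by
    induction hx using Submodule.span_induction with
    | zero => simp
    | add x x' _ _ hx hx' => rw [add_mul]; exact add_mem hx hx'
    | smul r x _ hx => rw [smul_mul_assoc]; exact Submodule.smul_mem _ r hx
    | mem x hx =>
      obtain ⟨i, j, ω, η, rfl, hω, hη, rfl⟩ := hx
      induction hy using Submodule.span_induction with
      | zero => simp
      | add x x' _ _ hx hx' => rw [mul_add]; exact add_mem hx hx'
      | smul r x _ hx => rw [mul_smul_comm]; exact Submodule.smul_mem _ r hx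
      | mem y hy =>
        obtain ⟨i', j', ω', η', rfl, hω', hη', rfl⟩ := hy
        rw [tmul_mul_tmul _ _ hη hω', add_add_add_comm]
        exact Submodule.smul_mem _ _ (tmul_mem_tensorGrade (SetLike.mul_mem_graded hω hω')
          (SetLike.mul_mem_graded hη hη'))

theorem tensorD_mem {n : ℕ} {x : Ω.Tensor Ω'} (hx : x ∈ Ω.tensorGrade Ω' n) :
    Ω.tensorD Ω' x ∈ Ω.tensorGrade Ω' (n + 1) := by
  induction hx using Submodule.span_induction with
  | zero => simp
  | add x x' _ _ hx hx' => rw [map_add]; exact add_mem hx hx'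
  | smul r x _ hx => rw [map_smul]; exact Submodule.smul_mem _ r hx
  | mem x hx =>
    obtain ⟨i, j, ω, η, rfl, hω, hη, rfl⟩ := hx
    rw [tensorD_tmul hω]
    have h1 := tmul_mem_tensorGrade (Ω.d_mem i ω hω) hη
    rw [add_right_comm] at h1
    have h2 := tmul_mem_tensorGrade hω (Ω'.d_mem j η hη)
    rw [← add_assoc] at h2
    exact add_mem h1 (Submodule.smul_mem _ _ h2)

variable (Ω Ω')

theorem tensorIncl_tmul (a : A) (h : H) :
    Ω.tensorIncl Ω' (a ⊗ₜ h) = (Ω.incl a) ᵍ⊗ₜ[k] (Ω'.incl h) := rfl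

theorem tensorInclRight_tmul (ω : Ω.Form) (h : H) :
    Ω.tensorInclRight Ω' (ω ⊗ₜ h) = ω ᵍ⊗ₜ[k] (Ω'.incl h) := rfl

/-- `tensorInclRight` as an algebra map. -/
noncomputable def tensorInclRightHom : Ω.Form ⊗[k] H →ₐ[k] Ω.Tensor Ω' :=
  AlgHom.ofLinearMap (Ω.tensorInclRight Ω')
    (by rw [Algebra.TensorProduct.one_def, tensorInclRight_tmul, map_one]; rfl)
    (by
      intro x y
      induction x with
      | zero => simp
      | add x x' hx hx' => simp only [add_mul, map_add, hx, hx']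
      | tmul ω h =>
        induction y with
        | zero => simp
        | add y y' hy hy' => simp only [mul_add, map_add, hy, hy']
        | tmul ω' h' =>
          rw [Algebra.TensorProduct.tmul_mul_tmul, tensorInclRight_tmul, tensorInclRight_tmul,
            tensorInclRight_tmul, tmul_mul_tmul_of_left (Ω'.incl_mem h), map_mul])

/-- `tensorIncl` as an algebra map. -/
noncomputable def tensorInclHom : A ⊗[k] H →ₐ[k] Ω.Tensor Ω' :=
  (Ω.tensorInclRightHom Ω').comp (Algebra.TensorProduct.map Ω.incl (AlgHom.id k H))

theorem tensorInclRightHom_apply (z : Ω.Form ⊗[k] H) :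
    Ω.tensorInclRightHom Ω' z = Ω.tensorInclRight Ω' z := rfl

theorem tensorInclHom_apply (z : A ⊗[k] H) : Ω.tensorInclHom Ω' z = Ω.tensorIncl Ω' z := by
  induction z with
  | zero => simp
  | add y z hy hz => simp only [map_add, hy, hz]
  | tmul a h =>
    rw [tensorInclHom, AlgHom.comp_apply, Algebra.TensorProduct.map_tmul, tensorInclRightHom_apply,
      tensorInclRight_tmul, tensorIncl_tmul, AlgHom.id_apply]

theorem tensorIncl_mem (z : A ⊗[k] H) : Ω.tensorIncl Ω' z ∈ Ω.tensorGrade Ω' 0 := by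
  induction z with
  | zero => simp
  | add y z hy hz => rw [map_add]; exact add_mem hy hz
  | tmul a h =>
    have := tmul_mem_tensorGrade (Ω.incl_mem a) (Ω'.incl_mem h)
    rwa [add_zero, ← tensorIncl_tmul] at this

/-- The projection onto `Ω^i ⊗ Ω'^j`. -/
noncomputable def biproj (i j : ℕ) : Ω.Tensor Ω' →ₗ[k] Ω.Tensor Ω' :=
  (GradedTensorProduct.of k Ω.grade Ω'.grade).toLinearMap ∘ₗ
    TensorProduct.map (GradedAlgebra.proj Ω.grade i) (GradedAlgebra.proj Ω'.grade j) ∘ₗ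
    (GradedTensorProduct.of k Ω.grade Ω'.grade).symm.toLinearMap

theorem biproj_tmul (i j : ℕ) (ω : Ω.Form) (η : Ω'.Form) : Ω.biproj Ω' i j (ω ᵍ⊗ₜ[k] η) =
    (GradedAlgebra.proj Ω.grade i ω) ᵍ⊗ₜ[k] (GradedAlgebra.proj Ω'.grade j η) := rfl

/-- The submodule `Ω^i ⊗ Ω'^j`. -/
noncomputable def bigrade (i j : ℕ) : Submodule k (Ω.Tensor Ω') :=
  Submodule.span k {x | ∃ (ω : Ω.Form) (η : Ω'.Form), ω ∈ Ω.grade i ∧ η ∈ Ω'.grade j ∧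
    x = ω ᵍ⊗ₜ[k] η}

variable {Ω Ω'}

theorem component_apply (Φ : Ω.Form →ₐ[k] Ω.Tensor Ω') (i j : ℕ) (ω : Ω.Form) :
    component Φ i j ω = Ω.biproj Ω' i j (Φ ω) := rfl

theorem biproj_of_mem {i j : ℕ} {x : Ω.Tensor Ω'} (hx : x ∈ Ω.bigrade Ω' i j) :
    Ω.biproj Ω' i j x = x := by
  induction hx using Submodule.span_induction with
  | zero => simp
  | add x y _ _ hx hy => rw [map_add, hx, hy]
  | smul r x _ hx => rw [map_smul, hx]
  | mem x hx =>
    obtain ⟨ω, η, hω, hη, rfl⟩ := hx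
    rw [biproj_tmul, Ω.proj_of_mem hω, Ω'.proj_of_mem hη]

theorem biproj_of_mem_ne {i j i' j' : ℕ} {x : Ω.Tensor Ω'} (hx : x ∈ Ω.bigrade Ω' i j)
    (h : i ≠ i' ∨ j ≠ j') : Ω.biproj Ω' i' j' x = 0 := by
  induction hx using Submodule.span_induction with
  | zero => simp
  | add x y _ _ hx hy => rw [map_add, hx, hy, add_zero]
  | smul r x _ hx => rw [map_smul, hx, smul_zero]
  | mem x hx =>
    obtain ⟨ω, η, hω, hη, rfl⟩ := hx
    rw [biproj_tmul]
    rcases h with h | h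
    · rw [Ω.proj_of_mem_ne hω h]; simp
    · rw [Ω'.proj_of_mem_ne hη h]; simp

theorem tmul_mem_bigrade {i j : ℕ} {ω : Ω.Form} {η : Ω'.Form} (hω : ω ∈ Ω.grade i)
    (hη : η ∈ Ω'.grade j) : ω ᵍ⊗ₜ[k] η ∈ Ω.bigrade Ω' i j :=
  Submodule.subset_span ⟨ω, η, hω, hη, rfl⟩

theorem tensorIncl_mul_mem_bigrade {i j : ℕ} (z : A ⊗[k] H) {x : Ω.Tensor Ω'}
    (hx : x ∈ Ω.bigrade Ω' i j) : Ω.tensorIncl Ω' z * x ∈ Ω.bigrade Ω' i j := by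
  induction hx using Submodule.span_induction with
  | zero => simp
  | add x y _ _ hx hy => rw [mul_add]; exact add_mem hx hy
  | smul r x _ hx => rw [mul_smul_comm]; exact Submodule.smul_mem _ r hx
  | mem x hx =>
    obtain ⟨ω, η, hω, hη, rfl⟩ := hx
    induction z with
    | zero => simp
    | add y z hy hz => rw [map_add, add_mul]; exact add_mem hy hz
    | tmul a h =>
      rw [tensorIncl_tmul, tmul_mul_tmul_of_left (Ω'.incl_mem h)]
      have h1 := SetLike.mul_mem_graded (Ω.incl_mem a) hω
      have h2 := SetLike.mul_mem_graded (Ω'.incl_mem h) hη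
      rw [zero_add] at h1 h2
      exact tmul_mem_bigrade h1 h2

theorem sum_biproj {n : ℕ} {x : Ω.Tensor Ω'} (hx : x ∈ Ω.tensorGrade Ω' n) :
    x = ∑ p ∈ Finset.HasAntidiagonal.antidiagonal n, Ω.biproj Ω' p.1 p.2 x := by
  induction hx using Submodule.span_induction with
  | zero => simp
  | add x y _ _ hx hy => simp only [map_add, Finset.sum_add_distrib, ← hx, ← hy]
  | smul r x _ hx => simp only [map_smul, ← Finset.smul_sum, ← hx]
  | mem x hx =>
    obtain ⟨i, j, ω, η, rfl, hω, hη, rfl⟩ := hx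
    have hm := tmul_mem_bigrade (Ω := Ω) (Ω' := Ω') hω hη
    rw [Finset.sum_eq_single (i, j), biproj_of_mem hm]
    · rintro ⟨i', j'⟩ _ hne
      apply biproj_of_mem_ne hm
      by_contra! h
      exact hne (by rw [h.1, h.2])
    · simp

variable (Ω Ω') in
/-- The projection `Ω ⊗ Ω' → Ω ⊗ Ω'^0`, as an algebra map. -/
noncomputable def projRightZero : Ω.Tensor Ω' →ₐ[k] Ω.Tensor Ω' :=
  AlgHom.ofLinearMap ((GradedTensorProduct.of k Ω.grade Ω'.grade).toLinearMap ∘ₗ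
      TensorProduct.map LinearMap.id (GradedAlgebra.proj Ω'.grade 0) ∘ₗ
      (GradedTensorProduct.of k Ω.grade Ω'.grade).symm.toLinearMap)
    (by
      have h : GradedAlgebra.proj Ω'.grade 0 1 = 1 :=
        Ω'.proj_of_mem SetLike.GradedOne.one_mem
      have h' : (1 : Ω.Tensor Ω') = 1 ᵍ⊗ₜ[k] 1 := rfl
      rw [h']
      simp [h])
    (by
      intro x y
      induction x using tensor_induction with
      | add x x' hx hx' => simp only [add_mul, map_add, hx, hx']
      | tmul i j ω η hω hη =>
        induction y using tensor_induction with
        | add y y' hy hy' => simp only [mul_add, map_add, hy, hy']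
        | tmul i' j' ω' η' hω' hη' =>
          rw [tmul_mul_tmul _ _ hη hω', map_smul]
          simp only [LinearMap.comp_apply, LinearEquiv.coe_coe, GradedTensorProduct.of_symm_of,
            TensorProduct.map_tmul, LinearMap.id_apply]
          have hm := SetLike.mul_mem_graded hη hη'
          -- Degrees are natural numbers, so a product has degree 0 in the second leg only if both
          -- factors do. This is why the projection is multiplicative.
          rcases Nat.eq_zero_or_pos j with rfl | hj
          · rcases Nat.eq_zero_or_pos j' with rfl | hj'
            · rw [Ω'.proj_of_mem hη, Ω'.proj_of_mem hη', Ω'.proj_of_mem hm,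
                tmul_mul_tmul _ _ hη hω']
            · rw [Ω'.proj_of_mem_ne hη' hj'.ne', Ω'.proj_of_mem_ne hm (by omega)]
              simp
          · rw [Ω'.proj_of_mem_ne hη hj.ne', Ω'.proj_of_mem_ne hm (by omega)]
            simp)

theorem projRightZero_tmul (ω : Ω.Form) (η : Ω'.Form) : Ω.projRightZero Ω' (ω ᵍ⊗ₜ[k] η) =
    ω ᵍ⊗ₜ[k] (GradedAlgebra.proj Ω'.grade 0 η) := rfl

end GradedTensor

end DifferentialCalculus

/-! ### Extending a coaction to the graded tensor product. -/

namespace FirstOrderCalculus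

open DifferentialCalculus

section CoactionLift

variable {k A Γ H : Type u} [Field k] [Ring A] [Algebra k A]
    [AddCommGroup Γ] [Module k Γ] [Module A Γ] [Module Aᵐᵒᵖ Γ] [SMulCommClass A Aᵐᵒᵖ Γ]
    [IsScalarTower k A Γ] [IsScalarTower k Aᵐᵒᵖ Γ] (F : FirstOrderCalculus k A Γ)

theorem tensorD_tensorIncl_mul [Ring H] [Algebra k H] (Ω : DifferentialCalculus k A)
    (Ω' : DifferentialCalculus k H) (z : A ⊗[k] H) (x : Ω.Tensor Ω') :
    Ω.tensorD Ω' (Ω.tensorInclHom Ω' z * x) =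
      Ω.tensorD Ω' (Ω.tensorInclHom Ω' z) * x + Ω.tensorInclHom Ω' z * Ω.tensorD Ω' x := by
  rw [tensorInclHom_apply, tensorD_mul (Ω.tensorIncl_mem Ω' z), pow_zero, one_smul]

/-- The universal property with the total differential of `Ω(A) ⊗ Ω(H)` as `D`. Both of its Leibniz
hypotheses are cases of `tensorD_mul`, in total degrees 0 and 1. -/
theorem exists_isCoactionLift [Ring H] [Algebra k H] (Δ : A →ₐ[k] A ⊗[k] H)
    (Ω' : DifferentialCalculus k H) (g : Γ →+ F.maximalProlongation.Tensor Ω')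
    (hl : ∀ a ω, g (a • ω) = F.maximalProlongation.tensorInclHom Ω' (Δ a) * g ω)
    (hd : ∀ a, g (F.d a) = F.maximalProlongation.tensorD Ω'
      (F.maximalProlongation.tensorInclHom Ω' (Δ a))) :
    ∃ Φ, IsCoactionLift Δ F.maximalProlongation Ω' Φ := by
  obtain ⟨Φ, h0, h1⟩ := F.exists_lift ((F.maximalProlongation.tensorInclHom Ω').comp Δ)
    (F.maximalProlongation.tensorD Ω') g hl hd
    (fun a x => tensorD_tensorIncl_mul _ _ _ x)
    (fun a x => by
      rw [AlgHom.comp_apply, tensorInclHom_apply, tensorD_mul (tensorD_mem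
        (F.maximalProlongation.tensorIncl_mem Ω' _)), tensorD_tensorD]
      simp)
  simp only [AlgHom.comp_apply, tensorInclHom_apply] at h0
  refine ⟨Φ, F.map_mem_of_deg Φ _ ?_ ?_, h1, h0⟩
  · intro a
    rw [h0]
    exact tensorIncl_mem _ _ _
  · intro a
    rw [← dWedge_fn, h1, h0]
    exact tensorD_mem (tensorIncl_mem _ _ _)

end CoactionLift

end FirstOrderCalculus

/-! ### Uniqueness of the lift, and its components in `Ω(A) ⊗ H`. -/

namespace DifferentialCalculus

variable {k A H : Type u} [Field k] [Ring A] [Algebra k A] {Ω : DifferentialCalculus k A}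

theorem hom_ext_d {B : Type*} [Semiring B] [Algebra k B] {φ ψ : Ω.Form →ₐ[k] B}
    (h0 : ∀ a, φ (Ω.incl a) = ψ (Ω.incl a))
    (h1 : ∀ a, φ (Ω.d (Ω.incl a)) = ψ (Ω.d (Ω.incl a))) : φ = ψ := by
  ext x
  induction x using Ω.form_induction with
  | add x y hx hy => rw [map_add, map_add, hx, hy]
  | hom n x hx =>
    rw [Ω.generated] at hx
    induction hx using Submodule.span_induction with
    | zero => simp
    | add x y _ _ hx hy => rw [map_add, map_add, hx, hy]
    | smul r x _ hx => rw [map_smul, map_smul, hx]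
    | mem x hx =>
      obtain ⟨a, b, rfl⟩ := hx
      simp [map_list_prod, List.map_ofFn, Function.comp_def, h0, h1]

theorem isCoactionLift_unique [Ring H] [Algebra k H] {Δ : A →ₐ[k] A ⊗[k] H}
    {Ω' : DifferentialCalculus k H}
    {Φ Φ' : Ω.Form →ₐ[k] Ω.Tensor Ω'}
    (h : IsCoactionLift Δ Ω Ω' Φ)
    (h' : IsCoactionLift Δ Ω Ω' Φ') : Φ = Φ' := by
  have h0 (a : A) : Φ (Ω.incl a) = Φ' (Ω.incl a) := by
    rw [h.map_incl, h'.map_incl]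
  refine hom_ext_d h0 fun a => ?_
  exact (h.map_d _).trans ((congrArg _ (h0 a)).trans (h'.map_d _).symm)

/-- Projecting the second leg to degree 0 is an algebra map and kills the part of the total
differential that acts on that leg, leaving `d ⊗ id`. The projected `Φ` and the included `Ψ` are
thus algebra maps that agree on functions and exact 1-forms. -/
theorem component_zero_right [Ring H] [HopfAlgebra k H] {Δ : A →ₐ[k] A ⊗[k] H}
    {Ω' : DifferentialCalculus k H}
    {Φ : Ω.Form →ₐ[k] Ω.Tensor Ω'}
    (hΦ : IsCoactionLift Δ Ω Ω' Φ)
    {Ψ : Ω.Form →ₐ[k] Ω.Form ⊗[k] H}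
    (hΨ : IsRightCovariantCoaction Δ Ω Ψ) (n : ℕ)
    (ω : Ω.Form) (hω : ω ∈ Ω.grade n) :
    component Φ n 0 ω = Ω.tensorInclRight Ω' (Ψ ω) := by
  have key : (Ω.projRightZero Ω').comp Φ = (Ω.tensorInclRightHom Ω').comp Ψ := by
    apply hom_ext_d
    · intro a
      have e1 : Φ (Ω.incl a) = Ω.tensorIncl Ω' (Δ a) := hΦ.map_incl a
      have e2 : Ψ (Ω.incl a) = Ω.incl.toLinearMap.rTensor H (Δ a) := hΨ.map_incl a
      rw [AlgHom.comp_apply, AlgHom.comp_apply, e1, e2]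
      generalize Δ a = z
      induction z with
      | zero => simp
      | add y z hy hz => simp only [map_add, hy, hz]
      | tmul a h =>
        rw [tensorIncl_tmul, projRightZero_tmul, Ω'.proj_of_mem (Ω'.incl_mem h),
          LinearMap.rTensor_tmul, tensorInclRightHom_apply, tensorInclRight_tmul,
          AlgHom.toLinearMap_apply]
    · intro a
      have e1 : Φ (Ω.d (Ω.incl a)) = Ω.tensorD Ω' (Ω.tensorIncl Ω' (Δ a)) := by
        exact (hΦ.map_d _).trans (congrArg _ (hΦ.map_incl a))
      have e2 : Ψ (Ω.d (Ω.incl a)) = Ω.d.rTensor H (Ω.incl.toLinearMap.rTensor H (Δ a)) := by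
        exact (hΨ.map_d _).trans (congrArg _ (hΨ.map_incl a))
      rw [AlgHom.comp_apply, AlgHom.comp_apply, e1, e2]
      generalize Δ a = z
      induction z with
      | zero => simp
      | add y z hy hz => simp only [map_add, hy, hz]
      | tmul a h =>
        rw [tensorIncl_tmul, tensorD_tmul (Ω.incl_mem a), map_add, map_smul, projRightZero_tmul,
          projRightZero_tmul, Ω'.proj_of_mem (Ω'.incl_mem h),
          Ω'.proj_of_mem_ne (Ω'.d_incl_mem h) one_ne_zero,
          LinearMap.rTensor_tmul, LinearMap.rTensor_tmul, tensorInclRightHom_apply,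
          tensorInclRight_tmul, AlgHom.toLinearMap_apply]
        simp [GradedTensorProduct.tmul]
  -- The projection to bidegree `(n, 0)` sees only the part of degree 0 in the second leg.
  have h1 (x : Ω.Tensor Ω') :
      Ω.biproj Ω' n 0 x = Ω.biproj Ω' n 0 (Ω.projRightZero Ω' x) := by
    induction x using tensor_induction with
    | add x y hx hy => simp only [map_add, hx, hy]
    | tmul i j ω η hω hη =>
      rw [projRightZero_tmul, biproj_tmul, biproj_tmul]
      by_cases hj : j = 0
      · subst hj
        rw [Ω'.proj_of_mem hη, Ω'.proj_of_mem hη]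
      · rw [Ω'.proj_of_mem_ne hη hj, map_zero]
  have h2 : Ω.projRightZero Ω' (Φ ω) = Ω.tensorInclRight Ω' (Ψ ω) := DFunLike.congr_fun key ω
  rw [component_apply, h1, h2]
  -- As `Ψ` preserves the form degree, its value already lies in bidegree `(n, 0)`.
  apply biproj_of_mem
  obtain ⟨z, hz⟩ := hΨ.map_grade n ω hω
  rw [← hz]
  clear hz
  induction z with
  | zero => simp
  | add y z hy hz => simp only [map_add]; exact add_mem hy hz
  | tmul ω h => exact tmul_mem_bigrade ω.2 (Ω'.incl_mem h)

end DifferentialCalculus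

/-! ### Maps out of twisted free bimodules: reduction to generators. -/

namespace TwistedFree

variable {k A B : Type u} [Field k] [Ring A] [Algebra k A] [Ring B] [Algebra k B] {n : ℕ}
  {σ : Fin n → A →ₐ[k] A} {δ : Fin n → A →ₗ[k] A}

/-- Compatibility at `a` of a derivation `D` along `f : A → B` with `e_i ↦ X_i`. -/
structure Compat (σ : Fin n → A →ₐ[k] A) (δ : Fin n → A →ₗ[k] A) (f : A →ₐ[k] B) (D : B →ₗ[k] B)
    (X : Fin n → B) (a : A) : Prop where
  comm : ∀ i, X i * f a = f (σ i a) * X i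
  map_d : D (f a) = ∑ i, f (δ i a) * X i

section

variable {f : A →ₐ[k] B} {D : B →ₗ[k] B} {X : Fin n → B}

theorem map_one_eq_zero (hδ : ∀ i a b, δ i (a * b) = δ i a * σ i b + a * δ i b)
    (i : Fin n) : δ i 1 = 0 := by
  have := hδ i 1 1
  simpa using this

theorem Compat.add {a b : A} (ha : Compat σ δ f D X a) (hb : Compat σ δ f D X b) :
    Compat σ δ f D X (a + b) where
  comm i := by simp only [map_add, mul_add, add_mul, ha.comm, hb.comm]
  map_d := by simp only [map_add, add_mul, Finset.sum_add_distrib, ha.map_d, hb.map_d]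

theorem Compat.algebraMap (hδ : ∀ i a b, δ i (a * b) = δ i a * σ i b + a * δ i b)
    (hD : ∀ a b, D (f a * f b) = D (f a) * f b + f a * D (f b))
    (r : k) : Compat σ δ f D X (algebraMap k A r) where
  comm i := by simp [Algebra.commutes]
  map_d := by
    have := hD 1 1
    simp only [map_one, mul_one, one_mul, left_eq_add] at this
    simp [Algebra.algebraMap_eq_smul_one, map_one_eq_zero hδ, this]

/-- The commutation rule carries `Xᵢ` past `f b`, which turns the Leibniz rule for `D` into the
twisted one for `∂ᵢ`. This is why the two conditions of `Compat` have to travel together. -/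
theorem Compat.mul (hδ : ∀ i a b, δ i (a * b) = δ i a * σ i b + a * δ i b)
    (hD : ∀ a b, D (f a * f b) = D (f a) * f b + f a * D (f b))
    {a b : A} (ha : Compat σ δ f D X a) (hb : Compat σ δ f D X b) :
    Compat σ δ f D X (a * b) where
  comm i := by
    rw [map_mul, ← mul_assoc, ha.comm, mul_assoc, hb.comm, map_mul, map_mul, mul_assoc]
  map_d := by
    simp only [map_mul, hD, hδ, map_add, add_mul, Finset.sum_add_distrib, mul_assoc, ← hb.comm]
    rw [ha.map_d, hb.map_d, Finset.sum_mul, Finset.mul_sum]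
    simp only [mul_assoc]

/-- Commutation with the inverse comes from multiplying by inverses on both sides. For the
differential, `D (f b)` and `∑ f(∂ᵢ b) Xᵢ` solve the same equation `D (f a) f b + f a y = 0`, and `f
a` is invertible. So inverse generators need no verification of their own. -/
theorem Compat.of_mul_eq_one (hδ : ∀ i a b, δ i (a * b) = δ i a * σ i b + a * δ i b)
    (hD : ∀ a b, D (f a * f b) = D (f a) * f b + f a * D (f b))
    {a b : A} (ha : Compat σ δ f D X a) (hab : a * b = 1)
    (hba : b * a = 1) : Compat σ δ f D X b := by
  have hfab : f a * f b = 1 := by rw [← map_mul, hab, map_one]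
  have hfba : f b * f a = 1 := by rw [← map_mul, hba, map_one]
  have hσ (i : Fin n) : f (σ i b) * f (σ i a) = 1 := by
    rw [← map_mul, ← map_mul, hba, map_one, map_one]
  have comm (i : Fin n) : X i * f b = f (σ i b) * X i := by
    calc X i * f b = f (σ i b) * f (σ i a) * (X i * f b) := by rw [hσ, one_mul]
      _ = f (σ i b) * (f (σ i a) * X i) * f b := by noncomm_ring
      _ = f (σ i b) * X i := by rw [← ha.comm, mul_assoc, mul_assoc, hfab, mul_one]
  refine ⟨comm, ?_⟩
  have hD1 : D 1 = 0 := by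
    have := hD 1 1
    simpa using this
  have h1 : D (f a) * f b + f a * D (f b) = 0 := by rw [← hD, hfab, hD1]
  have h2 : D (f a) * f b + f a * ∑ i, f (δ i b) * X i = 0 := by
    rw [ha.map_d, Finset.sum_mul, Finset.mul_sum, ← Finset.sum_add_distrib]
    apply Finset.sum_eq_zero
    intro i _
    rw [mul_assoc, comm, ← mul_assoc, ← mul_assoc, ← add_mul, ← map_mul, ← map_mul, ← map_add,
      ← hδ, hab, map_one_eq_zero hδ, map_zero, zero_mul]
  have h3 : f a * D (f b) = f a * ∑ i, f (δ i b) * X i := by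
    rw [← sub_eq_zero, ← add_sub_add_left_eq_sub _ _ (D (f a) * f b), h1, h2, sub_zero]
  calc D (f b) = f b * (f a * D (f b)) := by rw [← mul_assoc, hfba, one_mul]
    _ = _ := by rw [h3, ← mul_assoc, hfba, one_mul]

/-- The map is `ω ↦ ∑ f(ωᵢ) Xᵢ`. It supplies the input `g` of `exists_lift`. -/
theorem exists_form_map (hδ : ∀ i a b, δ i (a * b) = δ i a * σ i b + a * δ i b)
    (x : Fin n → A) (hx : ∀ i j, δ i (x j) = if i = j then 1 else 0)
    (h : ∀ a, Compat σ δ f D X a) : ∃ g : TwistedFree σ →+ B,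
      (∀ a ω, g (a • ω) = f a * g ω) ∧ ∀ a, g ((calculus σ δ hδ x hx).d a) = D (f a) := by
  refine ⟨{ toFun := fun ω => ∑ i, f (ω i) * X i, map_zero' := ?_, map_add' := ?_ }, ?_, ?_⟩
  · exact Finset.sum_eq_zero fun i _ => (congrArg (f · * X i) rfl).trans (by
      change f 0 * X i = 0
      simp)
  · intro ω η
    rw [← Finset.sum_add_distrib]
    refine Finset.sum_congr rfl fun i _ => ?_
    change f (ω i + η i) * X i = _
    rw [map_add, add_mul]
  · intro a ω
    change ∑ i, f (a * ω i) * X i = f a * ∑ i, f (ω i) * X i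
    simp only [map_mul, Finset.mul_sum, mul_assoc]
  · intro a
    exact (h a).map_d.symm

/-- With the choice `Xᵢ = D (f xᵢ)` the formula for `D` at a generator is automatic from `∂ᵢ xⱼ =
δᵢⱼ`, and only the commutation relations are left. -/
theorem Compat.of_gen (x : Fin n → A) (hx : ∀ i j, δ i (x j) = if i = j then 1 else 0)
    (j : Fin n) (h : ∀ i, D (f (x i)) * f (x j) = f (σ i (x j)) * D (f (x i))) :
    Compat σ δ f D (fun i => D (f (x i))) (x j) where
  comm := h
  map_d := by simp [hx, apply_ite f, ite_mul]

end

section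

variable (σ) (δ) (hδ : ∀ i a b, δ i (a * b) = δ i a * σ i b + a * δ i b) (x : Fin n → A)
  (hx : ∀ i j, δ i (x j) = if i = j then 1 else 0)

theorem d_gen_apply (i j : Fin n) :
    (calculus σ δ hδ x hx).d (x j) i = if i = j then 1 else 0 := hx i j

theorem op_smul_d_gen (i : Fin n) (a : A) :
    MulOpposite.op a • (calculus σ δ hδ x hx).d (x i) =
      σ i a • (calculus σ δ hδ x hx).d (x i) := by
  funext j
  rw [op_smul_apply, smul_apply, d_gen_apply]
  by_cases h : j = i
  · simp [h]
  · simp [h]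

theorem sum_smul_d_gen (c : Fin n → A) :
    ∑ i, c i • (calculus σ δ hδ x hx).d (x i) = (c : TwistedFree σ) := by
  funext j
  have : (∑ i, c i • (calculus σ δ hδ x hx).d (x i)) j =
      ∑ i, c i * (calculus σ δ hδ x hx).d (x i) j := Finset.sum_apply (M := fun _ => A) j _ _
  rw [this]
  simp [d_gen_apply]

open DifferentialCalculus

theorem exists_isRightCovariantCoaction {H : Type u} [Ring H] [HopfAlgebra k H]
    {Δ : A →ₐ[k] A ⊗[k] H} (hΔ : IsRightCoaction Δ)
    (X : Fin n → (calculus σ δ hδ x hx).Wedge ⊗[k] H)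
    (h : ∀ a, Compat σ δ
      ((Algebra.TensorProduct.map (calculus σ δ hδ x hx).fn (AlgHom.id k H)).comp Δ)
      ((calculus σ δ hδ x hx).dWedge.rTensor H) X a) :
    IsRightCovariant Δ (calculus σ δ hδ x hx).maximalProlongation := by
  obtain ⟨g, hl, hd⟩ := exists_form_map hδ x hx h
  exact (calculus σ δ hδ x hx).exists_isRightCovariantCoaction hΔ g hl hd

theorem isComplete {H : Type u} [Ring H] [Algebra k H] {Δ : A →ₐ[k] A ⊗[k] H}
    (Ω' : DifferentialCalculus k H)
    (X : Fin n → (calculus σ δ hδ x hx).maximalProlongation.Tensor Ω')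
    (h : ∀ a, Compat σ δ
      (((calculus σ δ hδ x hx).maximalProlongation.tensorInclHom Ω').comp Δ)
      ((calculus σ δ hδ x hx).maximalProlongation.tensorD Ω') X a) :
    IsComplete Δ (calculus σ δ hδ x hx).maximalProlongation Ω' := by
  obtain ⟨g, hl, hd⟩ := exists_form_map hδ x hx h
  exact (calculus σ δ hδ x hx).exists_isCoactionLift Δ Ω' g hl hd

end

end TwistedFree

/-! ### Relations between 2-forms from relations between 1-forms. -/

namespace FirstOrderCalculus

variable {k A Γ : Type u} [Field k] [Ring A] [Algebra k A]
    [AddCommGroup Γ] [Module k Γ] [Module A Γ] [Module Aᵐᵒᵖ Γ] [SMulCommClass A Aᵐᵒᵖ Γ]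
    [IsScalarTower k A Γ] [IsScalarTower k Aᵐᵒᵖ Γ] (F : FirstOrderCalculus k A Γ)

theorem form_d_mul_fn {a b x y : A} (h : MulOpposite.op a • F.d x = b • F.d y) :
    F.form (F.d x) * F.fn a = F.fn b * F.form (F.d y) := by
  rw [← form_right, h, form_left]

/-- Differentiate the relation `dx a = b dy`: the left side gives `-dx ∧ da`, the right side `db ∧
dy`. -/
theorem form_d_mul_form_d {a b x y : A} (h : MulOpposite.op a • F.d x = b • F.d y) :
    F.form (F.d x) * F.form (F.d a) = -(F.form (F.d b) * F.form (F.d y)) := by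
  have := congrArg F.dForm h
  rw [dForm_right, dForm_left, dForm_d, dForm_d, zero_mul, mul_zero, zero_sub, add_zero] at this
  rw [← this, neg_neg]

end FirstOrderCalculus

/-! ### Commutation relations in the graded tensor product, and the coproduct as a coaction. -/

namespace DifferentialCalculus

/-- The differential of `x ⊗ g` is `dx ⊗ g + x ⊗ dg`. Moving `y ⊗ h` past the first term costs `r`,
past the second `s s'`. The relation holds for the sum because `s s' = r`. -/
theorem tensorD_mul_tensorIncl {k A H : Type u} [Field k] [Ring A] [Algebra k A] [Ring H]
    [Algebra k H] {Ω : DifferentialCalculus k A} {Ω' : DifferentialCalculus k H} {x y : A} {g h : H}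
    {r s s' : k} (hxy : x * y = s • (y * x)) (hgh : g * h = h * g)
    (hdx : Ω.d (Ω.incl x) * Ω.incl y = r • (Ω.incl y * Ω.d (Ω.incl x)))
    (hdg : Ω'.d (Ω'.incl g) * Ω'.incl h = s' • (Ω'.incl h * Ω'.d (Ω'.incl g)))
    (hr : s * s' = r) :
    Ω.tensorD Ω' (Ω.tensorIncl Ω' (x ⊗ₜ g)) * Ω.tensorIncl Ω' (y ⊗ₜ h) =
      r • (Ω.tensorIncl Ω' (y ⊗ₜ h) * Ω.tensorD Ω' (Ω.tensorIncl Ω' (x ⊗ₜ g))) := by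
  rw [tensorIncl_tmul, tensorIncl_tmul, tensorD_tmul (Ω.incl_mem x), add_mul, mul_add,
    pow_zero, one_smul, tmul_mul_tmul_of_right (Ω.incl_mem y),
    tmul_mul_tmul_of_right (Ω.incl_mem y), tmul_mul_tmul_of_left (Ω'.incl_mem h),
    tmul_mul_tmul_of_left (Ω'.incl_mem h), hdx, hdg, ← map_mul, ← map_mul, ← map_mul, ← map_mul,
    hxy, hgh, map_smul]
  simp only [GradedTensorProduct.tmul, TensorProduct.tmul_smul, ← TensorProduct.smul_tmul',
    map_smul, smul_add, smul_smul, ← hr, mul_comm s]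

variable {k H : Type u} [Field k] [Ring H] [HopfAlgebra k H]

theorem isRightCoaction_comul : IsRightCoaction (Bialgebra.comulAlgHom k H) where
  coassoc a := Coalgebra.coassoc_apply a
  counit a := Coalgebra.lTensor_counit_comul a

theorem comm_comp_comul [Coalgebra.IsCocomm k H] :
    (Algebra.TensorProduct.comm k H H).toAlgHom.comp (Bialgebra.comulAlgHom k H) =
      Bialgebra.comulAlgHom k H :=
  AlgHom.ext fun a => Coalgebra.comm_comul k a

end DifferentialCalculus

/-! ### The calculus on `O(U(1))` for general `p`. -/

namespace Circle1

open DifferentialCalculus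

variable (p : ℂˣ)

theorem twist_t : twist p t = ((p⁻¹ : ℂˣ) : ℂ) • t := lift_t _

theorem twist_tInv : twist p tInv = (p : ℂ) • tInv :=
  (lift_tInv _).trans (by simp [scaleUnit])

theorem comul_t : Bialgebra.comulAlgHom ℂ Circle1 t = t ⊗ₜ t := LaurentPolynomial.comul_T 1

theorem upperRight_t (i j : Fin 1) :
    upperRight (lift (matrixUnit p)) t = if i = j then 1 else 0 := by
  rw [upperRight_apply, lift_t]
  simp [matrixUnit, Subsingleton.elim i j]

theorem op_smul_d_t (a : Circle1) : MulOpposite.op a • (firstOrder p).d t =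
    twist p a • (firstOrder p).d t :=
  TwistedFree.op_smul_d_gen _ _ _ (fun _ => t) _ 0 a

theorem form_d_t_mul_fn (a : Circle1) : (firstOrder p).form ((firstOrder p).d t) *
    (firstOrder p).fn a = (firstOrder p).fn (twist p a) *
      (firstOrder p).form ((firstOrder p).d t) :=
  (firstOrder p).form_d_mul_fn (op_smul_d_t p a)

theorem form_d_t_mul_self : (firstOrder p).form ((firstOrder p).d t) *
    (firstOrder p).form ((firstOrder p).d t) =
    -((p : ℂ) • ((firstOrder p).form ((firstOrder p).d t) *
      (firstOrder p).form ((firstOrder p).d t))) := by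
  have h := (firstOrder p).form_d_mul_form_d (op_smul_d_t p t)
  rw [twist_t, map_smul, map_smul, smul_mul_assoc] at h
  generalize (firstOrder p).form ((firstOrder p).d t) *
    (firstOrder p).form ((firstOrder p).d t) = x at h
  -- The bimodule is built with `dt t = p⁻¹ t dt`, so differentiating gives the relation with `p⁻¹`;
  -- multiplying by `p` brings it to the stated form.
  have h' := congrArg ((p : ℂ) • ·) h
  simp only [smul_neg, smul_smul, Units.mul_inv, one_smul] at h'
  rw [h', neg_neg]

theorem form_d_t_mul_self_eq_zero (hp : (p : ℂ) ≠ -1) :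
    (firstOrder p).form ((firstOrder p).d t) *
    (firstOrder p).form ((firstOrder p).d t) = 0 := by
  have h := form_d_t_mul_self p
  rw [eq_neg_iff_add_eq_zero] at h
  have h' : (1 + (p : ℂ)) • ((firstOrder p).form ((firstOrder p).d t) *
    (firstOrder p).form ((firstOrder p).d t)) = 0 := by rw [add_smul, one_smul, h]
  refine (smul_eq_zero.1 h').resolve_left fun h1 => hp ?_
  linear_combination h1

theorem d_t_mul_incl (a : Circle1) :
    (calculus p).d ((calculus p).incl t) * (calculus p).incl a =
      (calculus p).incl (twist p a) * (calculus p).d ((calculus p).incl t) := by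
  have := form_d_t_mul_fn p a
  rwa [← FirstOrderCalculus.dWedge_fn] at this

theorem d_t_mul_t : (calculus p).d ((calculus p).incl t) * (calculus p).incl t =
    ((p⁻¹ : ℂˣ) : ℂ) • ((calculus p).incl t * (calculus p).d ((calculus p).incl t)) := by
  rw [d_t_mul_incl, twist_t, map_smul, smul_mul_assoc]

theorem d_t_mul_tInv : (calculus p).d ((calculus p).incl t) * (calculus p).incl tInv =
    (p : ℂ) • ((calculus p).incl tInv * (calculus p).d ((calculus p).incl t)) := by
  rw [d_t_mul_incl, twist_tInv, map_smul, smul_mul_assoc]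

theorem exists_eq_smul_d_t (ω : TwistedFree (fun _ : Fin 1 => twist p)) :
    ω = ω 0 • (firstOrder p).d t := by
  refine (TwistedFree.sum_smul_d_gen _ _ (fun _ => upperRight_mul (isUpper p)) _
    (upperRight_t p) ω).symm.trans ?_
  rw [Fin.sum_univ_one]
  rfl

/-- One commutation relation, at `t`, controls the whole algebra; `t⁻¹` is covered by
`Compat.of_mul_eq_one`. -/
theorem compat {B : Type} [Ring B] [Algebra ℂ B] {f : Circle1 →ₐ[ℂ] B} {D : B →ₗ[ℂ] B}
    (hD : ∀ a b, D (f a * f b) = D (f a) * f b + f a * D (f b))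
    (h : D (f t) * f t = f (twist p t) * D (f t)) (a : Circle1) :
    TwistedFree.Compat (fun _ : Fin 1 => twist p) (fun _ => upperRight (lift (matrixUnit p))) f D
      (fun _ => D (f t)) a := by
  have hδ : ∀ i : Fin 1, _ := fun _ => upperRight_mul (isUpper p)
  have ht := TwistedFree.Compat.of_gen (σ := fun _ : Fin 1 => twist p) (f := f) (D := D)
    (fun _ => t) (upperRight_t p) 0 (fun _ => h)
  induction a using Circle1.induction with
  | scalar r => exact .algebraMap hδ hD r
  | ht => exact ht
  | htInv => exact ht.of_mul_eq_one hδ hD t_mul_tInv tInv_mul_t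
  | add a b ha hb => exact ha.add hb
  | mul a b ha hb => exact ha.mul hδ hD hb

theorem isRightCovariant :
    IsRightCovariant (Bialgebra.comulAlgHom ℂ Circle1) (calculus p) := by
  refine TwistedFree.exists_isRightCovariantCoaction _ _ _ _ _ isRightCoaction_comul _
    (compat p (fun a b => (firstOrder p).rTensor_dWedge_mul _ _) ?_)
  change (firstOrder p).dWedge.rTensor Circle1 (Algebra.TensorProduct.map (firstOrder p).fn
      (AlgHom.id ℂ Circle1) (Bialgebra.comulAlgHom ℂ Circle1 t)) *
      Algebra.TensorProduct.map (firstOrder p).fn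
      (AlgHom.id ℂ Circle1) (Bialgebra.comulAlgHom ℂ Circle1 t) =
    Algebra.TensorProduct.map (firstOrder p).fn
      (AlgHom.id ℂ Circle1) (Bialgebra.comulAlgHom ℂ Circle1 (twist p t)) *
    (firstOrder p).dWedge.rTensor Circle1 (Algebra.TensorProduct.map (firstOrder p).fn
      (AlgHom.id ℂ Circle1) (Bialgebra.comulAlgHom ℂ Circle1 t))
  rw [twist_t, map_smul, comul_t, map_smul, Algebra.TensorProduct.map_tmul, LinearMap.rTensor_tmul,
    FirstOrderCalculus.dWedge_fn, smul_mul_assoc, Algebra.TensorProduct.tmul_mul_tmul,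
    Algebra.TensorProduct.tmul_mul_tmul, form_d_t_mul_fn, twist_t, map_smul, smul_mul_assoc,
    TensorProduct.smul_tmul']

theorem isBicovariant : (calculus p).IsBicovariant := by
  refine ⟨?_, isRightCovariant p⟩
  have := (isRightCovariant p).comm
  rwa [comm_comp_comul] at this

/-- Works for every `p`: functions commute, so `s = 1`, and both legs carry the same factor `p⁻¹`.
-/
theorem isComplete :
    IsComplete (Bialgebra.comulAlgHom ℂ Circle1) (calculus p) (calculus p) := by
  refine TwistedFree.isComplete _ _ _ _ _ _ _
    (compat p (fun a b => FirstOrderCalculus.tensorD_tensorIncl_mul _ _ _ _) ?_)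
  rw [AlgHom.comp_apply, AlgHom.comp_apply, twist_t, map_smul, comul_t, map_smul,
    tensorInclHom_apply, smul_mul_assoc]
  have hdt : (calculus p).d ((calculus p).incl t) * (calculus p).incl t =
      ((p⁻¹ : ℂˣ) : ℂ) • ((calculus p).incl t * (calculus p).d ((calculus p).incl t)) :=
    d_t_mul_t p
  exact tensorD_mul_tensorIncl (s := 1) (by simp) rfl hdt hdt (one_mul _)

theorem existsUnique_isCoactionLift :
    ∃! Φ : (calculus p).Form →ₐ[ℂ] (calculus p).Tensor (calculus p),
      IsCoactionLift (Bialgebra.comulAlgHom ℂ Circle1) (calculus p) (calculus p) Φ := by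
  obtain ⟨Φ, hΦ⟩ := isComplete p
  exact ⟨Φ, hΦ, fun Φ' hΦ' => isCoactionLift_unique hΦ' hΦ⟩

theorem existsUnique_eq_mul_dt (ω : (calculus p).Form) (hω : ω ∈ (calculus p).grade 1) :
    ∃! f : Circle1, ω = (calculus p).incl f * (calculus p).d ((calculus p).incl t) := by
  obtain ⟨ω, rfl⟩ := (firstOrder p).mem_deg_one.1 hω
  have h (f : Circle1) : (calculus p).incl f * (calculus p).d ((calculus p).incl t) =
      (firstOrder p).form (f • (firstOrder p).d t) := by
    rw [FirstOrderCalculus.form_left, ← FirstOrderCalculus.dWedge_fn]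
    rfl
  simp only [h]
  refine ⟨ω 0, congrArg _ (exists_eq_smul_d_t p ω), fun f hf => ?_⟩
  rw [(firstOrder p).form_injective hf]
  change f = f * upperRight (lift (matrixUnit p)) t
  rw [upperRight_t p 0 0, if_pos rfl, mul_one]

/-- A product `f dt ∧ g dt` equals `f σ(g) dt ∧ dt`, and `(1 + p) dt ∧ dt = 0`. -/
theorem deg_two_eq_bot (hp : (p : ℂ) ≠ -1) : (firstOrder p).deg 2 = ⊥ := by
  rw [eq_bot_iff, FirstOrderCalculus.deg_succ, Submodule.mul_le]
  rintro _ hω _ ⟨η, rfl⟩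
  obtain ⟨ω, rfl⟩ := (firstOrder p).mem_deg_one.1 hω
  rw [exists_eq_smul_d_t p ω, exists_eq_smul_d_t p η, FirstOrderCalculus.form_left,
    FirstOrderCalculus.form_left, mul_assoc, ← mul_assoc ((firstOrder p).form _) _ _,
    form_d_t_mul_fn, mul_assoc, form_d_t_mul_self_eq_zero p hp]
  simp

end Circle1

/-! ### The torus: relations, top degree, and the twisted partial derivatives. -/

namespace Torus

open DifferentialCalculus

variable (θ : ℝ)

/-- The twisted partial derivatives. -/
noncomputable def partialDeriv : Fin 2 → Torus θ →ₗ[ℂ] Torus θ :=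
  ![upperRight (matrixU θ), upperRight (matrixV θ)]

theorem partial_mul (i : Fin 2) (a b : Torus θ) :
    partialDeriv θ i (a * b) = partialDeriv θ i a * twist θ i b + a * partialDeriv θ i b := by
  fin_cases i
  · exact upperRight_mul (isUpperU θ) a b
  · exact upperRight_mul (isUpperV θ) a b

theorem partial_gen (i j : Fin 2) :
    partialDeriv θ i (![u θ, v θ] j) = if i = j then 1 else 0 := by
  fin_cases i <;> fin_cases j <;>
    simp [partialDeriv, upperRight_apply, matrixU, matrixV, lift_u, lift_v]

theorem twist_zero_u : twist θ 0 (u θ) = u θ := by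
  simp [twist, rotate, lift_u, unitU]

theorem twist_zero_v : twist θ 0 (v θ) = (phase θ : ℂ) • v θ := by
  simp [twist, rotate, lift_v, unitV]

theorem twist_one_u : twist θ 1 (u θ) = (((phase θ)⁻¹ : ℂˣ) : ℂ) • u θ := by
  simp [twist, rotate, lift_u, unitU]

theorem twist_one_v : twist θ 1 (v θ) = v θ := by
  simp [twist, rotate, lift_v, unitV]

theorem v_u : v θ * u θ = (((phase θ)⁻¹ : ℂˣ) : ℂ) • (u θ * v θ) := by
  rw [u_v, smul_smul]; simp

theorem hom_ext {B : Type} [Semiring B] [Algebra ℂ B] {φ ψ : Torus θ →ₐ[ℂ] B}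
    (hu : φ (u θ) = ψ (u θ)) (hv : φ (v θ) = ψ (v θ)) : φ = ψ := by
  have inv {a b : Torus θ} (hab : a * b = 1) (hba : b * a = 1) (h : φ a = ψ a) : φ b = ψ b :=
    left_inv_eq_right_inv (a := φ a) (by rw [← map_mul, hba, map_one])
      (by rw [h, ← map_mul, hab, map_one])
  ext a
  induction a using Torus.induction with
  | scalar r => simp
  | hu => exact hu
  | huInv => exact inv (u_uInv θ) (uInv_u θ) hu
  | hv => exact hv
  | hvInv => exact inv (v_vInv θ) (vInv_v θ) hv
  | add a b ha hb => rw [map_add, map_add, ha, hb]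
  | mul a b ha hb => rw [map_mul, map_mul, ha, hb]

/-- The four hypotheses are the images of the four defining relations of the bimodule. They suffice
for both covariance and completeness. -/
theorem compat {B : Type} [Ring B] [Algebra ℂ B] {f : Torus θ →ₐ[ℂ] B} {D : B →ₗ[ℂ] B}
    (hD : ∀ a b, D (f a * f b) = D (f a) * f b + f a * D (f b))
    (huu : D (f (u θ)) * f (u θ) = f (u θ) * D (f (u θ)))
    (huv : D (f (u θ)) * f (v θ) = (phase θ : ℂ) • (f (v θ) * D (f (u θ))))
    (hvu : D (f (v θ)) * f (u θ) = (((phase θ)⁻¹ : ℂˣ) : ℂ) • (f (u θ) * D (f (v θ))))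
    (hvv : D (f (v θ)) * f (v θ) = f (v θ) * D (f (v θ))) (a : Torus θ) :
    TwistedFree.Compat (twist θ) (partialDeriv θ) f D (fun i => D (f (![u θ, v θ] i))) a := by
  have hu := TwistedFree.Compat.of_gen (σ := twist θ) (f := f) (D := D) _ (partial_gen θ) 0
    (fun i => by
      fin_cases i
      · simpa [twist_zero_u] using huu
      · simpa [twist_one_u] using hvu)
  have hv := TwistedFree.Compat.of_gen (σ := twist θ) (f := f) (D := D) _ (partial_gen θ) 1
    (fun i => by
      fin_cases i
      · simpa [twist_zero_v] using huv
      · simpa [twist_one_v] using hvv)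
  induction a using Torus.induction with
  | scalar r => exact .algebraMap (partial_mul θ) hD r
  | hu => exact hu
  | huInv => exact hu.of_mul_eq_one (partial_mul θ) hD (u_uInv θ) (uInv_u θ)
  | hv => exact hv
  | hvInv => exact hv.of_mul_eq_one (partial_mul θ) hD (v_vInv θ) (vInv_v θ)
  | add a b ha hb => exact ha.add hb
  | mul a b ha hb => exact ha.mul (partial_mul θ) hD hb

/-- The 1-form `du`. -/
noncomputable def du : TwistedFree (twist θ) := (firstOrder θ).d (u θ)

/-- The 1-form `dv`. -/
noncomputable def dv : TwistedFree (twist θ) := (firstOrder θ).d (v θ)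

theorem op_smul_du (a : Torus θ) : MulOpposite.op a • du θ = twist θ 0 a • du θ :=
  TwistedFree.op_smul_d_gen (twist θ) (partialDeriv θ) (partial_mul θ) _ (partial_gen θ) 0 a

theorem op_smul_dv (a : Torus θ) : MulOpposite.op a • dv θ = twist θ 1 a • dv θ :=
  TwistedFree.op_smul_d_gen (twist θ) (partialDeriv θ) (partial_mul θ) _ (partial_gen θ) 1 a

theorem smul_du_add_smul_dv (ω : TwistedFree (twist θ)) : ω 0 • du θ + ω 1 • dv θ = ω := by
  have := TwistedFree.sum_smul_d_gen (twist θ) (partialDeriv θ) (partial_mul θ) _ (partial_gen θ) ω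
  rw [Fin.sum_univ_two] at this
  exact this

theorem smul_du_add_smul_dv_apply (a b : Torus θ) :
    (a • du θ + b • dv θ : TwistedFree (twist θ)) 0 = a ∧
    (a • du θ + b • dv θ : TwistedFree (twist θ)) 1 = b := by
  have := TwistedFree.sum_smul_d_gen (twist θ) (partialDeriv θ) (partial_mul θ) _ (partial_gen θ)
    ![a, b]
  rw [Fin.sum_univ_two] at this
  exact ⟨congrFun this 0, congrFun this 1⟩

theorem form_du_mul_fn (a : Torus θ) : (firstOrder θ).form (du θ) * (firstOrder θ).fn a =
    (firstOrder θ).fn (twist θ 0 a) * (firstOrder θ).form (du θ) :=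
  (firstOrder θ).form_d_mul_fn (op_smul_du θ a)

theorem form_dv_mul_fn (a : Torus θ) : (firstOrder θ).form (dv θ) * (firstOrder θ).fn a =
    (firstOrder θ).fn (twist θ 1 a) * (firstOrder θ).form (dv θ) :=
  (firstOrder θ).form_d_mul_fn (op_smul_dv θ a)

theorem eq_zero_of_eq_neg {x : (firstOrder θ).Wedge} (h : x = -x) : x = 0 := by
  have h' : (2 : ℂ) • x = 0 := by
    rw [two_smul]; nth_rewrite 2 [h]; rw [add_neg_cancel]
  exact (smul_eq_zero.1 h').resolve_left two_ne_zero

theorem form_du_mul_self : (firstOrder θ).form (du θ) * (firstOrder θ).form (du θ) = 0 := by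
  have h := (firstOrder θ).form_d_mul_form_d (op_smul_du θ (u θ))
  rw [twist_zero_u] at h
  exact eq_zero_of_eq_neg θ h

theorem form_dv_mul_self : (firstOrder θ).form (dv θ) * (firstOrder θ).form (dv θ) = 0 := by
  have h := (firstOrder θ).form_d_mul_form_d (op_smul_dv θ (v θ))
  rw [twist_one_v] at h
  exact eq_zero_of_eq_neg θ h

theorem form_du_mul_dv : (firstOrder θ).form (du θ) * (firstOrder θ).form (dv θ) =
    -((phase θ : ℂ) • ((firstOrder θ).form (dv θ) * (firstOrder θ).form (du θ))) := by
  have h := (firstOrder θ).form_d_mul_form_d (op_smul_du θ (v θ))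
  rw [twist_zero_v, map_smul, map_smul, smul_mul_assoc] at h
  exact h

theorem form_dv_mul_du : (firstOrder θ).form (dv θ) * (firstOrder θ).form (du θ) =
    -((((phase θ)⁻¹ : ℂˣ) : ℂ) • ((firstOrder θ).form (du θ) * (firstOrder θ).form (dv θ))) := by
  have h := (firstOrder θ).form_d_mul_form_d (op_smul_dv θ (u θ))
  rw [twist_one_u, map_smul, map_smul, smul_mul_assoc] at h
  exact h

theorem mem_deg_two {x : (firstOrder θ).Wedge} (hx : x ∈ (firstOrder θ).deg 2) :
    ∃ a, x = (firstOrder θ).fn a * ((firstOrder θ).form (du θ) * (firstOrder θ).form (dv θ)) := by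
  rw [FirstOrderCalculus.deg_succ] at hx
  induction hx using Submodule.mul_induction_on' with
  | add x _ y _ hx hy =>
    obtain ⟨a, rfl⟩ := hx
    obtain ⟨b, rfl⟩ := hy
    exact ⟨a + b, by rw [map_add, add_mul]⟩
  | mem_mul_mem x hx y hy =>
    obtain ⟨ω, rfl⟩ := (firstOrder θ).mem_deg_one.1 hx
    obtain ⟨η, rfl⟩ := hy
    -- Of the four products only the mixed ones survive: `du` moves past `η 1` with its twist, `dv`
    -- past `η 0` with its own, and `dv ∧ du = -e^{iθ} du ∧ dv`.
    refine ⟨ω 0 * twist θ 0 (η 1) - (((phase θ)⁻¹ : ℂˣ) : ℂ) • (ω 1 * twist θ 1 (η 0)), ?_⟩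
    rw [← smul_du_add_smul_dv θ ω, ← smul_du_add_smul_dv θ η]
    simp only [smul_du_add_smul_dv_apply, map_add, FirstOrderCalculus.form_left]
    have e (i : Fin 2) (w : TwistedFree (twist θ)) (w' : (firstOrder θ).Wedge) (a b : Torus θ)
        (h : (firstOrder θ).form w * (firstOrder θ).fn b =
          (firstOrder θ).fn (twist θ i b) * (firstOrder θ).form w) :
        (firstOrder θ).fn a * (firstOrder θ).form w * ((firstOrder θ).fn b * w') =
        (firstOrder θ).fn (a * twist θ i b) * ((firstOrder θ).form w * w') := by
      rw [mul_assoc, ← mul_assoc ((firstOrder θ).form w), h, map_mul]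
      noncomm_ring
    rw [add_mul, mul_add, mul_add, e 0 _ _ _ _ (form_du_mul_fn θ _),
      e 0 _ _ _ _ (form_du_mul_fn θ _), e 1 _ _ _ _ (form_dv_mul_fn θ _),
      e 1 _ _ _ _ (form_dv_mul_fn θ _), form_du_mul_self, form_dv_mul_self, form_dv_mul_du,
      map_sub, sub_mul, map_smul]
    simp [sub_eq_add_neg]

/-- After all functions are moved to the left, every 3-form is a combination of `du ∧ dv ∧ du` and
`du ∧ dv ∧ dv`, each of which contains a vanishing square once reordered. -/
theorem deg_three_eq_bot : (firstOrder θ).deg 3 = ⊥ := by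
  rw [eq_bot_iff, FirstOrderCalculus.deg_succ, Submodule.mul_le]
  rintro _ hω _ ⟨η, rfl⟩
  obtain ⟨a, rfl⟩ := mem_deg_two θ hω
  have h1 : (firstOrder θ).form (du θ) * (firstOrder θ).form (dv θ) *
      (firstOrder θ).form (dv θ) = 0 := by
    rw [mul_assoc, form_dv_mul_self, mul_zero]
  have h2 : (firstOrder θ).form (du θ) * (firstOrder θ).form (dv θ) *
      (firstOrder θ).form (du θ) = 0 := by
    rw [mul_assoc, form_dv_mul_du, mul_neg, mul_smul_comm, ← mul_assoc, form_du_mul_self]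
    simp
  have h3 (b : Torus θ) : (firstOrder θ).form (du θ) * (firstOrder θ).form (dv θ) *
      (firstOrder θ).fn b = (firstOrder θ).fn (twist θ 0 (twist θ 1 b)) *
      ((firstOrder θ).form (du θ) * (firstOrder θ).form (dv θ)) := by
    rw [mul_assoc, form_dv_mul_fn, ← mul_assoc, form_du_mul_fn, mul_assoc]
  rw [← smul_du_add_smul_dv θ η, map_add, FirstOrderCalculus.form_left,
    FirstOrderCalculus.form_left, mul_assoc, mul_add, ← mul_assoc (_ * _) ((firstOrder θ).fn _),
    ← mul_assoc (_ * _) ((firstOrder θ).fn _), h3, h3, mul_assoc, mul_assoc (_) (_ * _), h1, h2]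
  simp

theorem twist_comm (a : Torus θ) : twist θ 0 (twist θ 1 a) = twist θ 1 (twist θ 0 a) := by
  have : (twist θ 0).comp (twist θ 1) = (twist θ 1).comp (twist θ 0) := by
    apply hom_ext <;>
      simp [twist_zero_u, twist_zero_v, twist_one_u, twist_one_v]
  exact DFunLike.congr_fun this a

theorem partial_one (i : Fin 2) : partialDeriv θ i 1 = 0 :=
  TwistedFree.map_one_eq_zero (partial_mul θ) i

theorem partial_algebraMap (i : Fin 2) (r : ℂ) : partialDeriv θ i (algebraMap ℂ _ r) = 0 := by
  rw [Algebra.algebraMap_eq_smul_one, map_smul, partial_one, smul_zero]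

theorem partial_zero_u : partialDeriv θ 0 (u θ) = 1 := partial_gen θ 0 0

theorem partial_zero_v : partialDeriv θ 0 (v θ) = 0 := partial_gen θ 0 1

theorem partial_one_u : partialDeriv θ 1 (u θ) = 0 := partial_gen θ 1 0

theorem partial_one_v : partialDeriv θ 1 (v θ) = 1 := partial_gen θ 1 1

theorem partial_zero_uInv : partialDeriv θ 0 (uInv θ) = -(uInv θ * uInv θ) := by
  simp [partialDeriv, upperRight_apply, matrixU, lift_uInv]

theorem partial_zero_vInv : partialDeriv θ 0 (vInv θ) = 0 := by
  simp [partialDeriv, upperRight_apply, matrixU, lift_vInv]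

theorem partial_one_uInv : partialDeriv θ 1 (uInv θ) = 0 := by
  simp [partialDeriv, upperRight_apply, matrixV, lift_uInv]

theorem partial_one_vInv : partialDeriv θ 1 (vInv θ) = -(vInv θ * vInv θ) := by
  simp [partialDeriv, upperRight_apply, matrixV, lift_vInv]

theorem twist_zero_uInv : twist θ 0 (uInv θ) = uInv θ := by
  simp [twist, rotate, lift_uInv, unitU]

theorem twist_zero_vInv : twist θ 0 (vInv θ) = (((phase θ)⁻¹ : ℂˣ) : ℂ) • vInv θ := by
  simp [twist, rotate, lift_vInv, unitV]

theorem twist_one_uInv : twist θ 1 (uInv θ) = (phase θ : ℂ) • uInv θ := by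
  simp [twist, rotate, lift_uInv, unitU]

theorem twist_one_vInv : twist θ 1 (vInv θ) = vInv θ := by
  simp [twist, rotate, lift_vInv, unitV]

/-- A chain rule: `σᵥ` rescales `u` by `e^{iθ}`, and `∂ᵤ` picks up that factor. -/
theorem partial_zero_twist_one (a : Torus θ) : partialDeriv θ 0 (twist θ 1 a) =
    (((phase θ)⁻¹ : ℂˣ) : ℂ) • twist θ 1 (partialDeriv θ 0 a) := by
  induction a using Torus.induction with
  | scalar r => simp [partial_algebraMap]
  | hu => simp [twist_one_u, partial_zero_u]
  | huInv => simp [twist_one_uInv, partial_zero_uInv, smul_smul]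
  | hv => simp [twist_one_v, partial_zero_v]
  | hvInv => simp [twist_one_vInv, partial_zero_vInv]
  | add a b ha hb => simp only [map_add, ha, hb, smul_add]
  | mul a b ha hb =>
    simp only [map_mul, partial_mul, map_add, ha, hb, smul_add, twist_comm, smul_mul_assoc,
      mul_smul_comm]

theorem partial_one_twist_zero (a : Torus θ) : partialDeriv θ 1 (twist θ 0 a) =
    (phase θ : ℂ) • twist θ 0 (partialDeriv θ 1 a) := by
  induction a using Torus.induction with
  | scalar r => simp [partial_algebraMap]
  | hu => simp [twist_zero_u, partial_one_u]
  | huInv => simp [twist_zero_uInv, partial_one_uInv]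
  | hv => simp [twist_zero_v, partial_one_v]
  | hvInv => simp [twist_zero_vInv, partial_one_vInv, smul_smul]
  | add a b ha hb => simp only [map_add, ha, hb, smul_add]
  | mul a b ha hb =>
    simp only [map_mul, partial_mul, map_add, ha, hb, smul_add, twist_comm, smul_mul_assoc,
      mul_smul_comm]

/-- This is `d² = 0` read off in the coefficient of `du ∧ dv`. On a product, the two cross terms of
the Leibniz expansions match by the chain rules for `∂ᵤ σᵥ` and `∂ᵥ σᵤ`, and the outer terms by
commutativity of the twists. -/
theorem partial_zero_partial_one (a : Torus θ) : partialDeriv θ 0 (partialDeriv θ 1 a) =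
    (((phase θ)⁻¹ : ℂˣ) : ℂ) • partialDeriv θ 1 (partialDeriv θ 0 a) := by
  induction a using Torus.induction with
  | scalar r => simp [partial_algebraMap]
  | hu => simp [partial_one_u, partial_zero_u, partial_one]
  | huInv => simp [partial_one_uInv, partial_zero_uInv, partial_mul]
  | hv => simp [partial_one_v, partial_zero_v, partial_one]
  | hvInv => simp [partial_one_vInv, partial_zero_vInv, partial_mul]
  | add a b ha hb => simp only [map_add, ha, hb, smul_add]
  | mul a b ha hb =>
    simp only [partial_mul, map_add, ha, hb, smul_add, twist_comm, smul_mul_assoc,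
      mul_smul_comm, partial_zero_twist_one, partial_one_twist_zero, smul_smul, Units.inv_mul,
      one_smul]
    abel

end Torus

/-! ### The classical case `p = 1` on `O(U(1))`. -/

namespace Circle1

open DifferentialCalculus

theorem twist_one (a : Circle1) : twist 1 a = a := by
  induction a using Circle1.induction with
  | scalar r => exact AlgHom.commutes _ r
  | ht => simp [twist_t]
  | htInv => simp [twist_tInv]
  | add a b ha hb => rw [map_add, ha, hb]
  | mul a b ha hb => rw [map_mul, ha, hb]

/-- At `p = 1` the twist is trivial and the algebra is commutative, so left and right actions on
1-forms agree. General `f` is needed since `d(t⁻¹)` occurs besides `dt`; the factor `1` fits the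
shape of `tensorD_mul_tensorIncl`. -/
theorem d_mul_incl_of_one (f g : Circle1) :
    (calculus 1).d ((calculus 1).incl f) * (calculus 1).incl g =
      (1 : ℂ) • ((calculus 1).incl g * (calculus 1).d ((calculus 1).incl f)) := by
  have h : MulOpposite.op g • (firstOrder 1).d f = g • (firstOrder 1).d f := by
    funext i
    rw [TwistedFree.op_smul_apply, TwistedFree.smul_apply, twist_one, mul_comm]
  have := (firstOrder 1).form_d_mul_fn h
  rw [← FirstOrderCalculus.dWedge_fn] at this
  rw [one_smul]
  exact this

end Circle1

/-! ### The matrix model for degree 2, and covariance and completeness of the torus. -/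

namespace Torus

open DifferentialCalculus

variable (θ : ℝ)

/-- Right multiplication by functions on the free left module on `1`, `du`, `dv`, `du ∧ dv`. -/
noncomputable def modelFn : Torus θ →ₐ[ℂ] Matrix (Fin 4) (Fin 4) (Torus θ) :=
  (Matrix.diagonalAlgHom ℂ).comp (AlgHom.pi
    ![AlgHom.id ℂ _, twist θ 0, twist θ 1, (twist θ 0).comp (twist θ 1)])

theorem modelFn_apply (a : Torus θ) : modelFn θ a =
    !![a, 0, 0, 0; 0, twist θ 0 a, 0, 0; 0, 0, twist θ 1 a, 0;
      0, 0, 0, twist θ 0 (twist θ 1 a)] := by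
  ext i j
  fin_cases i <;> fin_cases j <;> simp [modelFn]

/-- Right multiplication by 1-forms on the free left module on `1`, `du`, `dv`, `du ∧ dv`. -/
noncomputable def modelForm : TwistedFree (twist θ) →+ Matrix (Fin 4) (Fin 4) (Torus θ) where
  -- Each row lists the coordinates of a basis element times `ω`. The rows of `du` and `dv` come
  -- from `du ω₁ dv = σᵤ(ω₁) du ∧ dv` and `dv ω₀ du = -e^{iθ} σᵥ(ω₀) du ∧ dv`.
  toFun ω := !![0, ω 0, ω 1, 0; 0, 0, 0, twist θ 0 (ω 1);
    0, 0, 0, -((((phase θ)⁻¹ : ℂˣ) : ℂ) • twist θ 1 (ω 0)); 0, 0, 0, 0]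
  map_zero' := by
    have h (i : Fin 2) : (0 : TwistedFree (twist θ)) i = 0 := rfl
    ext i j
    fin_cases i <;> fin_cases j <;> simp [h]
  map_add' ω η := by
    have h (i : Fin 2) : (ω + η) i = ω i + η i := rfl
    ext i j
    fin_cases i <;> fin_cases j <;> simp [h, add_comm]

theorem modelForm_apply (ω : TwistedFree (twist θ)) : modelForm θ ω =
    !![0, ω 0, ω 1, 0; 0, 0, 0, twist θ 0 (ω 1);
    0, 0, 0, -((((phase θ)⁻¹ : ℂˣ) : ℂ) • twist θ 1 (ω 0)); 0, 0, 0, 0] := rfl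

theorem modelForm_mul (ω η : TwistedFree (twist θ)) : modelForm θ ω * modelForm θ η =
    Matrix.single 0 3 (ω 0 * twist θ 0 (η 1) -
      (((phase θ)⁻¹ : ℂˣ) : ℂ) • (ω 1 * twist θ 1 (η 0))) := by
  rw [modelForm_apply, modelForm_apply]
  ext i j
  fin_cases i <;> fin_cases j <;>
    simp [Matrix.mul_apply, Fin.sum_univ_four, Matrix.single, sub_eq_add_neg]

theorem firstOrder_d_apply (a : Torus θ) (i : Fin 2) :
    (firstOrder θ).d a i = partialDeriv θ i a := rfl

/-- The model respects `S^∧`: apply `∂ᵤ` to `∑ aᵢ ∂ᵥ bᵢ = 0` and `e^{iθ} ∂ᵥ` to `∑ aᵢ ∂ᵤ bᵢ = 0`,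
then subtract. The second order terms cancel by `partial_zero_partial_one`. -/
theorem sum_partial_eq_zero (n : ℕ) (a b : Fin n → Torus θ)
    (h : ∑ i, a i • (firstOrder θ).d (b i) = 0) :
    ∑ i, (partialDeriv θ 0 (a i) * twist θ 0 (partialDeriv θ 1 (b i)) -
      (((phase θ)⁻¹ : ℂˣ) : ℂ) • (partialDeriv θ 1 (a i) * twist θ 1 (partialDeriv θ 0 (b i)))) = 0 := by
  have hj (j : Fin 2) : ∑ i, a i * partialDeriv θ j (b i) = 0 := by
    have h' : (∑ i, a i • (firstOrder θ).d (b i)) j = ∑ i, a i * partialDeriv θ j (b i) :=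
      Finset.sum_apply (M := fun _ => Torus θ) j _ _
    exact h'.symm.trans (congrFun h j)
  have h0 := congrArg (partialDeriv θ 0) (hj 1)
  have h1 := congrArg (fun x => (((phase θ)⁻¹ : ℂˣ) : ℂ) • partialDeriv θ 1 x) (hj 0)
  simp only [map_sum, partial_mul, map_zero, smul_zero, Finset.smul_sum, smul_add] at h0 h1
  have h2 := congrArg₂ (· - ·) h0 h1
  simp only [sub_zero, ← Finset.sum_sub_distrib] at h2
  rw [← h2]
  refine Finset.sum_congr rfl fun i _ => ?_
  rw [partial_zero_partial_one, mul_smul_comm]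
  abel

/-- The model is a representation of the prolongation, and the entry `(0, 3)` of the matrix of `a du
∧ dv` is `a` itself, so the coefficient can be recovered. -/
theorem fn_mul_du_mul_dv_injective {a b : Torus θ}
    (h : (firstOrder θ).fn a * ((firstOrder θ).form (du θ) * (firstOrder θ).form (dv θ)) =
      (firstOrder θ).fn b * ((firstOrder θ).form (du θ) * (firstOrder θ).form (dv θ))) :
    a = b := by
  have hl (a : Torus θ) (ω : TwistedFree (twist θ)) :
      modelForm θ (a • ω) = modelFn θ a * modelForm θ ω := by
    rw [modelForm_apply, modelForm_apply, modelFn_apply]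
    simp only [TwistedFree.smul_apply]
    ext i j
    fin_cases i <;> fin_cases j <;>
      simp [Matrix.mul_apply, Fin.sum_univ_four]
  have hr (a : Torus θ) (ω : TwistedFree (twist θ)) :
      modelForm θ (MulOpposite.op a • ω) = modelForm θ ω * modelFn θ a := by
    rw [modelForm_apply, modelForm_apply, modelFn_apply]
    simp only [TwistedFree.op_smul_apply]
    ext i j
    fin_cases i <;> fin_cases j <;>
      simp [Matrix.mul_apply, Fin.sum_univ_four, twist_comm]
  have hw (n : ℕ) (a b : Fin n → Torus θ) (h : ∑ i, a i • (firstOrder θ).d (b i) = 0) :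
      ∑ i, modelForm θ ((firstOrder θ).d (a i)) * modelForm θ ((firstOrder θ).d (b i)) = 0 := by
    simp only [modelForm_mul, firstOrder_d_apply]
    exact (map_sum (Matrix.singleAddMonoidHom (α := Torus θ) (0 : Fin 4) (3 : Fin 4)) _
      Finset.univ).symm.trans
        ((congrArg _ (sum_partial_eq_zero θ n a b h)).trans (map_zero _))
  have key (a : Torus θ) : (firstOrder θ).lift (modelFn θ) (modelForm θ) hl hr hw
      ((firstOrder θ).fn a * ((firstOrder θ).form (du θ) * (firstOrder θ).form (dv θ))) 0 3 = a := by
    rw [map_mul, map_mul, FirstOrderCalculus.lift_fn, FirstOrderCalculus.lift_form,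
      FirstOrderCalculus.lift_form, modelForm_mul, modelFn_apply]
    simp [Matrix.mul_apply, Matrix.single, du, dv, firstOrder_d_apply,
      partial_zero_u, partial_one_u, partial_one_v]
  rw [← key a, h, key b]

theorem coaction_u : coaction θ (u θ) = u θ ⊗ₜ Circle1.t := lift_u ..

theorem coaction_v : coaction θ (v θ) = v θ ⊗ₜ Circle1.tInv := lift_v ..

theorem isRightCoaction : IsRightCoaction (coaction θ) where
  coassoc := by
    have key : ((Algebra.TensorProduct.assoc ℂ ℂ ℂ (Torus θ) Circle1 Circle1).toAlgHom.comp
        (Algebra.TensorProduct.map (coaction θ) (AlgHom.id ℂ Circle1))).comp (coaction θ) =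
        (Algebra.TensorProduct.map (AlgHom.id ℂ (Torus θ))
          (Bialgebra.comulAlgHom ℂ Circle1)).comp (coaction θ) := by
      apply hom_ext
      · simp [coaction_u, Circle1.t]
      · simp [coaction_v, Circle1.tInv]
    exact fun x => DFunLike.congr_fun key x
  counit := by
    have key : (Algebra.TensorProduct.map (AlgHom.id ℂ (Torus θ))
        (Bialgebra.counitAlgHom ℂ Circle1)).comp (coaction θ) =
        Algebra.TensorProduct.includeLeft := by
      apply hom_ext
      · simp [coaction_u, Circle1.t]
      · simp [coaction_v, Circle1.tInv]
    exact fun x => DFunLike.congr_fun key x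

theorem d_u_mul_incl (a : Torus θ) : (calculus θ).d ((calculus θ).incl (u θ)) *
    (calculus θ).incl a = (calculus θ).incl (twist θ 0 a) *
      (calculus θ).d ((calculus θ).incl (u θ)) := by
  have := form_du_mul_fn θ a
  rwa [du, ← FirstOrderCalculus.dWedge_fn] at this

theorem d_v_mul_incl (a : Torus θ) : (calculus θ).d ((calculus θ).incl (v θ)) *
    (calculus θ).incl a = (calculus θ).incl (twist θ 1 a) *
      (calculus θ).d ((calculus θ).incl (v θ)) := by
  have := form_dv_mul_fn θ a
  rwa [dv, ← FirstOrderCalculus.dWedge_fn] at this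

theorem d_u_mul_u : (calculus θ).d ((calculus θ).incl (u θ)) * (calculus θ).incl (u θ) =
    (calculus θ).incl (u θ) * (calculus θ).d ((calculus θ).incl (u θ)) := by
  rw [d_u_mul_incl, twist_zero_u]

theorem d_u_mul_v : (calculus θ).d ((calculus θ).incl (u θ)) * (calculus θ).incl (v θ) =
    (phase θ : ℂ) • ((calculus θ).incl (v θ) * (calculus θ).d ((calculus θ).incl (u θ))) := by
  rw [d_u_mul_incl, twist_zero_v, map_smul, smul_mul_assoc]

theorem d_v_mul_u : (calculus θ).d ((calculus θ).incl (v θ)) * (calculus θ).incl (u θ) =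
    (((phase θ)⁻¹ : ℂˣ) : ℂ) •
      ((calculus θ).incl (u θ) * (calculus θ).d ((calculus θ).incl (v θ))) := by
  rw [d_v_mul_incl, twist_one_u, map_smul, smul_mul_assoc]

theorem d_v_mul_v : (calculus θ).d ((calculus θ).incl (v θ)) * (calculus θ).incl (v θ) =
    (calculus θ).incl (v θ) * (calculus θ).d ((calculus θ).incl (v θ)) := by
  rw [d_v_mul_incl, twist_one_v]

/-- Only `Ω(A)` is differentiated, and the legs in `H` commute, so each of the four relations is
reproduced with its own factor. -/
theorem isRightCovariant : IsRightCovariant (coaction θ) (calculus θ) := by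
  have hmul (x y : Torus θ) (g h : Circle1) (r : ℂ)
      (H : (calculus θ).d ((calculus θ).incl x) * (calculus θ).incl y =
        r • ((calculus θ).incl y * (calculus θ).d ((calculus θ).incl x))) :
      (firstOrder θ).dWedge.rTensor Circle1 (Algebra.TensorProduct.map (firstOrder θ).fn
        (AlgHom.id ℂ Circle1) (x ⊗ₜ g)) * Algebra.TensorProduct.map (firstOrder θ).fn
        (AlgHom.id ℂ Circle1) (y ⊗ₜ h) =
      r • (Algebra.TensorProduct.map (firstOrder θ).fn (AlgHom.id ℂ Circle1) (y ⊗ₜ h) *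
        (firstOrder θ).dWedge.rTensor Circle1 (Algebra.TensorProduct.map (firstOrder θ).fn
        (AlgHom.id ℂ Circle1) (x ⊗ₜ g))) := by
    have H' : (firstOrder θ).dWedge ((firstOrder θ).fn x) * (firstOrder θ).fn y =
      r • ((firstOrder θ).fn y * (firstOrder θ).dWedge ((firstOrder θ).fn x)) := H
    simp only [Algebra.TensorProduct.map_tmul, LinearMap.rTensor_tmul,
      Algebra.TensorProduct.tmul_mul_tmul, AlgHom.id_apply, H', TensorProduct.smul_tmul',
      mul_comm h g]
  refine TwistedFree.exists_isRightCovariantCoaction (twist θ) (partialDeriv θ) (partial_mul θ) _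
    (partial_gen θ) (isRightCoaction θ) _
    (compat θ (fun a b => (firstOrder θ).rTensor_dWedge_mul _ _) ?_ ?_ ?_ ?_)
  · simp only [AlgHom.comp_apply, coaction_u]
    exact (hmul _ _ _ _ 1 (by rw [one_smul]; exact d_u_mul_u θ)).trans (one_smul _ _)
  · simp only [AlgHom.comp_apply, coaction_u, coaction_v]
    exact hmul _ _ _ _ _ (d_u_mul_v θ)
  · simp only [AlgHom.comp_apply, coaction_u, coaction_v]
    exact hmul _ _ _ _ _ (d_v_mul_u θ)
  · simp only [AlgHom.comp_apply, coaction_v]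
    exact (hmul _ _ _ _ 1 (by rw [one_smul]; exact d_v_mul_v θ)).trans (one_smul _ _)

/-- In each of the four relations the functions and the form commute with the same factor, `s = r`.
The condition `s s' = r` then asks that `dt` and `d(t⁻¹)` commute with `t` and `t⁻¹` without a
factor, as they do for `p = 1`. -/
theorem isComplete : IsComplete (coaction θ) (calculus θ) (Circle1.calculus 1) := by
  refine TwistedFree.isComplete (twist θ) (partialDeriv θ) (partial_mul θ) _ (partial_gen θ) _ _
    (compat θ (fun a b => FirstOrderCalculus.tensorD_tensorIncl_mul _ _ _ _) ?_ ?_ ?_ ?_)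
  · simp only [AlgHom.comp_apply, coaction_u, tensorInclHom_apply]
    exact (tensorD_mul_tensorIncl (r := 1) (s := 1) (one_smul _ _).symm (mul_comm _ _)
      ((d_u_mul_u θ).trans (one_smul _ _).symm) (Circle1.d_mul_incl_of_one _ _)
      (one_mul _)).trans (one_smul _ _)
  · simp only [AlgHom.comp_apply, coaction_u, coaction_v, tensorInclHom_apply]
    exact tensorD_mul_tensorIncl (u_v θ) (mul_comm _ _) (d_u_mul_v θ) (Circle1.d_mul_incl_of_one _ _)
      (mul_one _)
  · simp only [AlgHom.comp_apply, coaction_u, coaction_v, tensorInclHom_apply]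
    exact tensorD_mul_tensorIncl (v_u θ) (mul_comm _ _) (d_v_mul_u θ) (Circle1.d_mul_incl_of_one _ _)
      (mul_one _)
  · simp only [AlgHom.comp_apply, coaction_v, tensorInclHom_apply]
    exact (tensorD_mul_tensorIncl (r := 1) (s := 1) (one_smul _ _).symm (mul_comm _ _)
      ((d_v_mul_v θ).trans (one_smul _ _).symm) (Circle1.d_mul_incl_of_one _ _)
      (one_mul _)).trans (one_smul _ _)

end Torus

/-! ### Uniqueness of the lift, and bases of the 1-forms and 2-forms on the torus. -/

namespace Torus

open DifferentialCalculus

variable (θ : ℝ)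

theorem existsUnique_isCoactionLift :
    ∃! Φ : (calculus θ).Form →ₐ[ℂ] (calculus θ).Tensor (Circle1.calculus 1),
      IsCoactionLift (coaction θ) (calculus θ) (Circle1.calculus 1) Φ := by
  obtain ⟨Φ, hΦ⟩ := isComplete θ
  exact ⟨Φ, hΦ, fun Φ' hΦ' => isCoactionLift_unique hΦ' hΦ⟩

theorem exp_eq_phase : Complex.exp (-(θ * Complex.I)) = (phase θ : ℂ) := rfl

theorem exp_eq_phase_inv : Complex.exp (θ * Complex.I) = ((phase θ)⁻¹ : ℂˣ) := by
  rw [Units.val_inv_eq_inv_val, ← exp_eq_phase, ← Complex.exp_neg, neg_neg]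

theorem existsUnique_grade_one (ω : (calculus θ).Form) (hω : ω ∈ (calculus θ).grade 1) :
    ∃! a : Torus θ × Torus θ, ω = (calculus θ).incl a.1 * (calculus θ).d ((calculus θ).incl (u θ)) +
      (calculus θ).incl a.2 * (calculus θ).d ((calculus θ).incl (v θ)) := by
  obtain ⟨ω, rfl⟩ := (firstOrder θ).mem_deg_one.1 hω
  have h (a b : Torus θ) : (calculus θ).incl a * (calculus θ).d ((calculus θ).incl (u θ)) +
      (calculus θ).incl b * (calculus θ).d ((calculus θ).incl (v θ)) =
      (firstOrder θ).form (a • du θ + b • dv θ) := by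
    rw [map_add, FirstOrderCalculus.form_left, FirstOrderCalculus.form_left, du, dv,
      ← FirstOrderCalculus.dWedge_fn, ← FirstOrderCalculus.dWedge_fn]
    rfl
  simp only [h]
  refine ⟨(ω 0, ω 1), congrArg _ (smul_du_add_smul_dv θ ω).symm, ?_⟩
  rintro ⟨a, b⟩ hab
  rw [(firstOrder θ).form_injective hab, (smul_du_add_smul_dv_apply θ a b).1,
    (smul_du_add_smul_dv_apply θ a b).2]

theorem d_u_mul_d_v_eq : (calculus θ).d ((calculus θ).incl (u θ)) *
    (calculus θ).d ((calculus θ).incl (v θ)) =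
    (firstOrder θ).form (du θ) * (firstOrder θ).form (dv θ) := by
  rw [du, dv, ← FirstOrderCalculus.dWedge_fn, ← FirstOrderCalculus.dWedge_fn]
  rfl

theorem existsUnique_grade_two (ω : (calculus θ).Form) (hω : ω ∈ (calculus θ).grade 2) :
    ∃! a : Torus θ, ω = (calculus θ).incl a * ((calculus θ).d ((calculus θ).incl (u θ)) *
      (calculus θ).d ((calculus θ).incl (v θ))) := by
  rw [d_u_mul_d_v_eq]
  obtain ⟨a, rfl⟩ := mem_deg_two θ hω
  exact ⟨a, rfl, fun b hb => (fn_mul_du_mul_dv_injective θ hb).symm⟩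

end Torus

/-! ### Explicit components of the lift in degrees 1 and 2. -/

namespace DifferentialCalculus

variable {k A H : Type u} [Field k] [Ring A] [Algebra k A] [Ring H] [Algebra k H]
  {Ω : DifferentialCalculus k A} {Ω' : DifferentialCalculus k H} {Δ : A →ₐ[k] A ⊗[k] H}
  {Φ : Ω.Form →ₐ[k] Ω.Tensor Ω'}

theorem IsCoactionLift.map_d_incl (hΦ : IsCoactionLift Δ Ω Ω' Φ) {x : A} {g : H}
    (hx : Δ x = x ⊗ₜ g) : Φ (Ω.d (Ω.incl x)) = (Ω.d (Ω.incl x)) ᵍ⊗ₜ[k] (Ω'.incl g) +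
      (Ω.incl x) ᵍ⊗ₜ[k] (Ω'.d (Ω'.incl g)) := by
  rw [hΦ.map_d, hΦ.map_incl, hx, tensorIncl_tmul, tensorD_tmul (Ω.incl_mem x), pow_zero, one_smul]

theorem IsCoactionLift.eq_component_add_of_grade_one (hΦ : IsCoactionLift Δ Ω Ω' Φ) {ω : Ω.Form}
    (hω : ω ∈ Ω.grade 1) : Φ ω = component Φ 1 0 ω + component Φ 0 1 ω := by
  refine (sum_biproj (hΦ.map_grade 1 ω hω)).trans ?_
  rw [Finset.Nat.sum_antidiagonal_eq_sum_range_succ_mk, Finset.sum_range_succ, Finset.sum_range_one,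
    add_comm]
  rfl

theorem component_eq_zero_of_grade_eq_bot {j : ℕ} (h : Ω'.grade j = ⊥) (i : ℕ) (ω : Ω.Form) :
    component Φ i j ω = 0 := by
  rw [component_apply]
  induction Φ ω using tensor_induction with
  | add x y hx hy => rw [map_add, hx, hy, add_zero]
  | tmul i' j' ω η hω hη =>
    have : GradedAlgebra.proj Ω'.grade j η = 0 := by
      rw [← Submodule.mem_bot k, ← h, GradedAlgebra.proj_apply]
      exact SetLike.coe_mem _
    rw [biproj_tmul, this]
    simp [GradedTensorProduct.tmul]

theorem IsCoactionLift.eq_component_add_of_grade_two (hΦ : IsCoactionLift Δ Ω Ω' Φ) {ω : Ω.Form}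
    (hω : ω ∈ Ω.grade 2) (h : Ω'.grade 2 = ⊥) :
    Φ ω = component Φ 2 0 ω + component Φ 1 1 ω := by
  refine (sum_biproj (hΦ.map_grade 2 ω hω)).trans ?_
  rw [Finset.Nat.sum_antidiagonal_eq_sum_range_succ_mk, Finset.sum_range_succ,
    Finset.sum_range_succ, Finset.sum_range_one]
  simp only [← component_apply]
  rw [component_eq_zero_of_grade_eq_bot h, zero_add, add_comm]

theorem IsCoactionLift.component_grade_one (hΦ : IsCoactionLift Δ Ω Ω' Φ) {x y : A} {g h : H}
    (hx : Δ x = x ⊗ₜ g) (hy : Δ y = y ⊗ₜ h) (a b : A) :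
    component Φ 1 0 (Ω.incl a * Ω.d (Ω.incl x) + Ω.incl b * Ω.d (Ω.incl y)) =
      Ω.tensorIncl Ω' (Δ a) * ((Ω.d (Ω.incl x)) ᵍ⊗ₜ[k] (Ω'.incl g)) +
      Ω.tensorIncl Ω' (Δ b) * ((Ω.d (Ω.incl y)) ᵍ⊗ₜ[k] (Ω'.incl h)) ∧
    component Φ 0 1 (Ω.incl a * Ω.d (Ω.incl x) + Ω.incl b * Ω.d (Ω.incl y)) =
      Ω.tensorIncl Ω' (Δ a) * ((Ω.incl x) ᵍ⊗ₜ[k] (Ω'.d (Ω'.incl g))) +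
      Ω.tensorIncl Ω' (Δ b) * ((Ω.incl y) ᵍ⊗ₜ[k] (Ω'.d (Ω'.incl h))) := by
  have h1 (a x : A) (g : H) := tensorIncl_mul_mem_bigrade (Ω := Ω) (Ω' := Ω') (Δ a)
    (tmul_mem_bigrade (Ω.d_incl_mem x) (Ω'.incl_mem g))
  have h2 (a x : A) (g : H) := tensorIncl_mul_mem_bigrade (Ω := Ω) (Ω' := Ω') (Δ a)
    (tmul_mem_bigrade (Ω.incl_mem x) (Ω'.d_incl_mem g))
  simp only [component_apply, map_add, map_mul, hΦ.map_incl, hΦ.map_d_incl hx, hΦ.map_d_incl hy,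
    mul_add, biproj_of_mem (h1 _ _ _), biproj_of_mem (h2 _ _ _),
    biproj_of_mem_ne (h1 _ _ _) (Or.inl one_ne_zero),
    biproj_of_mem_ne (h2 _ _ _) (Or.inl zero_ne_one), add_zero, zero_add, and_self]

/-- Multiply `dx ⊗ g + x ⊗ dg` by `dy ⊗ h + y ⊗ dh` and sort by bidegree; multiplication by the
image of a function does not change the bidegree. -/
theorem IsCoactionLift.component_grade_two (hΦ : IsCoactionLift Δ Ω Ω' Φ) {x y : A} {g h : H}
    (hx : Δ x = x ⊗ₜ g) (hy : Δ y = y ⊗ₜ h) (hgh : g * h = 1) (hbot : Ω'.grade 2 = ⊥) (a : A) :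
    component Φ 2 0 (Ω.incl a * (Ω.d (Ω.incl x) * Ω.d (Ω.incl y))) =
      Ω.tensorIncl Ω' (Δ a) * ((Ω.d (Ω.incl x) * Ω.d (Ω.incl y)) ᵍ⊗ₜ[k] (1 : Ω'.Form)) ∧
    component Φ 1 1 (Ω.incl a * (Ω.d (Ω.incl x) * Ω.d (Ω.incl y))) =
      Ω.tensorIncl Ω' (Δ a) * ((Ω.d (Ω.incl x) * Ω.incl y) ᵍ⊗ₜ[k]
        (Ω'.incl g * Ω'.d (Ω'.incl h)) -
        (Ω.incl x * Ω.d (Ω.incl y)) ᵍ⊗ₜ[k] (Ω'.d (Ω'.incl g) * Ω'.incl h)) := by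
  have hzero : Ω'.d (Ω'.incl g) * Ω'.d (Ω'.incl h) = 0 := by
    rw [← Submodule.mem_bot k, ← hbot]
    exact SetLike.mul_mem_graded (Ω'.d_incl_mem g) (Ω'.d_incl_mem h)
  have hm1 : (Ω.d (Ω.incl x) * Ω.d (Ω.incl y)) ᵍ⊗ₜ[k] (1 : Ω'.Form) ∈ Ω.bigrade Ω' 2 0 :=
    tmul_mem_bigrade (SetLike.mul_mem_graded (Ω.d_incl_mem x) (Ω.d_incl_mem y))
      SetLike.GradedOne.one_mem
  have hm2 : (Ω.d (Ω.incl x) * Ω.incl y) ᵍ⊗ₜ[k] (Ω'.incl g * Ω'.d (Ω'.incl h)) -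
      (Ω.incl x * Ω.d (Ω.incl y)) ᵍ⊗ₜ[k] (Ω'.d (Ω'.incl g) * Ω'.incl h) ∈ Ω.bigrade Ω' 1 1 :=
    sub_mem (tmul_mem_bigrade (SetLike.mul_mem_graded (Ω.d_incl_mem x) (Ω.incl_mem y))
        (SetLike.mul_mem_graded (Ω'.incl_mem g) (Ω'.d_incl_mem h)))
      (tmul_mem_bigrade (SetLike.mul_mem_graded (Ω.incl_mem x) (Ω.d_incl_mem y))
        (SetLike.mul_mem_graded (Ω'.d_incl_mem g) (Ω'.incl_mem h)))
  -- The minus sign is the Koszul sign of moving `dg` past `dy`. The term `dx ∧ dy ⊗ gh` ends in `1`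
  -- because `g h = 1`, and the term with `dg ∧ dh` vanishes for lack of 2-forms.
  have hΦω : Φ (Ω.d (Ω.incl x) * Ω.d (Ω.incl y)) =
      (Ω.d (Ω.incl x) * Ω.d (Ω.incl y)) ᵍ⊗ₜ[k] (1 : Ω'.Form) +
      ((Ω.d (Ω.incl x) * Ω.incl y) ᵍ⊗ₜ[k] (Ω'.incl g * Ω'.d (Ω'.incl h)) -
        (Ω.incl x * Ω.d (Ω.incl y)) ᵍ⊗ₜ[k] (Ω'.d (Ω'.incl g) * Ω'.incl h)) := by
    rw [map_mul, hΦ.map_d_incl hx, hΦ.map_d_incl hy, add_mul, mul_add, mul_add,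
      tmul_mul_tmul_of_left (Ω'.incl_mem g), tmul_mul_tmul_of_left (Ω'.incl_mem g),
      tmul_mul_tmul_of_right (Ω.incl_mem y), hzero,
      tmul_mul_tmul _ _ (Ω'.d_incl_mem g) (Ω.d_incl_mem y), ← map_mul Ω'.incl, hgh, map_one]
    simp only [GradedTensorProduct.tmul, TensorProduct.tmul_zero, map_zero, add_zero, mul_one,
      pow_one, neg_smul, one_smul]
    abel
  rw [component_apply, component_apply, map_mul, hΦω, hΦ.map_incl, mul_add, map_add, map_add,
    biproj_of_mem (tensorIncl_mul_mem_bigrade _ hm1),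
    biproj_of_mem (tensorIncl_mul_mem_bigrade _ hm2),
    biproj_of_mem_ne (tensorIncl_mul_mem_bigrade _ hm1) (Or.inl (by norm_num)),
    biproj_of_mem_ne (tensorIncl_mul_mem_bigrade _ hm2) (Or.inl (by norm_num)), add_zero, zero_add]
  exact ⟨rfl, rfl⟩

end DifferentialCalculus

theorem mainTheorem8 (θ : ℝ) :
    -- The calculus on `O(U(1))` with `t dt = p dt t`, where `p = q ^ α`.
    (∀ p : ℂˣ,
      let Ω := Circle1.calculus p
      let t : Ω.Form := Ω.incl Circle1.t
      let tInv : Ω.Form := Ω.incl Circle1.tInv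
      let dt : Ω.Form := Ω.d t
      t * dt = (p : ℂ) • (dt * t) ∧
      tInv * dt = ((p⁻¹ : ℂˣ) : ℂ) • (dt * tInv) ∧
      dt * dt = -((p : ℂ) • (dt * dt)) ∧
      (∀ ω ∈ Ω.grade 1, ∃! f : Circle1, ω = Ω.incl f * dt) ∧
      ((p : ℂ) ≠ -1 → dt * dt = 0 ∧ ∀ k ≥ 2, Ω.grade k = ⊥) ∧
      Ω.IsBicovariant ∧
      ∃! Φ : Ω.Form →ₐ[ℂ] Ω.Tensor Ω,
        DifferentialCalculus.IsCoactionLift (Bialgebra.comulAlgHom ℂ Circle1) Ω Ω Φ) ∧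
    -- The calculus on `O_θ(𝕋²)`.
    (let Ω := Torus.calculus θ
      let u : Ω.Form := Ω.incl (Torus.u θ)
      let v : Ω.Form := Ω.incl (Torus.v θ)
      let du : Ω.Form := Ω.d u
      let dv : Ω.Form := Ω.d v
      du * u = u * du ∧
      dv * v = v * dv ∧
      du * v = Complex.exp (-(θ * Complex.I)) • (v * du) ∧
      dv * u = Complex.exp (θ * Complex.I) • (u * dv) ∧
      du * dv + Complex.exp (-(θ * Complex.I)) • (dv * du) = 0 ∧
      du * du = 0 ∧
      dv * dv = 0 ∧
      (∀ ω ∈ Ω.grade 1, ∃! a : Torus θ × Torus θ, ω = Ω.incl a.1 * du + Ω.incl a.2 * dv) ∧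
      (∀ ω ∈ Ω.grade 2, ∃! a : Torus θ, ω = Ω.incl a * (du * dv)) ∧
      (∀ k ≥ 3, Ω.grade k = ⊥) ∧
      DifferentialCalculus.IsRightCoaction (Torus.coaction θ) ∧
      DifferentialCalculus.IsRightCovariant (Torus.coaction θ) Ω) ∧
    -- Completeness, with the calculus on `O(U(1))` in which `t dt = dt t`.
    (let Ω := Torus.calculus θ
      let Ω' := Circle1.calculus 1
      let u : Ω.Form := Ω.incl (Torus.u θ)
      let v : Ω.Form := Ω.incl (Torus.v θ)
      let du : Ω.Form := Ω.d u
      let dv : Ω.Form := Ω.d v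
      let t : Ω'.Form := Ω'.incl Circle1.t
      let tInv : Ω'.Form := Ω'.incl Circle1.tInv
      let dt : Ω'.Form := Ω'.d t
      let dtInv : Ω'.Form := Ω'.d tInv
      let Δ : Torus θ → Ω.Tensor Ω' := fun a => Ω.tensorIncl Ω' (Torus.coaction θ a)
      DifferentialCalculus.IsComplete (Torus.coaction θ) Ω Ω' ∧
      (∃! Φ : Ω.Form →ₐ[ℂ] Ω.Tensor Ω',
        DifferentialCalculus.IsCoactionLift (Torus.coaction θ) Ω Ω' Φ) ∧
      ∀ Φ : Ω.Form →ₐ[ℂ] Ω.Tensor Ω',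
        DifferentialCalculus.IsCoactionLift (Torus.coaction θ) Ω Ω' Φ →
        (∃ Ψ : Ω.Form →ₐ[ℂ] Ω.Form ⊗[ℂ] Circle1,
          DifferentialCalculus.IsRightCovariantCoaction (Torus.coaction θ) Ω Ψ ∧
          ∀ k, ∀ ω ∈ Ω.grade k,
            DifferentialCalculus.component Φ k 0 ω = Ω.tensorInclRight Ω' (Ψ ω)) ∧
        (∀ ω ∈ Ω.grade 1, Φ ω =
          DifferentialCalculus.component Φ 1 0 ω + DifferentialCalculus.component Φ 0 1 ω) ∧
        (∀ ω ∈ Ω.grade 2, Φ ω =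
          DifferentialCalculus.component Φ 2 0 ω + DifferentialCalculus.component Φ 1 1 ω) ∧
        (∀ a b : Torus θ,
          DifferentialCalculus.component Φ 1 0 (Ω.incl a * du + Ω.incl b * dv) =
            Δ a * (du ᵍ⊗ₜ[ℂ] t) + Δ b * (dv ᵍ⊗ₜ[ℂ] tInv) ∧
          DifferentialCalculus.component Φ 0 1 (Ω.incl a * du + Ω.incl b * dv) =
            Δ a * (u ᵍ⊗ₜ[ℂ] dt) + Δ b * (v ᵍ⊗ₜ[ℂ] dtInv)) ∧
        (∀ a : Torus θ,
          DifferentialCalculus.component Φ 2 0 (Ω.incl a * (du * dv)) =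
            Δ a * ((du * dv) ᵍ⊗ₜ[ℂ] (1 : Ω'.Form)) ∧
          DifferentialCalculus.component Φ 1 1 (Ω.incl a * (du * dv)) =
            Δ a * ((du * v) ᵍ⊗ₜ[ℂ] (t * dtInv) - (u * dv) ᵍ⊗ₜ[ℂ] (dt * tInv)) ∧
          DifferentialCalculus.component Φ 0 2 (Ω.incl a * (du * dv)) = 0)) := by
  -- At `p = 1 ≠ -1` there are no 2-forms on `O(U(1))`; this removes every component with second
  -- degree 2.
  have hbot : (Circle1.calculus 1).grade 2 = ⊥ :=
    Circle1.deg_two_eq_bot 1 (by rw [Units.val_one]; norm_num)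
  refine ⟨fun p => ⟨?_, ?_, ?_, Circle1.existsUnique_eq_mul_dt p, fun hp => ⟨?_, fun k hk => ?_⟩,
    Circle1.isBicovariant p, Circle1.existsUnique_isCoactionLift p⟩, ?_, ?_⟩
  · rw [Circle1.d_t_mul_t, smul_smul, Units.mul_inv, one_smul]
  · rw [Circle1.d_t_mul_tInv, smul_smul, Units.inv_mul, one_smul]
  · have := Circle1.form_d_t_mul_self p
    rwa [← FirstOrderCalculus.dWedge_fn] at this
  · have := Circle1.form_d_t_mul_self_eq_zero p hp
    rwa [← FirstOrderCalculus.dWedge_fn] at this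
  · exact (Circle1.firstOrder p).deg_eq_bot_of_le (Circle1.deg_two_eq_bot p hp) hk
  · rw [Torus.exp_eq_phase, Torus.exp_eq_phase_inv]
    refine ⟨Torus.d_u_mul_u θ, Torus.d_v_mul_v θ, Torus.d_u_mul_v θ, Torus.d_v_mul_u θ, ?_, ?_, ?_,
      Torus.existsUnique_grade_one θ, Torus.existsUnique_grade_two θ,
      fun k hk => (Torus.firstOrder θ).deg_eq_bot_of_le (Torus.deg_three_eq_bot θ) hk,
      Torus.isRightCoaction θ, Torus.isRightCovariant θ⟩
    · have := Torus.form_du_mul_dv θ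
      rw [eq_neg_iff_add_eq_zero, Torus.du, Torus.dv, ← FirstOrderCalculus.dWedge_fn,
        ← FirstOrderCalculus.dWedge_fn] at this
      exact this
    · have := Torus.form_du_mul_self θ
      rwa [Torus.du, ← FirstOrderCalculus.dWedge_fn] at this
    · have := Torus.form_dv_mul_self θ
      rwa [Torus.dv, ← FirstOrderCalculus.dWedge_fn] at this
  · refine ⟨Torus.isComplete θ, Torus.existsUnique_isCoactionLift θ,
      fun Φ hΦ => ⟨?_, ?_, ?_, ?_, ?_⟩⟩
    · obtain ⟨Ψ, hΨ⟩ := Torus.isRightCovariant θ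
      exact ⟨Ψ, hΨ, fun k ω hω => DifferentialCalculus.component_zero_right hΦ hΨ k ω hω⟩
    · exact fun ω hω => hΦ.eq_component_add_of_grade_one hω
    · exact fun ω hω => hΦ.eq_component_add_of_grade_two hω hbot
    · exact hΦ.component_grade_one (Torus.coaction_u θ) (Torus.coaction_v θ)
    · intro a
      have h := hΦ.component_grade_two (Torus.coaction_u θ) (Torus.coaction_v θ)
        Circle1.t_mul_tInv hbot a
      exact ⟨h.1, h.2, DifferentialCalculus.component_eq_zero_of_grade_eq_bot hbot _ _⟩
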